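/- **Notation.** $(a)_n=a(a+1)\cdots(a+n-1)$. For $n=2e+p$ with $p\in\{0,1\}$ and $g=\rho_1+\rho_2-r_1-r_2$, the monic Bannai-Ito polynomial $B_n(x;\rho_1,\rho_2,r_1,r_2)$ is $$B_n(x)=\eta_n\Big[{}_4F_3\Big({-e,\ e+g+1,\ x-r_1+\frac12,\ -x-r_1+\frac12\atop 1-r_1-r_2,\ \rho_1-r_1+\frac12,\ \rho_2-r_1+\frac12};1\Big)+\frac{(-1)^n(e+p+gp)(x-r_1+\frac12)}{(\rho_1-r_1+\frac12)(\rho_2-r_1+\frac12)}\,{}_4F_3\Big({-e-p+1,\ e+p+g+1,\ x-r_1+\frac32,\ -x-r_1+\frac12\atop 1-r_1-r_2,\ \rho_1-r_1+\frac32,\ \rho_2-r_1+\frac32};1\Big)\Big],$$ $$\eta_n=(-1)^n\frac{(\rho_1-r_1+\frac12)_{e+p}(\rho_2-r_1+\frac12)_{e+p}(1-r_1-r_2)_e}{(e+g+1)_{e+p}},$$ where the lower Pochhammer symbols of the series are cancelled against $\eta_n$, so that the only parameter denominator left is $(e+g+1)_{e+p}$ (and $B_0=1$). For complex parameters $\alpha,\beta,\gamma,\delta,\epsilon$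 and $n_1,n_2\in\mathbb N$, with $\pi_n=1$ for $n$ even and $\pi_n=0$ for $n$ odd, the untruncated bivariate Bannai-Ito polynomials are $$B_{n_1,n_2}(z_1,z_2)=B_{n_1}\big(z_1-\tfrac14;\beta,z_2+\epsilon-\tfrac14,\alpha,z_2-\epsilon+\tfrac14\big)\,B_{n_2}\big((-1)^{n_1}z_2-\tfrac14;\beta+\epsilon+\tfrac{n_1}2,(1-\pi_{n_1})\gamma+\pi_{n_1}\delta,\alpha-\epsilon-\tfrac{n_1}2,(\pi_{n_1}-1)\delta-\pi_{n_1}\gamma\big).$$ Let $T_x^mf(x)=f(x+m)$, $R_xf(x)=f(-x)$ (so $T_x^mR_xf(x)=f(-x-m)$), and $$L_1=\frac{(\epsilon-z_1+z_2)(z_1-\beta-\frac14)}{2(z_1-\frac14)}\big(T_{z_1}^{-1/2}R_{z_1}-1\big)+\frac{(\epsilon+z_1-z_2)(z_1-\alpha+\frac14)}{2(z_1+\frac14)}\big(T_{z_1}^{1/2}R_{z_1}-1\big),$$ $$L_2=\sum_{i,j=-1}^{1}c_{i,j}\,T_{z_1}^{-i/2}R_{z_1}^i\,T_{z_2}^{-j/2}R_{z_2}^j,$$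 where, with $X=\alpha(z_1-\frac14)+\beta(z_1+\frac14)$ and $Y=\delta(z_2+\frac14)-\gamma(z_2-\frac14)$, $$\begin{aligned} c_{-1,-1}&=\tfrac{(z_1-\alpha+\frac14)(z_2+\gamma+\frac14)(\epsilon+z_1+z_2+\frac12)}{4(z_1+\frac14)(z_2+\frac14)},& c_{-1,0}&=\tfrac{(z_1-\alpha+\frac14)(\epsilon+z_1-z_2)Y}{4(z_1+\frac14)(z_2-\frac14)(z_2+\frac14)},\\ c_{-1,1}&=\tfrac{(z_1-\alpha+\frac14)(z_2-\delta-\frac14)(\epsilon+z_1-z_2)}{4(z_1+\frac14)(z_2-\frac14)},& c_{0,-1}&=\tfrac{(z_2+\gamma+\frac14)(\epsilon-z_1+z_2)X}{4(z_1-\frac14)(z_1+\frac14)(z_2+\frac14)},\\ c_{0,1}&=\tfrac{(z_2-\delta-\frac14)(\epsilon+z_1-z_2)X}{4(z_1-\frac14)(z_1+\frac14)(z_2-\frac14)},& c_{1,-1}&=\tfrac{(z_1-\beta-\frac14)(z_2+\gamma+\frac14)(\epsilon-z_1+z_2)}{4(z_1-\frac14)(z_2+\frac14)},\\ c_{1,0}&=\tfrac{(z_1-\beta-\frac14)(\epsilon-z_1+z_2)Y}{4(z_1-\frac14)(z_2-\frac14)(z_2+\frac14)},&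 c_{1,1}&=\tfrac{(z_1-\beta-\frac14)(z_2-\delta-\frac14)(\epsilon-z_1-z_2+\frac12)}{4(z_1-\frac14)(z_2-\frac14)}, \end{aligned}$$ $$c_{0,0}=\alpha(\gamma-\delta+\tfrac12)+\beta(\gamma-\delta-\tfrac12)-\tfrac12(\gamma+\delta+\tfrac12)-\epsilon+\tfrac{(\epsilon+4z_1z_2-\frac14)XY}{4(z_1-\frac14)(z_1+\frac14)(z_2-\frac14)(z_2+\frac14)}.$$ Let $$\mu_{n_1}=\begin{cases}\frac{n_1}2&n_1\text{ even}\\-\frac{n_1}2+\alpha-\beta-2\epsilon&n_1\text{ odd,}\end{cases}\qquad \lambda_{n_1,n_2}=\begin{cases}\frac{n_1+n_2}2&n_1+n_2\text{ even}\\-\big(\frac{n_1+n_2+1}2-\alpha+\beta+\gamma+\delta+2\epsilon\big)&n_1+n_2\text{ odd.}\end{cases}$$ **Proposition.** (1) Assume that $B_{n_1,n_2}$ is well defined, that is, $\beta-\alpha+2\epsilon-\frac12+k\ne0$ for $\lfloor n_1/2\rfloor<k\le n_1$ and $\beta-\alpha+\gamma+\delta+2\epsilon+n_1+k\neq0$ for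 $\lfloor n_2/2\rfloor<k\le n_2$. Then $B_{n_1,n_2}$ is not identically zero and $$L_1B_{n_1,n_2}(z_1,z_2)=\mu_{n_1}B_{n_1,n_2}(z_1,z_2),\qquad L_2B_{n_1,n_2}(z_1,z_2)=\lambda_{n_1,n_2}B_{n_1,n_2}(z_1,z_2)$$ for all complex $z_1,z_2$ off the poles of the coefficients ($z_1\ne\pm\frac14$ for $L_1$; $z_1,z_2\neq\pm\frac14$ for $L_2$). (2) $L_2$ is a $q\to-1$ limit of Iliev's $q$-difference operator $\mathcal L=\sum_{i,j=-1}^1C_{i,j}E_{q,z_1}^iE_{q,z_2}^j$ ($E_{q,z}:z\mapsto qz$) for the bivariate Askey-Wilson polynomials. Here, writing $S(a,b;z)=1+\frac{ab}q-\frac{(z^2+1)(a+b)}{z(q+1)}$, $$\begin{aligned} C_{-1,-1}&=-\tfrac{(z_1-a)(z_1-b)(z_2-c)(z_2-d)(z_1z_2-a_2)(z_1z_2-a_2q)}{(z_1^2-1)(z_2^2-1)(z_1^2-q)(q-z_2^2)},\\ C_{-1,0}&=\tfrac{z_2q(q+1)(z_1-a)(z_1-b)(z_1z_2-a_2)(z_1-a_2z_2)S(c,d;z_2)}{(z_1^2-1)(z_1^2-q)(q-z_2^2)(qz_2^2-1)},\\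 C_{-1,1}&=\tfrac{(a-z_1)(z_1-b)(cz_2-1)(1-dz_2)(z_1-a_2z_2)(z_1-a_2qz_2)}{(z_1^2-1)(z_2^2-1)(z_1^2-q)(qz_2^2-1)},\\ C_{0,-1}&=\tfrac{z_1q(q+1)(z_2-c)(z_2-d)(z_1z_2-a_2)(z_2-a_2z_1)S(a,b;z_1)}{(z_2^2-1)(z_1^2-q)(1-qz_1^2)(z_2^2-q)},\\ C_{0,0}&=-1+\tfrac{a_2(a+b)(c+d)}{q+1}-\tfrac{aa_2^2bcd}q+\tfrac{z_1^2z_2^2q^2(q+1)^2S(a,b;z_1)\left(1+\frac{a_2^2}q-\frac{a_2(z_1^2+1)(z_2^2+1)}{z_1z_2(q+1)}\right)S(c,d;z_2)}{(z_1^2-q)(1-qz_1^2)(z_2^2-q)(1-qz_2^2)},\\ C_{0,1}&=\tfrac{z_1q(q+1)(1-cz_2)(1-dz_2)(z_1-a_2z_2)(1-a_2z_1z_2)S(a,b;z_1)}{(1-z_2^2)(z_1^2-q)(1-qz_1^2)(1-qz_2^2)},\\ C_{1,-1}&=\tfrac{(az_1-1)(bz_1-1)(c-z_2)(z_2-d)(a_2z_1-z_2)(a_2qz_1-z_2)}{(z_1^2-1)(z_2^2-1)(qz_1^2-1)(q-z_2^2)},\\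 C_{1,0}&=\tfrac{z_2q(q+1)(1-az_1)(1-bz_1)(z_2-a_2z_1)(1-a_2z_1z_2)S(c,d;z_2)}{(z_1^2-1)(qz_1^2-1)(q-z_2^2)(qz_2^2-1)},\\ C_{1,1}&=-\tfrac{(az_1-1)(bz_1-1)(cz_2-1)(1-dz_2)(a_2z_1z_2-1)(a_2qz_1z_2-1)}{(z_1^2-1)(z_2^2-1)(qz_1^2-1)(qz_2^2-1)}, \end{aligned}$$ and the eigenvalue of $\mathcal L$ on the Askey-Wilson polynomial of degrees $n_1,n_2$ is $\Lambda_{n_1,n_2}=(q^{-n_1-n_2}-1)(1-aa_2^2bcd\,q^{n_1+n_2-1})$. Put $q=-e^t$, $a=ie^{t(-2\alpha+1/2)}$, $b=-ie^{t(2\beta+1/2)}$, $c=ie^{t(2\gamma+1/2)}$, $d=-ie^{t(2\delta+1/2)}$, $a_2=e^{2t\epsilon}$, and replace the variables $z_1,z_2$ of $\mathcal L$ by $ie^{-2tz_1},ie^{-2tz_2}$. Then, as $t\to0$ through nonzero complex values, and for all $z_1,z_2\ne\pm\frac14$: * $\dfrac{C_{i,j}}{4(1+q)}\to c_{i,j}(z_1,z_2)$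 for all $i,j\in\{-1,0,1\}$, and $\dfrac{\Lambda_{n_1,n_2}}{4(1+q)}\to\lambda_{n_1,n_2}$ for all $n_1,n_2\in\mathbb N$; * if functions $F_t(u,v)$ are invariant under $u\mapsto u^{-1}$ and under $v\mapsto v^{-1}$, and $F_t(ie^{-2tx},ie^{-2ty})\to f(x,y)$ for all $x,y\in\mathbb C$, then $\dfrac{1}{4(1+q)}(\mathcal LF_t)(ie^{-2tz_1},ie^{-2tz_2})\to(L_2f)(z_1,z_2)$. -/

import Mathlib

/-! Univariate and bivariate Bannai-Ito polynomials, the Dunkl shift operators `L1`, `L2`, and the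
q-difference operator of the bivariate Askey-Wilson polynomials. -/

noncomputable section

namespace BannaiIto

/-- The Pochhammer symbol `(a)_n = a (a+1) ⋯ (a+n-1)`. -/
def poch (a : ℂ) (n : ℕ) : ℂ := (ascPochhammer ℂ n).eval a

/-- The monic Bannai-Ito polynomial `B_n(x; ρ₁, ρ₂, r₁, r₂)`, where `n = 2 e + p`, `p ∈ {0, 1}`.
This is `η_n` times the usual combination of two terminating `₄F₃` series, with the lower Pochhammer
symbols of the series cancelled against the factors of `η_n`, so that no denominator containing
`1 - r₁ - r₂`, `ρ₁ - r₁ + 1/2` or `ρ₂ - r₁ + 1/2` remains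
(see `monicBI_eq_hypergeometric` for the uncancelled form). -/
def monicBI (n : ℕ) (x ρ₁ ρ₂ r₁ r₂ : ℂ) : ℂ :=
  let e : ℕ := n / 2
  let p : ℕ := n % 2
  let g : ℂ := ρ₁ + ρ₂ - r₁ - r₂
  let a : ℂ := ρ₁ - r₁ + 1 / 2
  let b : ℂ := ρ₂ - r₁ + 1 / 2
  let c : ℂ := 1 - r₁ - r₂
  (-1) ^ n / poch (e + g + 1) (e + p) *
    ((∑ k ∈ Finset.range (e + 1),
        poch (-e) k * poch (e + g + 1) k * poch (x - r₁ + 1 / 2) k * poch (-x - r₁ + 1 / 2) k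
          / (k.factorial : ℂ)
          * (poch (c + k) (e - k) * poch (a + k) (e + p - k) * poch (b + k) (e + p - k)))
     + (-1) ^ n * (e + p + g * p) * (x - r₁ + 1 / 2) *
       ∑ k ∈ Finset.range (e + p),
        poch (-e - p + 1) k * poch (e + p + g + 1) k
          * poch (x - r₁ + 3 / 2) k * poch (-x - r₁ + 1 / 2) k
          / (k.factorial : ℂ)
          * (poch (c + k) (e - k) * poch (a + 1 + k) (e + p - (k + 1))
              * poch (b + 1 + k) (e + p - (k + 1))))

/-- The sum of the first `N` terms of `₄F₃(a₁, a₂, a₃, a₄; b₁, b₂, b₃; 1)`. It is the whole series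
if one of the `aᵢ` is `-(N - 1)`. -/
def hyp43 (N : ℕ) (a₁ a₂ a₃ a₄ b₁ b₂ b₃ : ℂ) : ℂ :=
  ∑ k ∈ Finset.range N,
    poch a₁ k * poch a₂ k * poch a₃ k * poch a₄ k /
      (poch b₁ k * poch b₂ k * poch b₃ k * (k.factorial : ℂ))

/-- The normalization coefficient `η_n`. -/
def eta (n : ℕ) (ρ₁ ρ₂ r₁ r₂ : ℂ) : ℂ :=
  (-1) ^ n * (poch (ρ₁ - r₁ + 1 / 2) (n / 2 + n % 2) * poch (ρ₂ - r₁ + 1 / 2) (n / 2 + n % 2)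
    * poch (1 - r₁ - r₂) (n / 2))
    / poch (((n / 2 : ℕ) : ℂ) + (ρ₁ + ρ₂ - r₁ - r₂) + 1) (n / 2 + n % 2)

theorem poch_split (a : ℂ) {k n : ℕ} (h : k ≤ n) :
    poch a n = poch a k * poch (a + k) (n - k) := by
  unfold poch
  conv_lhs => rw [← Nat.add_sub_cancel' h, ← ascPochhammer_mul]
  simp

theorem poch_succ_left (a : ℂ) (k : ℕ) : poch a (k + 1) = a * poch (a + 1) k := by
  rw [poch_split a (Nat.le_add_left 1 k)]
  simp [poch]

/-- Whenever the lower Pochhammer symbols do not vanish, `monicBI` is given by the hypergeometric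
expression of the Bannai-Ito polynomials. -/
theorem monicBI_eq_hypergeometric (n e p : ℕ) (x ρ₁ ρ₂ r₁ r₂ g : ℂ)
    (he : e = n / 2) (hp : p = n % 2) (hg : g = ρ₁ + ρ₂ - r₁ - r₂)
    (ha : poch (ρ₁ - r₁ + 1 / 2) (e + p) ≠ 0) (hb : poch (ρ₂ - r₁ + 1 / 2) (e + p) ≠ 0)
    (hc : poch (1 - r₁ - r₂) e ≠ 0) :
    monicBI n x ρ₁ ρ₂ r₁ r₂ = eta n ρ₁ ρ₂ r₁ r₂ *
      (hyp43 (e + 1) (-e) (e + g + 1) (x - r₁ + 1 / 2) (-x - r₁ + 1 / 2)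
          (1 - r₁ - r₂) (ρ₁ - r₁ + 1 / 2) (ρ₂ - r₁ + 1 / 2)
        + (-1) ^ n * (e + p + g * p) * (x - r₁ + 1 / 2)
            / ((ρ₁ - r₁ + 1 / 2) * (ρ₂ - r₁ + 1 / 2)) *
          hyp43 (e + p) (-e - p + 1) (e + p + g + 1) (x - r₁ + 3 / 2) (-x - r₁ + 1 / 2)
            (1 - r₁ - r₂) (ρ₁ - r₁ + 3 / 2) (ρ₂ - r₁ + 3 / 2)) := by
  have h32 : ∀ u : ℂ, u - r₁ + 3 / 2 = u - r₁ + 1 / 2 + 1 := fun u => by ring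
  rw [h32 ρ₁, h32 ρ₂]
  unfold monicBI eta hyp43
  simp only [← he, ← hp, ← hg]
  generalize ρ₁ - r₁ + 1 / 2 = a at *
  generalize ρ₂ - r₁ + 1 / 2 = b at *
  generalize 1 - r₁ - r₂ = c at *
  have key1 : ∀ k ∈ Finset.range (e + 1), ∀ X : ℂ,
      X / (k.factorial : ℂ)
        * (poch (c + k) (e - k) * poch (a + k) (e + p - k) * poch (b + k) (e + p - k))
      = (poch a (e + p) * poch b (e + p) * poch c e) *
        (X / (poch c k * poch a k * poch b k * (k.factorial : ℂ))) := by
    intro k hk X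
    have hk' : k ≤ e := Nat.lt_succ_iff.mp (Finset.mem_range.mp hk)
    have hk'' : k ≤ e + p := hk'.trans (Nat.le_add_right _ _)
    rw [poch_split c hk'] at hc
    rw [poch_split a hk''] at ha
    rw [poch_split b hk''] at hb
    rw [poch_split c hk', poch_split a hk'', poch_split b hk'']
    have h1 := left_ne_zero_of_mul hc
    have h2 := left_ne_zero_of_mul ha
    have h3 := left_ne_zero_of_mul hb
    have h4 : (k.factorial : ℂ) ≠ 0 := by exact_mod_cast k.factorial_ne_zero
    field_simp
  have key2 : ∀ k ∈ Finset.range (e + p), ∀ X : ℂ,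
      X / (k.factorial : ℂ)
        * (poch (c + k) (e - k) * poch (a + 1 + k) (e + p - (k + 1))
            * poch (b + 1 + k) (e + p - (k + 1)))
      = (poch a (e + p) * poch b (e + p) * poch c e) / (a * b) *
        (X / (poch c k * poch (a + 1) k * poch (b + 1) k * (k.factorial : ℂ))) := by
    intro k hk X
    have hk0 : k < e + p := Finset.mem_range.mp hk
    have hk' : k ≤ e := by omega
    have hk'' : k + 1 ≤ e + p := hk0
    have hs : ∀ u : ℂ, u + ((k + 1 : ℕ) : ℂ) = u + 1 + k := fun u => by push_cast; ring
    rw [poch_split c hk'] at hc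
    rw [poch_split a hk'', poch_succ_left, hs] at ha
    rw [poch_split b hk'', poch_succ_left, hs] at hb
    rw [poch_split c hk', poch_split a hk'', poch_split b hk'', poch_succ_left, poch_succ_left,
      hs, hs]
    have h1 := left_ne_zero_of_mul hc
    have h2 := left_ne_zero_of_mul ha
    have h3 := left_ne_zero_of_mul hb
    have h2a := left_ne_zero_of_mul h2
    have h2b := right_ne_zero_of_mul h2
    have h3a := left_ne_zero_of_mul h3
    have h3b := right_ne_zero_of_mul h3
    have h4 : (k.factorial : ℂ) ≠ 0 := by exact_mod_cast k.factorial_ne_zero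
    field_simp
  rw [Finset.sum_congr rfl (fun k hk => key1 k hk _),
    Finset.sum_congr rfl (fun k hk => key2 k hk _), ← Finset.mul_sum, ← Finset.mul_sum]
  ring

/-- The indicator function of even numbers. -/
def evenInd (n : ℕ) : ℂ := if Even n then 1 else 0

/-- The untruncated bivariate Bannai-Ito polynomials `B_{n₁,n₂}(z₁, z₂)`. -/
def bivariateBI (n₁ n₂ : ℕ) (α β γ δ ε : ℂ) (z₁ z₂ : ℂ) : ℂ :=
  monicBI n₁ (z₁ - 1 / 4) β (z₂ + ε - 1 / 4) α (z₂ - ε + 1 / 4) *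
  monicBI n₂ ((-1) ^ n₁ * z₂ - 1 / 4)
    (β + ε + n₁ / 2) ((1 - evenInd n₁) * γ + evenInd n₁ * δ)
    (α - ε - n₁ / 2) ((evenInd n₁ - 1) * δ - evenInd n₁ * γ)

/-- Shift in the first variable, `(T^m_{z₁} f)(z₁, z₂) = f(z₁ + m, z₂)`. -/
def shift₁ (m : ℂ) (f : ℂ → ℂ → ℂ) : ℂ → ℂ → ℂ := fun z₁ z₂ => f (z₁ + m) z₂

/-- Shift in the second variable, `(T^m_{z₂} f)(z₁, z₂) = f(z₁, z₂ + m)`. -/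
def shift₂ (m : ℂ) (f : ℂ → ℂ → ℂ) : ℂ → ℂ → ℂ := fun z₁ z₂ => f z₁ (z₂ + m)

/-- Reflection in the first variable, `(R_{z₁} f)(z₁, z₂) = f(-z₁, z₂)`. -/
def refl₁ (f : ℂ → ℂ → ℂ) : ℂ → ℂ → ℂ := fun z₁ z₂ => f (-z₁) z₂

/-- Reflection in the second variable, `(R_{z₂} f)(z₁, z₂) = f(z₁, -z₂)`. -/
def refl₂ (f : ℂ → ℂ → ℂ) : ℂ → ℂ → ℂ := fun z₁ z₂ => f z₁ (-z₂)

/-- The operator `T_{z₁}^{-i/2} R_{z₁}^i` for `i ∈ {-1, 0, 1}` (note that `R⁻¹ = R`). -/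
def shiftRefl₁ (i : SignType) (f : ℂ → ℂ → ℂ) : ℂ → ℂ → ℂ :=
  match i with
  | .neg => shift₁ (1 / 2) (refl₁ f)
  | .zero => f
  | .pos => shift₁ (-1 / 2) (refl₁ f)

/-- The operator `T_{z₂}^{-j/2} R_{z₂}^j` for `j ∈ {-1, 0, 1}`. -/
def shiftRefl₂ (j : SignType) (f : ℂ → ℂ → ℂ) : ℂ → ℂ → ℂ :=
  match j with
  | .neg => shift₂ (1 / 2) (refl₂ f)
  | .zero => f
  | .pos => shift₂ (-1 / 2) (refl₂ f)

/-- The operator `L₁`. -/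
def opL1 (α β ε : ℂ) (f : ℂ → ℂ → ℂ) : ℂ → ℂ → ℂ := fun z₁ z₂ =>
  (ε - z₁ + z₂) * (z₁ - β - 1 / 4) / (2 * (z₁ - 1 / 4))
      * (shift₁ (-1 / 2) (refl₁ f) z₁ z₂ - f z₁ z₂)
    + (ε + z₁ - z₂) * (z₁ - α + 1 / 4) / (2 * (z₁ + 1 / 4))
      * (shift₁ (1 / 2) (refl₁ f) z₁ z₂ - f z₁ z₂)

/-- The coefficients `c_{i,j}(z₁, z₂)` of `L₂`. -/
def coefL2 (α β γ δ ε : ℂ) (i j : SignType) (z₁ z₂ : ℂ) : ℂ :=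
  match i, j with
  | .neg, .neg =>
      (z₁ - α + 1 / 4) * (z₂ + γ + 1 / 4) * (ε + z₁ + z₂ + 1 / 2)
        / (4 * (z₁ + 1 / 4) * (z₂ + 1 / 4))
  | .neg, .zero =>
      (z₁ - α + 1 / 4) * (ε + z₁ - z₂) * (δ * (z₂ + 1 / 4) - γ * (z₂ - 1 / 4))
        / (4 * (z₁ + 1 / 4) * (z₂ - 1 / 4) * (z₂ + 1 / 4))
  | .neg, .pos =>
      (z₁ - α + 1 / 4) * (z₂ - δ - 1 / 4) * (ε + z₁ - z₂)
        / (4 * (z₁ + 1 / 4) * (z₂ - 1 / 4))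
  | .zero, .neg =>
      (z₂ + γ + 1 / 4) * (ε - z₁ + z₂) * (α * (z₁ - 1 / 4) + β * (z₁ + 1 / 4))
        / (4 * (z₁ - 1 / 4) * (z₁ + 1 / 4) * (z₂ + 1 / 4))
  | .zero, .zero =>
      α * (γ - δ + 1 / 2) + β * (γ - δ - 1 / 2) - 1 / 2 * (γ + δ + 1 / 2) - ε
        + (ε + 4 * z₁ * z₂ - 1 / 4) * (α * (z₁ - 1 / 4) + β * (z₁ + 1 / 4))
            * (δ * (z₂ + 1 / 4) - γ * (z₂ - 1 / 4))
          / (4 * (z₁ - 1 / 4) * (z₁ + 1 / 4) * (z₂ - 1 / 4) * (z₂ + 1 / 4))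
  | .zero, .pos =>
      (z₂ - δ - 1 / 4) * (ε + z₁ - z₂) * (α * (z₁ - 1 / 4) + β * (z₁ + 1 / 4))
        / (4 * (z₁ - 1 / 4) * (z₁ + 1 / 4) * (z₂ - 1 / 4))
  | .pos, .neg =>
      (z₁ - β - 1 / 4) * (z₂ + γ + 1 / 4) * (ε - z₁ + z₂)
        / (4 * (z₁ - 1 / 4) * (z₂ + 1 / 4))
  | .pos, .zero =>
      (z₁ - β - 1 / 4) * (ε - z₁ + z₂) * (δ * (z₂ + 1 / 4) - γ * (z₂ - 1 / 4))
        / (4 * (z₁ - 1 / 4) * (z₂ - 1 / 4) * (z₂ + 1 / 4))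
  | .pos, .pos =>
      (z₁ - β - 1 / 4) * (z₂ - δ - 1 / 4) * (ε - z₁ - z₂ + 1 / 2)
        / (4 * (z₁ - 1 / 4) * (z₂ - 1 / 4))

/-- The operator `L₂`, a combination of nine shift-reflection operators. -/
def opL2 (α β γ δ ε : ℂ) (f : ℂ → ℂ → ℂ) : ℂ → ℂ → ℂ := fun z₁ z₂ =>
  ∑ i : SignType, ∑ j : SignType,
    coefL2 α β γ δ ε i j z₁ z₂ * shiftRefl₁ i (shiftRefl₂ j f) z₁ z₂

/-- The eigenvalue `μ_{n₁}` of `L₁`. -/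
def eigL1 (n₁ : ℕ) (α β ε : ℂ) : ℂ :=
  if Even n₁ then n₁ / 2 else -(n₁ / 2) + α - β - 2 * ε

/-- The eigenvalue `λ_{n₁,n₂}` of `L₂`. -/
def eigL2 (n₁ n₂ : ℕ) (α β γ δ ε : ℂ) : ℂ :=
  if Even (n₁ + n₂) then (n₁ + n₂) / 2
  else -((n₁ + n₂ + 1) / 2 - α + β + γ + δ + 2 * ε)

/-- The factor `1 + ab/q - (z² + 1)(a + b) / (z (q + 1))`. -/
def awFactor (q a b z : ℂ) : ℂ := 1 + a * b / q - (z ^ 2 + 1) * (a + b) / (z * (q + 1))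

/-- The coefficients `C_{i,j}(z₁, z₂)` of the q-difference operator of the bivariate Askey-Wilson
polynomials. -/
def coefAW (q a b c d a₂ : ℂ) (i j : SignType) (z₁ z₂ : ℂ) : ℂ :=
  match i, j with
  | .neg, .neg =>
      -((z₁ - a) * (z₁ - b) * (z₂ - c) * (z₂ - d) * (z₁ * z₂ - a₂) * (z₁ * z₂ - a₂ * q)
        / ((z₁ ^ 2 - 1) * (z₂ ^ 2 - 1) * (z₁ ^ 2 - q) * (q - z₂ ^ 2)))
  | .neg, .zero =>
      z₂ * q * (q + 1) * (z₁ - a) * (z₁ - b) * (z₁ * z₂ - a₂) * (z₁ - a₂ * z₂) * awFactor q c d z₂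
        / ((z₁ ^ 2 - 1) * (z₁ ^ 2 - q) * (q - z₂ ^ 2) * (q * z₂ ^ 2 - 1))
  | .neg, .pos =>
      (a - z₁) * (z₁ - b) * (c * z₂ - 1) * (1 - d * z₂) * (z₁ - a₂ * z₂) * (z₁ - a₂ * q * z₂)
        / ((z₁ ^ 2 - 1) * (z₂ ^ 2 - 1) * (z₁ ^ 2 - q) * (q * z₂ ^ 2 - 1))
  | .zero, .neg =>
      z₁ * q * (q + 1) * (z₂ - c) * (z₂ - d) * (z₁ * z₂ - a₂) * (z₂ - a₂ * z₁) * awFactor q a b z₁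
        / ((z₂ ^ 2 - 1) * (z₁ ^ 2 - q) * (1 - q * z₁ ^ 2) * (z₂ ^ 2 - q))
  | .zero, .zero =>
      -1 + a₂ * (a + b) * (c + d) / (q + 1) - a * a₂ ^ 2 * b * c * d / q
        + z₁ ^ 2 * z₂ ^ 2 * q ^ 2 * (q + 1) ^ 2 * awFactor q a b z₁
            * (1 + a₂ ^ 2 / q - a₂ * (z₁ ^ 2 + 1) * (z₂ ^ 2 + 1) / (z₁ * z₂ * (q + 1)))
            * awFactor q c d z₂
          / ((z₁ ^ 2 - q) * (1 - q * z₁ ^ 2) * (z₂ ^ 2 - q) * (1 - q * z₂ ^ 2))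
  | .zero, .pos =>
      z₁ * q * (q + 1) * (1 - c * z₂) * (1 - d * z₂) * (z₁ - a₂ * z₂) * (1 - a₂ * z₁ * z₂)
          * awFactor q a b z₁
        / ((1 - z₂ ^ 2) * (z₁ ^ 2 - q) * (1 - q * z₁ ^ 2) * (1 - q * z₂ ^ 2))
  | .pos, .neg =>
      (a * z₁ - 1) * (b * z₁ - 1) * (c - z₂) * (z₂ - d) * (a₂ * z₁ - z₂) * (a₂ * q * z₁ - z₂)
        / ((z₁ ^ 2 - 1) * (z₂ ^ 2 - 1) * (q * z₁ ^ 2 - 1) * (q - z₂ ^ 2))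
  | .pos, .zero =>
      z₂ * q * (q + 1) * (1 - a * z₁) * (1 - b * z₁) * (z₂ - a₂ * z₁) * (1 - a₂ * z₁ * z₂)
          * awFactor q c d z₂
        / ((z₁ ^ 2 - 1) * (q * z₁ ^ 2 - 1) * (q - z₂ ^ 2) * (q * z₂ ^ 2 - 1))
  | .pos, .pos =>
      -((a * z₁ - 1) * (b * z₁ - 1) * (c * z₂ - 1) * (1 - d * z₂)
          * (a₂ * z₁ * z₂ - 1) * (a₂ * q * z₁ * z₂ - 1)
        / ((z₁ ^ 2 - 1) * (z₂ ^ 2 - 1) * (q * z₁ ^ 2 - 1) * (q * z₂ ^ 2 - 1)))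

/-- The q-difference operator `∑ C_{i,j} E_{q,z₁}^i E_{q,z₂}^j`, where `E_{q,z}` sends `z` to `q z`,
of the bivariate Askey-Wilson polynomials. -/
def opAW (q a b c d a₂ : ℂ) (F : ℂ → ℂ → ℂ) : ℂ → ℂ → ℂ := fun z₁ z₂ =>
  ∑ i : SignType, ∑ j : SignType,
    coefAW q a b c d a₂ i j z₁ z₂ * F (q ^ (i : ℤ) * z₁) (q ^ (j : ℤ) * z₂)

/-- The eigenvalue of `opAW` on the bivariate Askey-Wilson polynomial of degrees `n₁, n₂`. -/
def eigAW (n₁ n₂ : ℕ) (q a b c d a₂ : ℂ) : ℂ :=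
  (q ^ (-(n₁ : ℤ) - n₂) - 1) * (1 - a * a₂ ^ 2 * b * c * d * q ^ ((n₁ : ℤ) + n₂ - 1))

/-! The parametrization of the limit `q → -1`, as functions of `t → 0`. -/

/-- `q = -e^t`. -/
def qT (t : ℂ) : ℂ := -Complex.exp t

/-- `z = i e^{-2 t x}`. -/
def zT (x t : ℂ) : ℂ := Complex.I * Complex.exp (t * (-2 * x))

/-- `a = i e^{t (-2α + 1/2)}`. -/
def aT (α t : ℂ) : ℂ := Complex.I * Complex.exp (t * (-2 * α + 1 / 2))

/-- `b = -i e^{t (2β + 1/2)}`. -/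
def bT (β t : ℂ) : ℂ := -Complex.I * Complex.exp (t * (2 * β + 1 / 2))

/-- `c = i e^{t (2γ + 1/2)}`. -/
def cT (γ t : ℂ) : ℂ := Complex.I * Complex.exp (t * (2 * γ + 1 / 2))

/-- `d = -i e^{t (2δ + 1/2)}`. -/
def dT (δ t : ℂ) : ℂ := -Complex.I * Complex.exp (t * (2 * δ + 1 / 2))

/-- `a₂ = e^{2 t ε}`. -/
def a₂T (ε t : ℂ) : ℂ := Complex.exp (t * (2 * ε))

end BannaiIto

end

open BannaiIto Filter Topology

/-!
Write `x = z₁ - 1/4`. In the Newton basis `newtonBI α m`, which does not involve `z₂`, the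
polynomial `monicBI n₁ x β (z₂ + ε - 1/4) α (z₂ - ε + 1/4)` has explicit product coefficients
`biCoef` (`monicBI_eq_sum`). The elements of this basis vanish at the first points of an orbit of
the two reflections `x ↦ -x` and `x ↦ -x - 1`, so every operator `f ↦ U f(-x) + V f(x) + W f(-x-1)`
which preserves the degree and whose coefficient `W` vanishes at the starting point is bidiagonal.
Its action on a Bannai-Ito polynomial is thereby reduced to two-term relations between products of
Pochhammer symbols. This gives the univariate eigenvalue equation `monicBI_eigen`, which is the
statement on `L₁`, and two contiguity relations, `monicBI_lower` and `monicBI_raise`.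

For `L₂`, the nine terms are grouped by the reflection which they apply to `z₂`. Each group acts in
`z₁` by an operator of the above kind, which maps the first factor of `bivariateBI`, taken at the
reflected value of `z₂`, to a multiple of the first factor at `z₂`; the multiplier depends on `z₂`
and `n₁` only (`coefL2_column_neg`, `coefL2_column_zero`, `coefL2_column_pos`). The three
multipliers together with the reflections of `z₂` form, up to sign and an additive constant, the
univariate operator of the second factor, and `monicBI_eigen` applies once more. The polynomials do
not vanish identically, since their expansion in the Newton basis has a nonzero leading
coefficient.

For the limit `q → -1`, every Askey-Wilson coefficient except `C_{0,0}` is a quotient of products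
whose factors, suitably paired, either have a nonzero limit or vanish at `t = 0`; the derivatives
of the latter are, up to constants, the factors of the corresponding coefficient of `L₂`. The
coefficient `C_{0,0}` is a sum of three terms treated in the same way (`tendsto_coefAW_zero_zero`).
The substitution turns `z ↦ q^{±1} z` into a reflection followed by an inversion (`qT_mul_zT`,
`qT_inv_mul_zT`), which invariant functions do not see.
-/

noncomputable section

namespace BannaiIto

/-! ### Pochhammer symbols -/

theorem poch_zero (a : ℂ) : poch a 0 = 1 := by simp [poch]

theorem poch_succ_right (a : ℂ) (k : ℕ) : poch a (k + 1) = poch a k * (a + k) := by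
  simp [poch, ascPochhammer_succ_eval]

theorem poch_ne_zero {a : ℂ} {n : ℕ} (h : ∀ i < n, a + (i : ℂ) ≠ 0) : poch a n ≠ 0 := by
  induction n with
  | zero => simp [poch_zero]
  | succ n ih =>
    rw [poch_succ_right]
    exact mul_ne_zero (ih fun i hi => h i (by omega)) (h n (by omega))

theorem mul_poch_shift (a : ℂ) (k : ℕ) : a * poch (a + 1) k = poch a k * (a + k) := by
  rw [← poch_succ_left, poch_succ_right]

/-! ### The expansion in the Newton basis -/

/-- The Newton basis `φ₀, φ₁, …` attached to the parameter `r = r₁`: `φ_m` has degree `m` in `x`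
and vanishes at the first `m` points of the orbit `r - 1/2, 1/2 - r, r - 3/2, 3/2 - r, …` of
`r - 1/2` under alternating applications of the reflections `x ↦ -x` and `x ↦ -x - 1`. -/
def newtonBI (r : ℂ) (m : ℕ) (x : ℂ) : ℂ :=
  poch (x - r + 1 / 2) ((m + 1) / 2) * poch (-x - r + 1 / 2) (m / 2)

theorem newtonBI_even (r x : ℂ) (k : ℕ) :
    newtonBI r (2 * k) x = poch (x - r + 1 / 2) k * poch (-x - r + 1 / 2) k := by
  unfold newtonBI
  rw [show (2 * k + 1) / 2 = k by omega, show 2 * k / 2 = k by omega]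

theorem newtonBI_odd (r x : ℂ) (k : ℕ) :
    newtonBI r (2 * k + 1) x = poch (x - r + 1 / 2) (k + 1) * poch (-x - r + 1 / 2) k := by
  unfold newtonBI
  rw [show (2 * k + 1 + 1) / 2 = k + 1 by omega, show (2 * k + 1) / 2 = k by omega]

theorem newtonBI_odd_eq (r x : ℂ) (k : ℕ) :
    newtonBI r (2 * k + 1) x = newtonBI r (2 * k) x * (x - r + 1 / 2 + k) := by
  rw [newtonBI_odd, newtonBI_even, poch_succ_right]
  ring

theorem newtonBI_even_succ_eq (r x : ℂ) (k : ℕ) :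
    newtonBI r (2 * k + 2) x = newtonBI r (2 * k + 1) x * (-x - r + 1 / 2 + k) := by
  rw [show 2 * k + 2 = 2 * (k + 1) by ring, newtonBI_odd, newtonBI_even,
      poch_succ_right (-x - r + 1 / 2)]
  ring

theorem newtonBI_even_neg (r x : ℂ) (k : ℕ) : newtonBI r (2 * k) (-x) = newtonBI r (2 * k) x := by
  rw [newtonBI_even, newtonBI_even, neg_neg]
  ring

/-- The factor `x - r + 1/2`, which occurs in the coefficient of the reflection `x ↦ -x - 1`, turns
the reflected basis element back into a multiple of `φ_{2k+1}`. -/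
theorem newtonBI_odd_refl (r x : ℂ) (k : ℕ) :
    (x - r + 1 / 2) * newtonBI r (2 * k + 1) (-x - 1)
      = (-x - r - 1 / 2) * newtonBI r (2 * k + 1) x := by
  rw [newtonBI_odd, newtonBI_odd, show -(-x - 1) - r + 1 / 2 = x - r + 1 / 2 + 1 by ring,
    show -x - r + 1 / 2 = -x - 1 - r + 1 / 2 + 1 by ring, poch_succ_left (-x - 1 - r + 1 / 2),
    poch_succ_left (x - r + 1 / 2)]
  ring

theorem newtonBI_even_succ_refl (r x : ℂ) (k : ℕ) :
    (x - r + 1 / 2) * newtonBI r (2 * k + 2) (-x - 1)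
      = (-x - r - 1 / 2) * newtonBI r (2 * k + 1) x * (x - r + 1 / 2 + k + 1) := by
  rw [newtonBI_even_succ_eq]
  linear_combination (x - r + 1 / 2 + k + 1) * newtonBI_odd_refl r x k

theorem newtonBI_zero (r x : ℂ) : newtonBI r 0 x = 1 := by simp [newtonBI, poch_zero]

/-- The coefficient of `φ_m` in the Bannai-Ito polynomial of degree `n`, up to the common factor
`(-1)^n / (e+g+1)_{e+p}`. The parameters enter through `a = ρ₁ - r₁ + 1/2`, `b = ρ₂ - r₁ + 1/2`,
`c = 1 - r₁ - r₂` and `g = ρ₁ + ρ₂ - r₁ - r₂`. The prefactor `e + p + g p` of the second series of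
`monicBI` is absorbed into one of the Pochhammer symbols: into `(-e)_{k+1}` for even `n` and into
`(e+g+1)_{k+1}` for odd `n`. Only indices `m ≤ n` are meaningful, as subtraction in `ℕ` truncates.
-/
def biCoef (n : ℕ) (g a b c : ℂ) (m : ℕ) : ℂ :=
  (-1) ^ m * poch (-((n / 2 : ℕ) : ℂ)) (if Even n then (m + 1) / 2 else m / 2)
    * poch (((n / 2 : ℕ) : ℂ) + g + 1) (if Even n then m / 2 else (m + 1) / 2)
    / ((m / 2).factorial : ℂ)
    * (poch (c + (m / 2 : ℕ)) (n / 2 - m / 2)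
      * poch (a + ((m + 1) / 2 : ℕ)) ((n + 1) / 2 - (m + 1) / 2)
      * poch (b + ((m + 1) / 2 : ℕ)) ((n + 1) / 2 - (m + 1) / 2))

theorem biCoef_even_even (e k : ℕ) (g a b c : ℂ) :
    biCoef (2 * e) g a b c (2 * k) =
      poch (-e) k * poch (e + g + 1) k / (k.factorial : ℂ)
        * (poch (c + k) (e - k) * poch (a + k) (e - k) * poch (b + k) (e - k)) := by
  unfold biCoef
  rw [if_pos (even_two_mul e), if_pos (even_two_mul e), show (2 * k + 1) / 2 = k by omega,
    show 2 * k / 2 = k by omega, show 2 * e / 2 = e by omega, show (2 * e + 1) / 2 = e by omega,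
    pow_mul]
  norm_num

theorem biCoef_even_odd (e k : ℕ) (g a b c : ℂ) :
    biCoef (2 * e) g a b c (2 * k + 1) =
      -(poch (-e) (k + 1) * poch (e + g + 1) k / (k.factorial : ℂ))
        * (poch (c + k) (e - k) * poch (a + k + 1) (e - (k + 1))
          * poch (b + k + 1) (e - (k + 1))) := by
  unfold biCoef
  rw [if_pos (even_two_mul e), if_pos (even_two_mul e), show (2 * k + 1 + 1) / 2 = k + 1 by omega,
    show (2 * k + 1) / 2 = k by omega, show 2 * e / 2 = e by omega,
    show (2 * e + 1) / 2 = e by omega, pow_succ, pow_mul]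
  push_cast
  rw [add_assoc a, add_assoc b]
  norm_num
  ring

theorem biCoef_odd_even (e k : ℕ) (g a b c : ℂ) :
    biCoef (2 * e + 1) g a b c (2 * k) =
      poch (-e) k * poch (e + g + 1) k / (k.factorial : ℂ)
        * (poch (c + k) (e - k) * poch (a + k) (e + 1 - k) * poch (b + k) (e + 1 - k)) := by
  have he : ¬ Even (2 * e + 1) := by simp
  unfold biCoef
  rw [if_neg he, if_neg he, show (2 * k + 1) / 2 = k by omega,
    show 2 * k / 2 = k by omega, show (2 * e + 1) / 2 = e by omega,
    show (2 * e + 1 + 1) / 2 = e + 1 by omega, pow_mul]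
  norm_num

theorem biCoef_odd_odd (e k : ℕ) (g a b c : ℂ) :
    biCoef (2 * e + 1) g a b c (2 * k + 1) =
      -(poch (-e) k * poch (e + g + 1) (k + 1) / (k.factorial : ℂ))
        * (poch (c + k) (e - k) * poch (a + k + 1) (e - k) * poch (b + k + 1) (e - k)) := by
  have he : ¬ Even (2 * e + 1) := by simp
  unfold biCoef
  rw [if_neg he, if_neg he, show (2 * k + 1 + 1) / 2 = k + 1 by omega,
    show (2 * k + 1) / 2 = k by omega, show (2 * e + 1) / 2 = e by omega,
    show (2 * e + 1 + 1) / 2 = e + 1 by omega, show e + 1 - (k + 1) = e - k by omega,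
    pow_succ, pow_mul]
  push_cast
  rw [add_assoc a, add_assoc b]
  norm_num
  ring

theorem sum_range_even_odd (f : ℕ → ℂ) (e p : ℕ) (hp : p < 2) :
    ∑ m ∈ Finset.range (2 * e + p + 1), f m
      = ∑ k ∈ Finset.range (e + 1), f (2 * k) + ∑ k ∈ Finset.range (e + p), f (2 * k + 1) := by
  have h : ∀ e : ℕ, ∑ m ∈ Finset.range (2 * e), f m
      = ∑ k ∈ Finset.range e, f (2 * k) + ∑ k ∈ Finset.range e, f (2 * k + 1) := by
    intro e
    induction e with
    | zero => simp
    | succ e ih =>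
      rw [show 2 * (e + 1) = 2 * e + 1 + 1 by ring, Finset.sum_range_succ, Finset.sum_range_succ,
        Finset.sum_range_succ, Finset.sum_range_succ, ih]
      ring
  interval_cases p
  · rw [add_zero, Finset.sum_range_succ, h, Finset.sum_range_succ, add_zero]
    ring
  · rw [show 2 * e + 1 + 1 = 2 * (e + 1) by ring, h]

/-- The two hypergeometric sums defining `monicBI` run over the even and over the odd elements of
the Newton basis. -/
theorem monicBI_eq_sum (n : ℕ) (x ρ₁ ρ₂ r₁ r₂ : ℂ) :
    monicBI n x ρ₁ ρ₂ r₁ r₂ =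
      (-1) ^ n / poch (((n / 2 : ℕ) : ℂ) + (ρ₁ + ρ₂ - r₁ - r₂) + 1) (n / 2 + n % 2) *
        ∑ m ∈ Finset.range (n + 1),
          biCoef n (ρ₁ + ρ₂ - r₁ - r₂) (ρ₁ - r₁ + 1 / 2) (ρ₂ - r₁ + 1 / 2) (1 - r₁ - r₂) m
            * newtonBI r₁ m x := by
  have h32 : x - r₁ + 3 / 2 = x - r₁ + 1 / 2 + 1 := by ring
  unfold monicBI
  rw [h32]
  dsimp only
  generalize ρ₁ + ρ₂ - r₁ - r₂ = g
  generalize ρ₁ - r₁ + 1 / 2 = a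
  generalize ρ₂ - r₁ + 1 / 2 = b
  generalize 1 - r₁ - r₂ = c
  congr 1
  obtain ⟨e, rfl | rfl⟩ := Nat.even_or_odd' n
  · rw [show 2 * e / 2 = e by omega, show 2 * e % 2 = 0 by omega, Finset.mul_sum]
    refine Eq.trans ?_ (sum_range_even_odd _ e 0 (by norm_num)).symm
    simp only [add_zero]
    congr 1
    · refine Finset.sum_congr rfl fun k _ => ?_
      rw [biCoef_even_even, newtonBI_even]
      ring
    · refine Finset.sum_congr rfl fun k _ => ?_
      rw [biCoef_even_odd, newtonBI_odd, pow_mul, poch_succ_left (-(e : ℂ)),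
        poch_succ_left (x - r₁ + 1 / 2),
        add_right_comm a, add_right_comm b]
      push_cast
      simp only [sub_zero]
      norm_num
      ring
  · rw [show (2 * e + 1) / 2 = e by omega, show (2 * e + 1) % 2 = 1 by omega,
      sum_range_even_odd _ e 1 (by norm_num), Finset.mul_sum]
    congr 1
    · refine Finset.sum_congr rfl fun k _ => ?_
      rw [biCoef_odd_even, newtonBI_even]
      ring
    · refine Finset.sum_congr rfl fun k _ => ?_
      rw [biCoef_odd_odd, newtonBI_odd, pow_succ, pow_mul, poch_succ_left ((e : ℂ) + g + 1),
        poch_succ_left (x - r₁ + 1 / 2), add_right_comm a, add_right_comm b,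
        show e + 1 - (k + 1) = e - k by omega]
      push_cast
      rw [show -(e : ℂ) - 1 + 1 = -e by ring,
        show (e : ℂ) + 1 + g + 1 = e + g + 1 + 1 by ring]
      norm_num
      ring

/-! ### Dunkl shift operators on the Newton basis -/

/-- If the operator `f ↦ U f(-x) + V f(x) + W f(-x-1)` is bidiagonal in a basis `φ_m`, then it maps
`∑ c'_m φ_m` to `κ ∑ c_m φ_m` as soon as the coefficients satisfy a two-term relation. -/
theorem bidiagonal_sum (φ : ℕ → ℂ → ℂ) (u v c c' : ℕ → ℂ) (U V W κ x : ℂ) (n : ℕ)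
    (h0 : U * φ 0 (-x) + V * φ 0 x + W * φ 0 (-x - 1) = u 0 * φ 0 x)
    (hs : ∀ m, U * φ (m + 1) (-x) + V * φ (m + 1) x + W * φ (m + 1) (-x - 1)
      = u (m + 1) * φ (m + 1) x + v (m + 1) * φ m x)
    (hc : ∀ m < n, u m * c' m + v (m + 1) * c' (m + 1) = κ * c m)
    (hn : u n * c' n = κ * c n) :
    U * (∑ m ∈ Finset.range (n + 1), c' m * φ m (-x))
        + V * (∑ m ∈ Finset.range (n + 1), c' m * φ m x)
        + W * (∑ m ∈ Finset.range (n + 1), c' m * φ m (-x - 1))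
      = κ * ∑ m ∈ Finset.range (n + 1), c m * φ m x := by
  have key : ∀ N ≤ n, U * (∑ m ∈ Finset.range (N + 1), c' m * φ m (-x))
        + V * (∑ m ∈ Finset.range (N + 1), c' m * φ m x)
        + W * (∑ m ∈ Finset.range (N + 1), c' m * φ m (-x - 1))
      = κ * (∑ m ∈ Finset.range N, c m * φ m x) + u N * c' N * φ N x := by
    intro N hN
    induction N with
    | zero =>
      simp only [zero_add, Finset.sum_range_one, Finset.sum_range_zero]
      linear_combination c' 0 * h0
    | succ N ih =>
      rw [Finset.sum_range_succ _ (N + 1), Finset.sum_range_succ _ (N + 1),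
        Finset.sum_range_succ _ (N + 1), Finset.sum_range_succ (fun m => c m * φ m x) N]
      linear_combination ih (by omega) + c' (N + 1) * hs N + φ N x * hc N (by omega)
  rw [key n le_rfl, Finset.sum_range_succ, hn]
  ring

theorem mul_mul_div_mul (p s d G : ℂ) : p * s / d * G = p / d * (s * G) := by ring

section action

variable {x ρ₁ ρ₂ r₁ r₂ : ℂ}

theorem eigenOp_newtonBI_zero (hx : x ≠ 0) (hx' : 2 * x + 1 ≠ 0) :
    (ρ₂ - x) * (x - ρ₁) / (2 * x) * newtonBI r₁ 0 (-x)
        + (-((ρ₂ - x) * (x - ρ₁) / (2 * x)) - (x - r₂ + 1 / 2) * (x - r₁ + 1 / 2) / (2 * x + 1))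
          * newtonBI r₁ 0 x
      + (x - r₂ + 1 / 2) * (x - r₁ + 1 / 2) / (2 * x + 1) * newtonBI r₁ 0 (-x - 1)
      = 0 * newtonBI r₁ 0 x := by
  simp only [newtonBI_zero]
  generalize hy : 2 * x + 1 = y at *
  field_simp
  rw [← hy]
  ring

/-- With the two companion lemmas for `φ₀` and for even positive indices: the operator having the
Bannai-Ito polynomials as eigenfunctions is bidiagonal in the Newton basis. -/
theorem eigenOp_newtonBI_odd (hx : x ≠ 0) (hx' : 2 * x + 1 ≠ 0) (k : ℕ) :
    (ρ₂ - x) * (x - ρ₁) / (2 * x) * newtonBI r₁ (2 * k + 1) (-x)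
        + (-((ρ₂ - x) * (x - ρ₁) / (2 * x)) - (x - r₂ + 1 / 2) * (x - r₁ + 1 / 2) / (2 * x + 1))
          * newtonBI r₁ (2 * k + 1) x
      + (x - r₂ + 1 / 2) * (x - r₁ + 1 / 2) / (2 * x + 1) * newtonBI r₁ (2 * k + 1) (-x - 1)
      = -((ρ₁ + ρ₂ - r₁ - r₂) + 1 + k) * newtonBI r₁ (2 * k + 1) x
        + (ρ₁ - r₁ + 1 / 2 + k) * (ρ₂ - r₁ + 1 / 2 + k) * newtonBI r₁ (2 * k) x := by
  rw [mul_mul_div_mul _ (x - r₁ + 1 / 2), newtonBI_odd_refl, newtonBI_odd_eq, newtonBI_odd_eq,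
    newtonBI_even_neg]
  generalize hy : 2 * x + 1 = y at *
  field_simp
  rw [← hy]
  ring

theorem eigenOp_newtonBI_even_succ (hx : x ≠ 0) (hx' : 2 * x + 1 ≠ 0) (k : ℕ) :
    (ρ₂ - x) * (x - ρ₁) / (2 * x) * newtonBI r₁ (2 * k + 2) (-x)
        + (-((ρ₂ - x) * (x - ρ₁) / (2 * x)) - (x - r₂ + 1 / 2) * (x - r₁ + 1 / 2) / (2 * x + 1))
          * newtonBI r₁ (2 * k + 2) x
      + (x - r₂ + 1 / 2) * (x - r₁ + 1 / 2) / (2 * x + 1) * newtonBI r₁ (2 * k + 2) (-x - 1)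
      = (k + 1) * newtonBI r₁ (2 * k + 2) x
        + -((k + 1) * ((k + 1) - r₁ - r₂)) * newtonBI r₁ (2 * k + 1) x := by
  rw [show newtonBI r₁ (2 * k + 2) (-x)
      = newtonBI r₁ (2 * k + 2) x from newtonBI_even_neg _ _ (k + 1),
    mul_mul_div_mul _ (x - r₁ + 1 / 2), newtonBI_even_succ_refl, newtonBI_even_succ_eq]
  generalize hy : 2 * x + 1 = y at *
  field_simp
  rw [← hy]
  ring

theorem lowerOp_newtonBI_zero (hx : x ≠ 0) (hx' : x + 1 / 2 ≠ 0) :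
    (ρ₂ - x) * (x - ρ₁) / x * newtonBI r₁ 0 (-x)
        + (ρ₂ - x) * (r₁ * x + ρ₁ * (x + 1 / 2)) / (x * (x + 1 / 2)) * newtonBI r₁ 0 x
      + (x + ρ₂ + 1) * (x - r₁ + 1 / 2) / (x + 1 / 2) * newtonBI r₁ 0 (-x - 1)
      = 2 * (0 + (ρ₂ - r₁ + 1 / 2)) * newtonBI r₁ 0 x := by
  simp only [newtonBI_zero]
  generalize hy : x + 1 / 2 = y at *
  field_simp
  rw [← hy]
  ring

/-- With its two companions: the part of `L₂` containing `z₂ ↦ -z₂ - 1/2`, stripped of its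
dependence on `γ` and `δ`, is bidiagonal in the Newton basis. -/
theorem lowerOp_newtonBI_odd (hx : x ≠ 0) (hx' : x + 1 / 2 ≠ 0) (k : ℕ) :
    (ρ₂ - x) * (x - ρ₁) / x * newtonBI r₁ (2 * k + 1) (-x)
        + (ρ₂ - x) * (r₁ * x + ρ₁ * (x + 1 / 2)) / (x * (x + 1 / 2)) * newtonBI r₁ (2 * k + 1) x
      + (x + ρ₂ + 1) * (x - r₁ + 1 / 2) / (x + 1 / 2) * newtonBI r₁ (2 * k + 1) (-x - 1)
      = -(2 * (ρ₁ + ρ₂ + 1 + k)) * newtonBI r₁ (2 * k + 1) x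
        + 2 * (ρ₁ - r₁ + 1 / 2 + k) * (ρ₂ - r₁ + 1 / 2 + k) * newtonBI r₁ (2 * k) x := by
  rw [mul_mul_div_mul _ (x - r₁ + 1 / 2), newtonBI_odd_refl, newtonBI_odd_eq, newtonBI_odd_eq,
    newtonBI_even_neg]
  generalize hy : x + 1 / 2 = y at *
  field_simp
  rw [← hy]
  ring

theorem lowerOp_newtonBI_even_succ (hx : x ≠ 0) (hx' : x + 1 / 2 ≠ 0) (k : ℕ) :
    (ρ₂ - x) * (x - ρ₁) / x * newtonBI r₁ (2 * k + 2) (-x)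
        + (ρ₂ - x) * (r₁ * x + ρ₁ * (x + 1 / 2)) / (x * (x + 1 / 2)) * newtonBI r₁ (2 * k + 2) x
      + (x + ρ₂ + 1) * (x - r₁ + 1 / 2) / (x + 1 / 2) * newtonBI r₁ (2 * k + 2) (-x - 1)
      = 2 * ((k + 1) + (ρ₂ - r₁ + 1 / 2)) * newtonBI r₁ (2 * k + 2) x
        + -(2 * (k + 1) * ((k + 1) + (ρ₂ - r₁ + 1 / 2))) * newtonBI r₁ (2 * k + 1) x := by
  rw [show newtonBI r₁ (2 * k + 2) (-x)
      = newtonBI r₁ (2 * k + 2) x from newtonBI_even_neg _ _ (k + 1),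
    mul_mul_div_mul _ (x - r₁ + 1 / 2), newtonBI_even_succ_refl, newtonBI_even_succ_eq]
  generalize hy : x + 1 / 2 = y at *
  field_simp
  rw [← hy]
  ring

theorem raiseOp_newtonBI_zero (hx : x ≠ 0) (hx' : x + 1 / 2 ≠ 0) :
    (1 / 2 - r₂ - x) * (x - ρ₁) / x * newtonBI r₁ 0 (-x)
        + (x - r₂ + 1 / 2) * (r₁ * x + ρ₁ * (x + 1 / 2)) / (x * (x + 1 / 2)) * newtonBI r₁ 0 x
      + (x - r₂ + 1 / 2) * (x - r₁ + 1 / 2) / (x + 1 / 2) * newtonBI r₁ 0 (-x - 1)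
      = 2 * (0 + (ρ₁ - r₂ + 1 / 2)) * newtonBI r₁ 0 x := by
  simp only [newtonBI_zero]
  generalize hy : x + 1 / 2 = y at *
  field_simp
  rw [← hy]
  ring

/-- With its two companions: the part of `L₂` containing `z₂ ↦ -z₂ + 1/2`, stripped of its
dependence on `γ` and `δ`, is bidiagonal in the Newton basis. -/
theorem raiseOp_newtonBI_odd (hx : x ≠ 0) (hx' : x + 1 / 2 ≠ 0) (k : ℕ) :
    (1 / 2 - r₂ - x) * (x - ρ₁) / x * newtonBI r₁ (2 * k + 1) (-x)
        + (x - r₂ + 1 / 2) * (r₁ * x + ρ₁ * (x + 1 / 2)) / (x * (x + 1 / 2))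
          * newtonBI r₁ (2 * k + 1) x
      + (x - r₂ + 1 / 2) * (x - r₁ + 1 / 2) / (x + 1 / 2) * newtonBI r₁ (2 * k + 1) (-x - 1)
      = -(2 * (1 - r₁ - r₂ + k)) * newtonBI r₁ (2 * k + 1) x
        + 2 * (ρ₁ - r₁ + 1 / 2 + k) * (1 - r₁ - r₂ + k) * newtonBI r₁ (2 * k) x := by
  rw [mul_mul_div_mul _ (x - r₁ + 1 / 2), newtonBI_odd_refl, newtonBI_odd_eq, newtonBI_odd_eq,
    newtonBI_even_neg]
  generalize hy : x + 1 / 2 = y at *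
  field_simp
  rw [← hy]
  ring

theorem raiseOp_newtonBI_even_succ (hx : x ≠ 0) (hx' : x + 1 / 2 ≠ 0) (k : ℕ) :
    (1 / 2 - r₂ - x) * (x - ρ₁) / x * newtonBI r₁ (2 * k + 2) (-x)
        + (x - r₂ + 1 / 2) * (r₁ * x + ρ₁ * (x + 1 / 2)) / (x * (x + 1 / 2))
          * newtonBI r₁ (2 * k + 2) x
      + (x - r₂ + 1 / 2) * (x - r₁ + 1 / 2) / (x + 1 / 2) * newtonBI r₁ (2 * k + 2) (-x - 1)
      = 2 * ((k + 1) + (ρ₁ - r₂ + 1 / 2)) * newtonBI r₁ (2 * k + 2) x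
        + -(2 * (k + 1) * ((k + 1) - r₁ - r₂)) * newtonBI r₁ (2 * k + 1) x := by
  rw [show newtonBI r₁ (2 * k + 2) (-x)
      = newtonBI r₁ (2 * k + 2) x from newtonBI_even_neg _ _ (k + 1),
    mul_mul_div_mul _ (x - r₁ + 1 / 2), newtonBI_even_succ_refl, newtonBI_even_succ_eq]
  generalize hy : x + 1 / 2 = y at *
  field_simp
  rw [← hy]
  ring

end action

/-! ### Two-term relations between the coefficients -/

theorem succ_mul_biCoef_even_even (e k : ℕ) (g a b c : ℂ) :
    (k + 1) * biCoef (2 * e) g a b c (2 * k + 2) =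
      poch (-e) (k + 1) * poch (e + g + 1) (k + 1) / (k.factorial : ℂ)
        * (poch (c + k + 1) (e - (k + 1)) * poch (a + k + 1) (e - (k + 1))
          * poch (b + k + 1) (e - (k + 1))) := by
  have hk : (k : ℂ) + 1 ≠ 0 := by exact_mod_cast k.succ_ne_zero
  rw [show 2 * k + 2 = 2 * (k + 1) by ring, biCoef_even_even, Nat.factorial_succ]
  push_cast
  rw [← add_assoc, ← add_assoc, ← add_assoc]
  field_simp

theorem succ_mul_biCoef_odd_even (e k : ℕ) (g a b c : ℂ) :
    (k + 1) * biCoef (2 * e + 1) g a b c (2 * k + 2) =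
      poch (-e) (k + 1) * poch (e + g + 1) (k + 1) / (k.factorial : ℂ)
        * (poch (c + k + 1) (e - (k + 1)) * poch (a + k + 1) (e - k)
          * poch (b + k + 1) (e - k)) := by
  have hk : (k : ℂ) + 1 ≠ 0 := by exact_mod_cast k.succ_ne_zero
  rw [show 2 * k + 2 = 2 * (k + 1) by ring, biCoef_odd_even, Nat.factorial_succ,
    show e + 1 - (k + 1) = e - k by omega]
  push_cast
  rw [← add_assoc, ← add_assoc, ← add_assoc]
  field_simp

/-- The four lemmas `biCoef_eigen_*`, for the parities of the degree and of the index, are the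
recurrence that the eigenvalue equation imposes on the coefficients. -/
theorem biCoef_eigen_even_even {e k : ℕ} (h : k < e) (g a b c : ℂ) :
    k * biCoef (2 * e) g a b c (2 * k) + ((a + k) * (b + k)) * biCoef (2 * e) g a b c (2 * k + 1)
      = e * biCoef (2 * e) g a b c (2 * k) := by
  obtain ⟨j, hj⟩ : ∃ j, e = k + j + 1 := ⟨e - k - 1, by omega⟩
  have he : (e : ℂ) = k + j + 1 := by rw [hj]; push_cast; ring
  have s0 : e - k = j + 1 := by omega
  have s1 : e - (k + 1) = j := by omega
  have h0 : poch (a + k) (j + 1) = (a + k) * poch (a + k + 1) j := poch_succ_left _ _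
  have h1 : poch (b + k) (j + 1) = (b + k) * poch (b + k + 1) j := poch_succ_left _ _
  simp only [biCoef_even_even, biCoef_even_odd]
  simp only [s0, s1, poch_succ_right (-(e : ℂ)), h0, h1]
  simp only [he]
  ring

/-- The reflection `z₂ ↦ -z₂ - 1/2` changes `(b, c)` into `(c - 1, b + 1)`; the four lemmas
`biCoef_lower_*` compare the coefficients before and after it. -/
theorem biCoef_lower_even_even {e k : ℕ} (h : k < e) (g a b c : ℂ) :
    2 * (k + b) * biCoef (2 * e) g a (c - 1) (b + 1) (2 * k)
        + (2 * (a + k) * (b + k)) * biCoef (2 * e) g a (c - 1) (b + 1) (2 * k + 1)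
      = 2 * (e + b) * biCoef (2 * e) g a b c (2 * k) := by
  obtain ⟨j, hj⟩ : ∃ j, e = k + j + 1 := ⟨e - k - 1, by omega⟩
  have he : (e : ℂ) = k + j + 1 := by rw [hj]; push_cast; ring
  have s0 : e - k = j + 1 := by omega
  have s1 : e - (k + 1) = j := by omega
  have h0 : poch (a + k) (j + 1) = (a + k) * poch (a + k + 1) j := poch_succ_left _ _
  have h1 : poch (b + k) (j + 1) = (b + k) * poch (b + k + 1) j := poch_succ_left _ _
  have h2 : poch (b + 1 + k) (j + 1) = poch (b + k + 1) j * (b + 1 + k + j) := by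
    rw [poch_succ_right]; ring_nf
  have h3 : poch (c + k) (j + 1) = poch (c + k) j * (c + k + j) := poch_succ_right _ _
  have h4 : poch (c - 1 + k) (j + 1) = (c - 1 + k) * poch (c + k) j := by
    rw [poch_succ_left]; ring_nf
  have h5 : poch (c - 1 + k + 1) j = poch (c + k) j := by ring_nf
  simp only [biCoef_even_even, biCoef_even_odd]
  simp only [s0, s1, poch_succ_right (-(e : ℂ)), h0, h1, h2, h3, h4, h5]
  simp only [he]
  ring

/-- The reflection `z₂ ↦ -z₂ + 1/2` exchanges `b` and `c`; the four lemmas `biCoef_raise_*` compare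
the coefficients before and after it. -/
theorem biCoef_raise_even_even {e k : ℕ} (h : k < e) (g a b c : ℂ) :
    2 * (k + (g - b + 1)) * biCoef (2 * e) g a c b (2 * k)
        + (2 * (a + k) * (c + k)) * biCoef (2 * e) g a c b (2 * k + 1)
      = 2 * (e + (g - b + 1)) * biCoef (2 * e) g a b c (2 * k) := by
  obtain ⟨j, hj⟩ : ∃ j, e = k + j + 1 := ⟨e - k - 1, by omega⟩
  have he : (e : ℂ) = k + j + 1 := by rw [hj]; push_cast; ring
  have s0 : e - k = j + 1 := by omega
  have s1 : e - (k + 1) = j := by omega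
  have h0 : poch (a + k) (j + 1) = (a + k) * poch (a + k + 1) j := poch_succ_left _ _
  have h1 : poch (c + k) (j + 1) = (c + k) * poch (c + k + 1) j := poch_succ_left _ _
  simp only [biCoef_even_even, biCoef_even_odd]
  simp only [s0, s1, poch_succ_right (-(e : ℂ)), h0, h1]
  simp only [he]
  ring

theorem biCoef_eigen_odd_even {e k : ℕ} (h : k ≤ e) (g a b c : ℂ) :
    k * biCoef (2 * e + 1) g a b c (2 * k)
        + ((a + k) * (b + k)) * biCoef (2 * e + 1) g a b c (2 * k + 1)
      = -(g + 1 + e) * biCoef (2 * e + 1) g a b c (2 * k) := by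
  obtain ⟨j, hj⟩ : ∃ j, e = k + j := ⟨e - k, by omega⟩
  have he : (e : ℂ) = k + j := by rw [hj]; push_cast; ring
  have s0 : e - k = j := by omega
  have s1 : e + 1 - k = j + 1 := by omega
  have h0 : poch (a + k) (j + 1) = (a + k) * poch (a + k + 1) j := poch_succ_left _ _
  have h1 : poch (b + k) (j + 1) = (b + k) * poch (b + k + 1) j := poch_succ_left _ _
  simp only [biCoef_odd_even, biCoef_odd_odd]
  simp only [s0, s1, poch_succ_right ((e : ℂ) + g + 1), h0, h1]
  simp only [he]
  ring

theorem biCoef_lower_odd_even {e k : ℕ} (h : k ≤ e) (g a b c : ℂ) :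
    2 * (k + b) * biCoef (2 * e + 1) g a (c - 1) (b + 1) (2 * k)
        + (2 * (a + k) * (b + k)) * biCoef (2 * e + 1) g a (c - 1) (b + 1) (2 * k + 1)
      = -(2 * (g + 2 - c + e)) * biCoef (2 * e + 1) g a b c (2 * k) := by
  obtain ⟨j, hj⟩ : ∃ j, e = k + j := ⟨e - k, by omega⟩
  have he : (e : ℂ) = k + j := by rw [hj]; push_cast; ring
  have s0 : e - k = j := by omega
  have s1 : e + 1 - k = j + 1 := by omega
  have h0 : poch (a + k) (j + 1) = (a + k) * poch (a + k + 1) j := poch_succ_left _ _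
  have h1 : poch (b + k) (j + 1) = (b + k) * poch (b + k + 1) j := poch_succ_left _ _
  have h2 : poch (c - 1 + k) (j + 1) = (c - 1 + k) * poch (c + k) j := by
    rw [poch_succ_left]; ring_nf
  have h3 : poch (c - 1 + k + 1) j = poch (c + k) j := by ring_nf
  have h4 : poch (b + 1 + k) j = poch (b + k + 1) j := by ring_nf
  simp only [biCoef_odd_even, biCoef_odd_odd]
  simp only [s0, s1, poch_succ_right ((e : ℂ) + g + 1), h0, h1, h2, h3, h4]
  simp only [he]
  ring

theorem biCoef_raise_odd_even {e k : ℕ} (h : k ≤ e) (g a b c : ℂ) :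
    2 * (k + (g - b + 1)) * biCoef (2 * e + 1) g a c b (2 * k)
        + (2 * (a + k) * (c + k)) * biCoef (2 * e + 1) g a c b (2 * k + 1)
      = -(2 * (c + e)) * biCoef (2 * e + 1) g a b c (2 * k) := by
  obtain ⟨j, hj⟩ : ∃ j, e = k + j := ⟨e - k, by omega⟩
  have he : (e : ℂ) = k + j := by rw [hj]; push_cast; ring
  have s0 : e - k = j := by omega
  have s1 : e + 1 - k = j + 1 := by omega
  have h0 : poch (a + k) (j + 1) = (a + k) * poch (a + k + 1) j := poch_succ_left _ _
  have h1 : poch (b + k) (j + 1) = poch (b + k) j * (b + k + j) := poch_succ_right _ _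
  have h2 : poch (c + k) (j + 1) = poch (c + k) j * (c + k + j) := poch_succ_right _ _
  simp only [biCoef_odd_even, biCoef_odd_odd]
  simp only [s0, s1, poch_succ_right ((e : ℂ) + g + 1), h0, h1, h2]
  simp only [he]
  linear_combination -(2 * (a + k)
      * (poch (-((k : ℂ) + j)) k
        * (poch ((k : ℂ) + j + g + 1) k * ((k : ℂ) + j + g + 1 + k)) / (k.factorial : ℂ))
          * poch (b + k) j * poch (a + k + 1) j) * mul_poch_shift (c + k) j

theorem biCoef_eigen_even_odd {e k : ℕ} (h : k < e) (g a b c : ℂ) :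
    -(g + 1 + k) * biCoef (2 * e) g a b c (2 * k + 1)
        + -((k + 1) * (k + c)) * biCoef (2 * e) g a b c (2 * k + 2)
      = e * biCoef (2 * e) g a b c (2 * k + 1) := by
  obtain ⟨j, hj⟩ : ∃ j, e = k + j + 1 := ⟨e - k - 1, by omega⟩
  have he : (e : ℂ) = k + j + 1 := by rw [hj]; push_cast; ring
  have s0 : e - k = j + 1 := by omega
  have s1 : e - (k + 1) = j := by omega
  have h0 : poch (c + k) (j + 1) = (c + k) * poch (c + k + 1) j := poch_succ_left _ _
  have hk := succ_mul_biCoef_even_even e k g a b c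
  simp only [biCoef_even_odd]
  simp only [s0, s1, poch_succ_right (-(e : ℂ)), poch_succ_right ((e : ℂ) + g + 1), h0] at hk ⊢
  simp only [he] at hk ⊢
  linear_combination (-(k + c)) * hk

theorem biCoef_lower_even_odd {e k : ℕ} (h : k < e) (g a b c : ℂ) :
    -(2 * (g + 2 - c + k)) * biCoef (2 * e) g a (c - 1) (b + 1) (2 * k + 1)
        + -(2 * (k + 1) * (k + 1 + b)) * biCoef (2 * e) g a (c - 1) (b + 1) (2 * k + 2)
      = 2 * (e + b) * biCoef (2 * e) g a b c (2 * k + 1) := by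
  obtain ⟨j, hj⟩ : ∃ j, e = k + j + 1 := ⟨e - k - 1, by omega⟩
  have he : (e : ℂ) = k + j + 1 := by rw [hj]; push_cast; ring
  have s0 : e - k = j + 1 := by omega
  have s1 : e - (k + 1) = j := by omega
  have h0 : poch (b + 1 + k) (j + 1) = poch (b + k + 1) j * (b + 1 + k + j) := by
    rw [poch_succ_right]; ring_nf
  have h1 : poch (c + k) (j + 1) = poch (c + k) j * (c + k + j) := poch_succ_right _ _
  have h2 : poch (c - 1 + k + 1) j = poch (c + k) j := by ring_nf
  have hk := succ_mul_biCoef_even_even e k g a (c - 1) (b + 1)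
  simp only [biCoef_even_odd]
  simp only [s0, s1, poch_succ_right (-(e : ℂ)), poch_succ_right ((e : ℂ) + g + 1), h0, h1,
      h2] at hk ⊢
  simp only [he] at hk ⊢
  have hb : (b + k + 1) * poch (b + 1 + k + 1) j = poch (b + k + 1) j * (b + k + 1 + j) := by
    rw [← mul_poch_shift, add_right_comm b 1]
  linear_combination (-(2 * (k + 1 + b))) * hk
    - 2 * (poch (-((k : ℂ) + j + 1)) k * (-((k : ℂ) + j + 1) + k)
        * (poch ((k : ℂ) + j + 1 + g + 1) k * ((k : ℂ) + j + 1 + g + 1 + k)) / (k.factorial : ℂ)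
        * poch (a + k + 1) j * poch (c + k) j) * hb

theorem biCoef_raise_even_odd {e k : ℕ} (h : k < e) (g a b c : ℂ) :
    -(2 * (c + k)) * biCoef (2 * e) g a c b (2 * k + 1)
        + -(2 * (k + 1) * (k + c)) * biCoef (2 * e) g a c b (2 * k + 2)
      = 2 * (e + (g - b + 1)) * biCoef (2 * e) g a b c (2 * k + 1) := by
  obtain ⟨j, hj⟩ : ∃ j, e = k + j + 1 := ⟨e - k - 1, by omega⟩
  have he : (e : ℂ) = k + j + 1 := by rw [hj]; push_cast; ring
  have s0 : e - k = j + 1 := by omega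
  have s1 : e - (k + 1) = j := by omega
  have h0 : poch (b + k) (j + 1) = (b + k) * poch (b + k + 1) j := poch_succ_left _ _
  have h1 : poch (c + k) (j + 1) = (c + k) * poch (c + k + 1) j := poch_succ_left _ _
  have hk := succ_mul_biCoef_even_even e k g a c b
  simp only [biCoef_even_odd]
  simp only [s0, s1, poch_succ_right (-(e : ℂ)), poch_succ_right ((e : ℂ) + g + 1), h0, h1] at hk ⊢
  simp only [he] at hk ⊢
  linear_combination (-(2 * (k + c))) * hk

theorem biCoef_eigen_odd_odd {e k : ℕ} (h : k < e) (g a b c : ℂ) :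
    -(g + 1 + k) * biCoef (2 * e + 1) g a b c (2 * k + 1)
        + -((k + 1) * (k + c)) * biCoef (2 * e + 1) g a b c (2 * k + 2)
      = -(g + 1 + e) * biCoef (2 * e + 1) g a b c (2 * k + 1) := by
  obtain ⟨j, hj⟩ : ∃ j, e = k + j + 1 := ⟨e - k - 1, by omega⟩
  have he : (e : ℂ) = k + j + 1 := by rw [hj]; push_cast; ring
  have s0 : e - k = j + 1 := by omega
  have s1 : e - (k + 1) = j := by omega
  have h0 : poch (c + k) (j + 1) = (c + k) * poch (c + k + 1) j := poch_succ_left _ _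
  have hk := succ_mul_biCoef_odd_even e k g a b c
  simp only [biCoef_odd_odd]
  simp only [s0, s1, poch_succ_right (-(e : ℂ)), poch_succ_right ((e : ℂ) + g + 1), h0] at hk ⊢
  simp only [he] at hk ⊢
  linear_combination (-(k + c)) * hk

theorem biCoef_lower_odd_odd {e k : ℕ} (h : k < e) (g a b c : ℂ) :
    -(2 * (g + 2 - c + k)) * biCoef (2 * e + 1) g a (c - 1) (b + 1) (2 * k + 1)
        + -(2 * (k + 1) * (k + 1 + b)) * biCoef (2 * e + 1) g a (c - 1) (b + 1) (2 * k + 2)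
      = -(2 * (g + 2 - c + e)) * biCoef (2 * e + 1) g a b c (2 * k + 1) := by
  obtain ⟨j, hj⟩ : ∃ j, e = k + j + 1 := ⟨e - k - 1, by omega⟩
  have he : (e : ℂ) = k + j + 1 := by rw [hj]; push_cast; ring
  have s0 : e - k = j + 1 := by omega
  have s1 : e - (k + 1) = j := by omega
  have h0 : poch (b + 1 + k) (j + 1) = (b + 1 + k) * poch (b + 1 + k + 1) j := poch_succ_left _ _
  have h1 : poch (b + k + 1) (j + 1) = (b + k + 1) * poch (b + 1 + k + 1) j := by
    rw [poch_succ_left]; ring_nf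
  have h2 : poch (c - 1 + k + 1) (j + 1) = poch (c + k) (j + 1) := by ring_nf
  have hk := succ_mul_biCoef_odd_even e k g a (c - 1) (b + 1)
  simp only [biCoef_odd_odd]
  simp only [s0, s1, poch_succ_right (-(e : ℂ)), poch_succ_right ((e : ℂ) + g + 1), h0, h1,
      h2] at hk ⊢
  simp only [he] at hk ⊢
  linear_combination (-(2 * (k + 1 + b))) * hk

theorem biCoef_raise_odd_odd {e k : ℕ} (h : k < e) (g a b c : ℂ) :
    -(2 * (c + k)) * biCoef (2 * e + 1) g a c b (2 * k + 1)
        + -(2 * (k + 1) * (k + c)) * biCoef (2 * e + 1) g a c b (2 * k + 2)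
      = -(2 * (c + e)) * biCoef (2 * e + 1) g a b c (2 * k + 1) := by
  obtain ⟨j, hj⟩ : ∃ j, e = k + j + 1 := ⟨e - k - 1, by omega⟩
  have he : (e : ℂ) = k + j + 1 := by rw [hj]; push_cast; ring
  have s0 : e - k = j + 1 := by omega
  have s1 : e - (k + 1) = j := by omega
  have h0 : poch (b + k) (j + 1) = (b + k) * poch (b + k + 1) j := poch_succ_left _ _
  have h1 : poch (c + k) (j + 1) = (c + k) * poch (c + k + 1) j := poch_succ_left _ _
  have h2 : poch (c + k + 1) (j + 1) = poch (c + k + 1) j * (c + k + 1 + j) := poch_succ_right _ _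
  have h3 : poch (b + k + 1) (j + 1) = poch (b + k + 1) j * (b + k + 1 + j) := poch_succ_right _ _
  have hk := succ_mul_biCoef_odd_even e k g a c b
  simp only [biCoef_odd_odd]
  simp only [s0, s1, poch_succ_right (-(e : ℂ)), poch_succ_right ((e : ℂ) + g + 1), h0, h1, h2,
      h3] at hk ⊢
  simp only [he] at hk ⊢
  linear_combination (-(2 * (k + c))) * hk

/-! ### Eigenvalue equation and contiguity relations -/

/-- `bidiagonal_sum` for the Newton basis, with the diagonal entries `ue`, `uo` and the entries
`ve`, `vo` below them split by parity: `ve k` belongs to `φ_{2k+2}` and `vo k` to `φ_{2k+1}`. -/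
theorem newtonBI_sum_map {U V W κ x r : ℂ} {C C' ue uo ve vo : ℕ → ℂ} {n : ℕ}
    (h0 : U * newtonBI r 0 (-x) + V * newtonBI r 0 x + W * newtonBI r 0 (-x - 1)
      = ue 0 * newtonBI r 0 x)
    (hodd : ∀ k, U * newtonBI r (2 * k + 1) (-x) + V * newtonBI r (2 * k + 1) x
        + W * newtonBI r (2 * k + 1) (-x - 1)
      = uo k * newtonBI r (2 * k + 1) x + vo k * newtonBI r (2 * k) x)
    (heven : ∀ k, U * newtonBI r (2 * k + 2) (-x) + V * newtonBI r (2 * k + 2) x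
        + W * newtonBI r (2 * k + 2) (-x - 1)
      = ue (k + 1) * newtonBI r (2 * k + 2) x + ve k * newtonBI r (2 * k + 1) x)
    (hce : ∀ k, 2 * k < n → ue k * C' (2 * k) + vo k * C' (2 * k + 1) = κ * C (2 * k))
    (hco : ∀ k, 2 * k + 1 < n →
      uo k * C' (2 * k + 1) + ve k * C' (2 * k + 2) = κ * C (2 * k + 1))
    (hn : (if Even n then ue (n / 2) else uo (n / 2)) * C' n = κ * C n) :
    U * (∑ m ∈ Finset.range (n + 1), C' m * newtonBI r m (-x))
        + V * (∑ m ∈ Finset.range (n + 1), C' m * newtonBI r m x)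
        + W * (∑ m ∈ Finset.range (n + 1), C' m * newtonBI r m (-x - 1))
      = κ * ∑ m ∈ Finset.range (n + 1), C m * newtonBI r m x := by
  have hdiv : ∀ k : ℕ, (2 * k + 1) / 2 = k := fun k => by omega
  have hdiv' : ∀ k : ℕ, (2 * k + 1 + 1) / 2 = k + 1 := fun k => by omega
  have hE : ∀ k : ℕ, Even (2 * k + 1 + 1) := fun k => ⟨k + 1, by ring⟩
  refine bidiagonal_sum (newtonBI r) (fun m => if Even m then ue (m / 2) else uo (m / 2))
    (fun m => if Even m then ve (m / 2 - 1) else vo (m / 2)) C C' U V W κ x n ?_ ?_ ?_ ?_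
  · simpa using h0
  · intro m
    obtain ⟨k, rfl | rfl⟩ := Nat.even_or_odd' m
    · simpa [hdiv] using hodd k
    · simpa [hdiv', hE] using heven k
  · intro m hm
    obtain ⟨k, rfl | rfl⟩ := Nat.even_or_odd' m
    · simpa [hdiv] using hce k hm
    · simpa [hdiv, hdiv', hE] using hco k hm
  · exact hn

/-- The leading coefficient depends on `n` and `g` only. -/
theorem biCoef_self (n : ℕ) (g a b c a' b' c' : ℂ) :
    biCoef n g a b c n = biCoef n g a' b' c' n := by
  unfold biCoef
  simp only [Nat.sub_self, poch_zero]

/-- The eigenvalue of the univariate Bannai-Ito operator on the polynomial of degree `n`. -/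
def eigBI (n : ℕ) (g : ℂ) : ℂ := if Even n then n / 2 else -(g + (n + 1) / 2)

/-- The univariate Bannai-Ito polynomials are eigenfunctions of a first-order Dunkl shift operator
in `x`. -/
theorem monicBI_eigen (n : ℕ) {x : ℂ} (ρ₁ ρ₂ r₁ r₂ : ℂ) (hx : x ≠ 0) (hx' : 2 * x + 1 ≠ 0) :
    (ρ₂ - x) * (x - ρ₁) / (2 * x) * monicBI n (-x) ρ₁ ρ₂ r₁ r₂
        + (-((ρ₂ - x) * (x - ρ₁) / (2 * x)) - (x - r₂ + 1 / 2) * (x - r₁ + 1 / 2) / (2 * x + 1))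
          * monicBI n x ρ₁ ρ₂ r₁ r₂
        + (x - r₂ + 1 / 2) * (x - r₁ + 1 / 2) / (2 * x + 1) * monicBI n (-x - 1) ρ₁ ρ₂ r₁ r₂
      = eigBI n (ρ₁ + ρ₂ - r₁ - r₂) * monicBI n x ρ₁ ρ₂ r₁ r₂ := by
  simp only [monicBI_eq_sum]
  set g := ρ₁ + ρ₂ - r₁ - r₂ with hg
  have key := newtonBI_sum_map (n := n) (κ := eigBI n g)
    (C := biCoef n g (ρ₁ - r₁ + 1 / 2) (ρ₂ - r₁ + 1 / 2) (1 - r₁ - r₂))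
    (C' := biCoef n g (ρ₁ - r₁ + 1 / 2) (ρ₂ - r₁ + 1 / 2) (1 - r₁ - r₂))
    (ue := fun k => k) (uo := fun k => -(g + 1 + k))
    (ve := fun k => -((k + 1) * (k + (1 - r₁ - r₂))))
    (vo := fun k => (ρ₁ - r₁ + 1 / 2 + k) * (ρ₂ - r₁ + 1 / 2 + k))
    (by simpa using eigenOp_newtonBI_zero (ρ₁ := ρ₁) (ρ₂ := ρ₂) (r₁ := r₁) (r₂ := r₂) hx hx')
    (fun k => eigenOp_newtonBI_odd hx hx' k)
    (fun k => (eigenOp_newtonBI_even_succ hx hx' k).trans (by push_cast; ring))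
    (fun k hk => by
      obtain ⟨e, rfl | rfl⟩ := Nat.even_or_odd' n
      · rw [eigBI, if_pos (even_two_mul e)]
        refine (biCoef_eigen_even_even (by omega) _ _ _ _).trans ?_
        push_cast
        ring
      · rw [eigBI, if_neg (by simp)]
        refine (biCoef_eigen_odd_even (by omega) _ _ _ _).trans ?_
        push_cast
        ring)
    (fun k hk => by
      obtain ⟨e, rfl | rfl⟩ := Nat.even_or_odd' n
      · rw [eigBI, if_pos (even_two_mul e)]
        refine (biCoef_eigen_even_odd (by omega) _ _ _ _).trans ?_
        push_cast
        ring
      · rw [eigBI, if_neg (by simp)]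
        refine (biCoef_eigen_odd_odd (by omega) _ _ _ _).trans ?_
        push_cast
        ring)
    (by
      obtain ⟨e, rfl | rfl⟩ := Nat.even_or_odd' n
      · rw [eigBI, if_pos (even_two_mul e), if_pos (even_two_mul e),
          show 2 * e / 2 = e by omega]
        push_cast
        ring
      · rw [eigBI, if_neg (by simp), if_neg (by simp), show (2 * e + 1) / 2 = e by omega]
        push_cast
        ring)
  linear_combination ((-1) ^ n / poch (((n / 2 : ℕ) : ℂ) + g + 1) (n / 2 + n % 2)) * key

/-- Contiguity relation for `(ρ₂, r₂) ↦ (-r₂ - 1/2, -ρ₂ - 1/2)`, which is the effect of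
`z₂ ↦ -z₂ - 1/2` on the parameters of the first factor of `bivariateBI`. -/
theorem monicBI_lower (n : ℕ) {x : ℂ} (ρ₁ ρ₂ r₁ r₂ : ℂ) (hx : x ≠ 0) (hx' : x + 1 / 2 ≠ 0) :
    (ρ₂ - x) * (x - ρ₁) / x * monicBI n (-x) ρ₁ (-r₂ - 1 / 2) r₁ (-ρ₂ - 1 / 2)
        + (ρ₂ - x) * (r₁ * x + ρ₁ * (x + 1 / 2)) / (x * (x + 1 / 2))
          * monicBI n x ρ₁ (-r₂ - 1 / 2) r₁ (-ρ₂ - 1 / 2)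
        + (x + ρ₂ + 1) * (x - r₁ + 1 / 2) / (x + 1 / 2)
          * monicBI n (-x - 1) ρ₁ (-r₂ - 1 / 2) r₁ (-ρ₂ - 1 / 2)
      = (if Even n then n + 2 * ρ₂ - 2 * r₁ + 1 else -(2 * ρ₁ + 2 * ρ₂ + 1 + n))
        * monicBI n x ρ₁ ρ₂ r₁ r₂ := by
  simp only [monicBI_eq_sum]
  rw [show ρ₁ + (-r₂ - 1 / 2) - r₁ - (-ρ₂ - 1 / 2) = ρ₁ + ρ₂ - r₁ - r₂ by ring,
    show -r₂ - 1 / 2 - r₁ + 1 / 2 = 1 - r₁ - r₂ - 1 by ring,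
    show 1 - r₁ - (-ρ₂ - 1 / 2) = ρ₂ - r₁ + 1 / 2 + 1 by ring]
  set g := ρ₁ + ρ₂ - r₁ - r₂ with hg
  have key := newtonBI_sum_map (n := n)
    (κ := if Even n then n + 2 * ρ₂ - 2 * r₁ + 1 else -(2 * ρ₁ + 2 * ρ₂ + 1 + n))
    (C := biCoef n g (ρ₁ - r₁ + 1 / 2) (ρ₂ - r₁ + 1 / 2) (1 - r₁ - r₂))
    (C' := biCoef n g (ρ₁ - r₁ + 1 / 2) (1 - r₁ - r₂ - 1) (ρ₂ - r₁ + 1 / 2 + 1))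
    (ue := fun k => 2 * (k + (ρ₂ - r₁ + 1 / 2)))
    (uo := fun k => -(2 * (g + 2 - (1 - r₁ - r₂) + k)))
    (ve := fun k => -(2 * (k + 1) * (k + 1 + (ρ₂ - r₁ + 1 / 2))))
    (vo := fun k => 2 * (ρ₁ - r₁ + 1 / 2 + k) * (ρ₂ - r₁ + 1 / 2 + k))
    (by simpa using lowerOp_newtonBI_zero (ρ₁ := ρ₁) (ρ₂ := ρ₂) (r₁ := r₁) hx hx')
    (fun k => (lowerOp_newtonBI_odd hx hx' k).trans (by rw [hg]; ring))
    (fun k => (lowerOp_newtonBI_even_succ hx hx' k).trans (by push_cast; ring))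
    (fun k hk => by
      obtain ⟨e, rfl | rfl⟩ := Nat.even_or_odd' n
      · rw [if_pos (even_two_mul e)]
        refine (biCoef_lower_even_even (by omega) _ _ _ _).trans ?_
        push_cast
        ring
      · rw [if_neg (by simp)]
        refine (biCoef_lower_odd_even (by omega) _ _ _ _).trans ?_
        rw [hg]
        push_cast
        ring)
    (fun k hk => by
      obtain ⟨e, rfl | rfl⟩ := Nat.even_or_odd' n
      · rw [if_pos (even_two_mul e)]
        refine (biCoef_lower_even_odd (by omega) _ _ _ _).trans ?_
        push_cast
        ring
      · rw [if_neg (by simp)]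
        refine (biCoef_lower_odd_odd (by omega) _ _ _ _).trans ?_
        rw [hg]
        push_cast
        ring)
    (by
      rw [biCoef_self n g _ (1 - r₁ - r₂ - 1) _ (ρ₁ - r₁ + 1 / 2) (ρ₂ - r₁ + 1 / 2) (1 - r₁ - r₂)]
      congr 1
      obtain ⟨e, rfl | rfl⟩ := Nat.even_or_odd' n
      · rw [if_pos (even_two_mul e), if_pos (even_two_mul e), show 2 * e / 2 = e by omega]
        push_cast
        ring
      · rw [if_neg (by simp), if_neg (by simp), show (2 * e + 1) / 2 = e by omega, hg]
        push_cast
        ring)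
  linear_combination ((-1) ^ n / poch (((n / 2 : ℕ) : ℂ) + g + 1) (n / 2 + n % 2)) * key

/-- Contiguity relation for `(ρ₂, r₂) ↦ (1/2 - r₂, 1/2 - ρ₂)`, which is the effect of
`z₂ ↦ -z₂ + 1/2` on the parameters of the first factor of `bivariateBI`. -/
theorem monicBI_raise (n : ℕ) {x : ℂ} (ρ₁ ρ₂ r₁ r₂ : ℂ) (hx : x ≠ 0) (hx' : x + 1 / 2 ≠ 0) :
    (1 / 2 - r₂ - x) * (x - ρ₁) / x * monicBI n (-x) ρ₁ (1 / 2 - r₂) r₁ (1 / 2 - ρ₂)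
        + (x - r₂ + 1 / 2) * (r₁ * x + ρ₁ * (x + 1 / 2)) / (x * (x + 1 / 2))
          * monicBI n x ρ₁ (1 / 2 - r₂) r₁ (1 / 2 - ρ₂)
        + (x - r₂ + 1 / 2) * (x - r₁ + 1 / 2) / (x + 1 / 2)
          * monicBI n (-x - 1) ρ₁ (1 / 2 - r₂) r₁ (1 / 2 - ρ₂)
      = (if Even n then n + 2 * ρ₁ - 2 * r₂ + 1 else 2 * r₁ + 2 * r₂ - n - 1)
        * monicBI n x ρ₁ ρ₂ r₁ r₂ := by
  simp only [monicBI_eq_sum]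
  rw [show ρ₁ + (1 / 2 - r₂) - r₁ - (1 / 2 - ρ₂) = ρ₁ + ρ₂ - r₁ - r₂ by ring,
    show 1 / 2 - r₂ - r₁ + 1 / 2 = 1 - r₁ - r₂ by ring,
    show 1 - r₁ - (1 / 2 - ρ₂) = ρ₂ - r₁ + 1 / 2 by ring]
  set g := ρ₁ + ρ₂ - r₁ - r₂ with hg
  have key := newtonBI_sum_map (n := n)
    (κ := if Even n then n + 2 * ρ₁ - 2 * r₂ + 1 else 2 * r₁ + 2 * r₂ - n - 1)
    (C := biCoef n g (ρ₁ - r₁ + 1 / 2) (ρ₂ - r₁ + 1 / 2) (1 - r₁ - r₂))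
    (C' := biCoef n g (ρ₁ - r₁ + 1 / 2) (1 - r₁ - r₂) (ρ₂ - r₁ + 1 / 2))
    (ue := fun k => 2 * (k + (g - (ρ₂ - r₁ + 1 / 2) + 1)))
    (uo := fun k => -(2 * (1 - r₁ - r₂ + k)))
    (ve := fun k => -(2 * (k + 1) * (k + (1 - r₁ - r₂))))
    (vo := fun k => 2 * (ρ₁ - r₁ + 1 / 2 + k) * (1 - r₁ - r₂ + k))
    (by
      refine (raiseOp_newtonBI_zero (ρ₁ := ρ₁) (r₁ := r₁) (r₂ := r₂) hx hx').trans ?_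
      rw [hg]
      push_cast
      ring)
    (fun k => raiseOp_newtonBI_odd hx hx' k)
    (fun k => (raiseOp_newtonBI_even_succ hx hx' k).trans (by rw [hg]; push_cast; ring))
    (fun k hk => by
      obtain ⟨e, rfl | rfl⟩ := Nat.even_or_odd' n
      · rw [if_pos (even_two_mul e)]
        refine (biCoef_raise_even_even (by omega) _ _ _ _).trans ?_
        rw [hg]
        push_cast
        ring
      · rw [if_neg (by simp)]
        refine (biCoef_raise_odd_even (by omega) _ _ _ _).trans ?_
        push_cast
        ring)
    (fun k hk => by
      obtain ⟨e, rfl | rfl⟩ := Nat.even_or_odd' n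
      · rw [if_pos (even_two_mul e)]
        refine (biCoef_raise_even_odd (by omega) _ _ _ _).trans ?_
        rw [hg]
        push_cast
        ring
      · rw [if_neg (by simp)]
        refine (biCoef_raise_odd_odd (by omega) _ _ _ _).trans ?_
        push_cast
        ring)
    (by
      rw [biCoef_self n g _ (1 - r₁ - r₂) _ (ρ₁ - r₁ + 1 / 2) (ρ₂ - r₁ + 1 / 2) (1 - r₁ - r₂)]
      congr 1
      obtain ⟨e, rfl | rfl⟩ := Nat.even_or_odd' n
      · rw [if_pos (even_two_mul e), if_pos (even_two_mul e), show 2 * e / 2 = e by omega, hg]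
        push_cast
        ring
      · rw [if_neg (by simp), if_neg (by simp), show (2 * e + 1) / 2 = e by omega]
        push_cast
        ring)
  linear_combination ((-1) ^ n / poch (((n / 2 : ℕ) : ℂ) + g + 1) (n / 2 + n % 2)) * key

/-! ### Non-vanishing -/

open Polynomial in
/-- When the denominator does not vanish, `monicBI` is a polynomial of exact degree `n` in `x`: its
coefficient along `φ_n` is nonzero. -/
theorem exists_monicBI_ne_zero (n : ℕ) (ρ₁ ρ₂ r₁ r₂ : ℂ)
    (h : ∀ k ∈ Finset.Ioc (n / 2) n, ρ₁ + ρ₂ - r₁ - r₂ + (k : ℂ) ≠ 0) :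
    ∃ x, monicBI n x ρ₁ ρ₂ r₁ r₂ ≠ 0 := by
  by_contra! hcon
  set g := ρ₁ + ρ₂ - r₁ - r₂ with hg
  have hp : ∀ N ≤ n / 2 + n % 2, poch (((n / 2 : ℕ) : ℂ) + g + 1) N ≠ 0 := fun N hN =>
    poch_ne_zero fun i hi => by
      have := h (n / 2 + i + 1) (Finset.mem_Ioc.mpr ⟨by omega, by omega⟩)
      push_cast at this
      intro h0
      exact this (by linear_combination h0)
  -- the Newton basis as polynomials
  let P : ℕ → ℂ[X] := fun m =>
    (ascPochhammer ℂ ((m + 1) / 2)).comp (X + C (-r₁ + 1 / 2))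
      * (ascPochhammer ℂ (m / 2)).comp (-X + C (-r₁ + 1 / 2))
  have hPeval : ∀ m x, (P m).eval x = newtonBI r₁ m x := fun m x => by
    simp only [P, newtonBI, poch, eval_mul, eval_comp, eval_add, eval_neg, eval_X, eval_C]
    rw [show x - r₁ + 1 / 2 = x + (-r₁ + 1 / 2) by ring,
      show -x - r₁ + 1 / 2 = -x + (-r₁ + 1 / 2) by ring]
  have hdeg1 : (X + C (-r₁ + 1 / 2) : ℂ[X]).natDegree = 1 := natDegree_X_add_C _
  have hdeg2 : (-X + C (-r₁ + 1 / 2) : ℂ[X]).natDegree = 1 := by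
    rw [natDegree_add_C, natDegree_neg, natDegree_X]
  have hcomp : ∀ (N : ℕ) (q : ℂ[X]), q.natDegree = 1 → (ascPochhammer ℂ N).comp q ≠ 0 := by
    intro N q hq h0
    rcases comp_eq_zero_iff.mp h0 with h0 | ⟨-, h0⟩
    · exact (monic_ascPochhammer ℂ N).ne_zero h0
    · rw [h0, natDegree_C] at hq
      exact zero_ne_one hq
  have hne : ∀ m, P m ≠ 0 := fun m => mul_ne_zero (hcomp _ _ hdeg1) (hcomp _ _ hdeg2)
  have hPdeg : ∀ m, (P m).natDegree = m := fun m => by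
    have h1 := hne m
    rw [natDegree_mul (left_ne_zero_of_mul h1) (right_ne_zero_of_mul h1), natDegree_comp,
      natDegree_comp, hdeg1, hdeg2, ascPochhammer_natDegree, ascPochhammer_natDegree]
    omega
  have hzero : ∑ m ∈ Finset.range (n + 1),
      C (biCoef n g (ρ₁ - r₁ + 1 / 2) (ρ₂ - r₁ + 1 / 2) (1 - r₁ - r₂) m) * P m = 0 := by
    refine Polynomial.funext fun x => ?_
    have := hcon x
    rw [monicBI_eq_sum, mul_eq_zero] at this
    have h2 := this.resolve_left (div_ne_zero (by simp) (hp _ le_rfl))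
    simpa [eval_finsetSum, hPeval] using h2
  have hcoef := congrArg (fun p => p.coeff n) hzero
  simp only [finsetSum_coeff, coeff_C_mul, coeff_zero] at hcoef
  rw [Finset.sum_range_succ, Finset.sum_eq_zero, zero_add, mul_eq_zero] at hcoef
  · rcases hcoef with h0 | h0
    · unfold biCoef at h0
      simp only [Nat.sub_self, poch_zero, mul_one] at h0
      revert h0
      -- `(-e)_e` is the last symbol `(-e)_k` which does not vanish
      have hk : poch (-((n / 2 : ℕ) : ℂ)) (n / 2) ≠ 0 := poch_ne_zero fun i hi h0 => by
        have : (i : ℂ) = (n / 2 : ℕ) := by linear_combination h0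
        exact absurd (Nat.cast_injective this) hi.ne
      refine div_ne_zero (mul_ne_zero (mul_ne_zero (by simp) ?_) (hp _ ?_))
        (by exact_mod_cast Nat.factorial_ne_zero _)
      · split_ifs with he
        · rwa [show (n + 1) / 2 = n / 2 by grind]
        · exact hk
      · split_ifs <;> omega
    · have := hne n
      rw [← leadingCoeff_ne_zero, leadingCoeff, hPdeg] at this
      exact this h0
  · intro m hm
    rw [coeff_eq_zero_of_natDegree_lt (by rw [hPdeg]; exact Finset.mem_range.mp hm), mul_zero]

/-! ### The bivariate polynomials -/

theorem sum_signType {M : Type*} [AddCommMonoid M] (f : SignType → M) :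
    ∑ i, f i = f .neg + f .zero + f .pos := by
  rw [show (Finset.univ : Finset SignType) = {.neg, .zero, .pos} by decide,
    Finset.sum_insert (by decide), Finset.sum_insert (by decide), Finset.sum_singleton, add_assoc]

theorem bivariateBI_ne_zero {n₁ n₂ : ℕ} {α β γ δ ε : ℂ}
    (h₁ : ∀ k ∈ Finset.Ioc (n₁ / 2) n₁, β - α + 2 * ε - 1 / 2 + (k : ℂ) ≠ 0)
    (h₂ : ∀ k ∈ Finset.Ioc (n₂ / 2) n₂, β - α + γ + δ + 2 * ε + (n₁ : ℂ) + (k : ℂ) ≠ 0) :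
    bivariateBI n₁ n₂ α β γ δ ε ≠ 0 := by
  obtain ⟨y, hy⟩ := exists_monicBI_ne_zero n₂ (β + ε + n₁ / 2)
    ((1 - evenInd n₁) * γ + evenInd n₁ * δ) (α - ε - n₁ / 2)
    ((evenInd n₁ - 1) * δ - evenInd n₁ * γ) fun k hk => by
      refine ne_of_eq_of_ne ?_ (h₂ k hk)
      ring
  set z₂ : ℂ := (-1) ^ n₁ * (y + 1 / 4) with hz₂
  have hsq : ((-1 : ℂ) ^ n₁) * (-1) ^ n₁ = 1 := by rw [← mul_pow]; simp
  have hz : (-1) ^ n₁ * z₂ - 1 / 4 = y := by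
    rw [hz₂]
    linear_combination (y + 1 / 4) * hsq
  obtain ⟨x, hx⟩ := exists_monicBI_ne_zero n₁ β (z₂ + ε - 1 / 4) α (z₂ - ε + 1 / 4) fun k hk => by
      refine ne_of_eq_of_ne ?_ (h₁ k hk)
      ring
  intro h0
  have h := congrFun (congrFun h0 (x + 1 / 4)) z₂
  unfold bivariateBI at h
  rw [hz, add_sub_cancel_right] at h
  exact mul_ne_zero hx hy h

theorem opL1_bivariateBI (n₁ n₂ : ℕ) (α β γ δ ε : ℂ) {z₁ : ℂ} (z₂ : ℂ) (hz : z₁ ≠ 1 / 4)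
    (hz' : z₁ ≠ -1 / 4) :
    opL1 α β ε (bivariateBI n₁ n₂ α β γ δ ε) z₁ z₂
      = eigL1 n₁ α β ε * bivariateBI n₁ n₂ α β γ δ ε z₁ z₂ := by
  obtain ⟨x, rfl⟩ : ∃ x, z₁ = x + 1 / 4 := ⟨z₁ - 1 / 4, by ring⟩
  have hx : x ≠ 0 := fun h => hz (by rw [h]; ring)
  have hx' : 2 * x + 1 ≠ 0 := fun h => hz' (by linear_combination h / 2)
  have h := monicBI_eigen n₁ β (z₂ + ε - 1 / 4) α (z₂ - ε + 1 / 4) hx hx'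
  have he : eigBI n₁ (β + (z₂ + ε - 1 / 4) - α - (z₂ - ε + 1 / 4)) = eigL1 n₁ α β ε := by
    unfold eigBI eigL1
    split_ifs
    · rfl
    · ring
  rw [he] at h
  simp only [opL1, shift₁, refl₁, bivariateBI]
  rw [show -(x + 1 / 4 + -1 / 2) - 1 / 4 = -x by ring,
    show -(x + 1 / 4 + 1 / 2) - 1 / 4 = -x - 1 by ring, add_sub_cancel_right,
    show 2 * (x + 1 / 4 + 1 / 4) = 2 * x + 1 by ring]
  linear_combination monicBI n₂ ((-1) ^ n₁ * z₂ - 1 / 4)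
    (β + ε + n₁ / 2) ((1 - evenInd n₁) * γ + evenInd n₁ * δ)
    (α - ε - n₁ / 2) ((evenInd n₁ - 1) * δ - evenInd n₁ * γ) * h

/-- The part of `L₂` with a fixed reflection in `z₂` multiplies the first factor of `bivariateBI`
by a function of `z₂` alone; here for `z₂ ↦ -z₂ - 1/2`. -/
theorem coefL2_column_neg (n : ℕ) (α β γ δ ε : ℂ) {x z₂ : ℂ} (hx : x ≠ 0) (hx' : x + 1 / 2 ≠ 0)
    (hz : z₂ + 1 / 4 ≠ 0) :
    coefL2 α β γ δ ε .neg .neg (x + 1 / 4) z₂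
          * monicBI n (-x - 1) β (-z₂ + ε - 3 / 4) α (-z₂ - ε - 1 / 4)
        + coefL2 α β γ δ ε .zero .neg (x + 1 / 4) z₂
          * monicBI n x β (-z₂ + ε - 3 / 4) α (-z₂ - ε - 1 / 4)
        + coefL2 α β γ δ ε .pos .neg (x + 1 / 4) z₂
          * monicBI n (-x) β (-z₂ + ε - 3 / 4) α (-z₂ - ε - 1 / 4)
      = (z₂ + γ + 1 / 4) / (4 * (z₂ + 1 / 4))
        * (if Even n then n + 2 * z₂ + 2 * ε - 2 * α + 1 / 2
            else -(2 * β + 2 * z₂ + 2 * ε + 1 / 2 + n))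
        * monicBI n x β (z₂ + ε - 1 / 4) α (z₂ - ε + 1 / 4) := by
  have h := monicBI_lower n β (z₂ + ε - 1 / 4) α (z₂ - ε + 1 / 4) hx hx'
  rw [show -(z₂ - ε + 1 / 4) - 1 / 2 = -z₂ + ε - 3 / 4 by ring,
    show -(z₂ + ε - 1 / 4) - 1 / 2 = -z₂ - ε - 1 / 4 by ring,
    show (n : ℂ) + 2 * (z₂ + ε - 1 / 4) - 2 * α + 1 = n + 2 * z₂ + 2 * ε - 2 * α + 1 / 2 by ring,
    show -(2 * β + 2 * (z₂ + ε - 1 / 4) + 1 + n)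
        = -(2 * β + 2 * z₂ + 2 * ε + 1 / 2 + n) by ring] at h
  rw [mul_assoc, ← h]
  simp only [coefL2]
  rw [add_sub_cancel_right, show x + 1 / 4 + 1 / 4 = x + 1 / 2 by ring]
  generalize hy : x + 1 / 2 = y at *
  generalize hw : z₂ + 1 / 4 = w at *
  field_simp
  rw [← hy]
  ring

/-- The analogue of `coefL2_column_neg` for `z₂ ↦ -z₂ + 1/2`. -/
theorem coefL2_column_pos (n : ℕ) (α β γ δ ε : ℂ) {x z₂ : ℂ} (hx : x ≠ 0) (hx' : x + 1 / 2 ≠ 0)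
    (hz : z₂ - 1 / 4 ≠ 0) :
    coefL2 α β γ δ ε .neg .pos (x + 1 / 4) z₂
          * monicBI n (-x - 1) β (-z₂ + ε + 1 / 4) α (-z₂ - ε + 3 / 4)
        + coefL2 α β γ δ ε .zero .pos (x + 1 / 4) z₂
          * monicBI n x β (-z₂ + ε + 1 / 4) α (-z₂ - ε + 3 / 4)
        + coefL2 α β γ δ ε .pos .pos (x + 1 / 4) z₂
          * monicBI n (-x) β (-z₂ + ε + 1 / 4) α (-z₂ - ε + 3 / 4)
      = (z₂ - δ - 1 / 4) / (4 * (z₂ - 1 / 4))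
        * (if Even n then n + 2 * β - 2 * z₂ + 2 * ε + 1 / 2
            else 2 * α + 2 * z₂ - 2 * ε - n - 1 / 2)
        * monicBI n x β (z₂ + ε - 1 / 4) α (z₂ - ε + 1 / 4) := by
  have h := monicBI_raise n β (z₂ + ε - 1 / 4) α (z₂ - ε + 1 / 4) hx hx'
  rw [show 1 / 2 - (z₂ - ε + 1 / 4) = -z₂ + ε + 1 / 4 by ring,
    show 1 / 2 - (z₂ + ε - 1 / 4) = -z₂ - ε + 3 / 4 by ring,
    show (n : ℂ) + 2 * β - 2 * (z₂ - ε + 1 / 4) + 1 = n + 2 * β - 2 * z₂ + 2 * ε + 1 / 2 by ring,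
    show 2 * α + 2 * (z₂ - ε + 1 / 4) - n - 1 = 2 * α + 2 * z₂ - 2 * ε - n - 1 / 2 by ring] at h
  rw [mul_assoc, ← h]
  simp only [coefL2]
  rw [add_sub_cancel_right, show x + 1 / 4 + 1 / 4 = x + 1 / 2 by ring]
  generalize hy : x + 1 / 2 = y at *
  generalize hw : z₂ - 1 / 4 = w at *
  field_simp
  rw [← hy]
  ring

/-- The part of `L₂` without reflection in `z₂` is a combination of `L₁` and the identity with
coefficients depending on `z₂` only. -/
theorem coefL2_column_zero (n : ℕ) (α β γ δ ε : ℂ) {x z₂ : ℂ} (hx : x ≠ 0) (hx' : x + 1 / 2 ≠ 0)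
    (hz : z₂ - 1 / 4 ≠ 0) (hz' : z₂ + 1 / 4 ≠ 0) :
    coefL2 α β γ δ ε .neg .zero (x + 1 / 4) z₂
          * monicBI n (-x - 1) β (z₂ + ε - 1 / 4) α (z₂ - ε + 1 / 4)
        + coefL2 α β γ δ ε .zero .zero (x + 1 / 4) z₂
          * monicBI n x β (z₂ + ε - 1 / 4) α (z₂ - ε + 1 / 4)
        + coefL2 α β γ δ ε .pos .zero (x + 1 / 4) z₂
          * monicBI n (-x) β (z₂ + ε - 1 / 4) α (z₂ - ε + 1 / 4)
      = (α * (γ - δ + 1 / 2) + β * (γ - δ - 1 / 2) - 1 / 2 * (γ + δ + 1 / 2) - ε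
          + (δ * (z₂ + 1 / 4) - γ * (z₂ - 1 / 4)) / (4 * (z₂ - 1 / 4) * (z₂ + 1 / 4))
            * (2 * eigL1 n α β ε + 4 * z₂ * (α + β) + 2 * ε + β - α))
        * monicBI n x β (z₂ + ε - 1 / 4) α (z₂ - ε + 1 / 4) := by
  have h := monicBI_eigen n β (z₂ + ε - 1 / 4) α (z₂ - ε + 1 / 4) hx
    (show 2 * x + 1 ≠ 0 from fun h => hx' (by linear_combination h / 2))
  have he : eigBI n (β + (z₂ + ε - 1 / 4) - α - (z₂ - ε + 1 / 4)) = eigL1 n α β ε := by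
    unfold eigBI eigL1
    split_ifs
    · rfl
    · ring
  rw [he, show 2 * x + 1 = 2 * (x + 1 / 2) by ring] at h
  have h' : ∀ A B M E : ℂ, (A + B * (2 * E + 4 * z₂ * (α + β) + 2 * ε + β - α)) * M
    = (A + B * (4 * z₂ * (α + β) + 2 * ε + β - α)) * M + 2 * B * (E * M) := by
    intros
    ring
  rw [h', ← h]
  simp only [coefL2]
  rw [add_sub_cancel_right, show x + 1 / 4 + 1 / 4 = x + 1 / 2 by ring]
  generalize hy : x + 1 / 2 = y at *
  generalize hw : z₂ - 1 / 4 = w at *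
  generalize hw' : z₂ + 1 / 4 = w' at *
  generalize δ * w' - γ * w = Y
  field_simp
  rw [← hy]
  ring

/-- After `L₂` has passed the first factor, what remains acts on the second factor as
`± L + const`, where `L` is the univariate operator of `monicBI_eigen` in the variable
`(-1)^{n₁} z₂ - 1/4`, with the sign `(-1)^{n₁}`. -/
theorem opL2_bivariateBI (n₁ n₂ : ℕ) (α β γ δ ε : ℂ) {z₁ z₂ : ℂ} (hz₁ : z₁ ≠ 1 / 4)
    (hz₁' : z₁ ≠ -1 / 4) (hz₂ : z₂ ≠ 1 / 4) (hz₂' : z₂ ≠ -1 / 4) :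
    opL2 α β γ δ ε (bivariateBI n₁ n₂ α β γ δ ε) z₁ z₂
      = eigL2 n₁ n₂ α β γ δ ε * bivariateBI n₁ n₂ α β γ δ ε z₁ z₂ := by
  obtain ⟨x, rfl⟩ : ∃ x, z₁ = x + 1 / 4 := ⟨z₁ - 1 / 4, by ring⟩
  have hx : x ≠ 0 := fun h => hz₁ (by rw [h]; ring)
  have hx' : x + 1 / 2 ≠ 0 := fun h => hz₁' (by linear_combination h)
  have hw : z₂ - 1 / 4 ≠ 0 := sub_ne_zero.mpr hz₂
  have hw' : z₂ + 1 / 4 ≠ 0 := fun h => hz₂' (by linear_combination h)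
  have hneg := coefL2_column_neg n₁ α β γ δ ε hx hx' hw'
  have hzero := coefL2_column_zero n₁ α β γ δ ε hx hx' hw hw'
  have hpos := coefL2_column_pos n₁ α β γ δ ε hx hx' hw
  simp only [opL2, sum_signType, shiftRefl₁, shiftRefl₂, shift₁, shift₂, refl₁, refl₂, bivariateBI]
  rw [show -(x + 1 / 4 + -1 / 2) - 1 / 4 = -x by ring,
    show -(x + 1 / 4 + 1 / 2) - 1 / 4 = -x - 1 by ring, add_sub_cancel_right,
    show -(z₂ + 1 / 2) + ε - 1 / 4 = -z₂ + ε - 3 / 4 by ring,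
    show -(z₂ + 1 / 2) - ε + 1 / 4 = -z₂ - ε - 1 / 4 by ring,
    show -(z₂ + -1 / 2) + ε - 1 / 4 = -z₂ + ε + 1 / 4 by ring,
    show -(z₂ + -1 / 2) - ε + 1 / 4 = -z₂ - ε + 3 / 4 by ring]
  rcases Nat.even_or_odd n₁ with hn | hn
  · simp only [eigL1, if_pos hn, hn.neg_one_pow, evenInd, one_mul] at hneg hzero hpos ⊢
    simp only [sub_self, zero_mul, zero_add, zero_sub]
    have h := monicBI_eigen n₂ (β + ε + n₁ / 2) δ (α - ε - n₁ / 2) (-γ) hw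
      (show 2 * (z₂ - 1 / 4) + 1 ≠ 0 from fun h => hw' (by linear_combination h / 2))
    have he : eigL2 n₁ n₂ α β γ δ ε
        = n₁ / 2 + eigBI n₂ (β + ε + n₁ / 2 + δ - (α - ε - n₁ / 2) - -γ) := by
      unfold eigL2 eigBI
      simp only [Nat.even_add, hn, true_iff]
      split_ifs <;> ring
    rw [show 2 * (z₂ - 1 / 4) + 1 = 2 * (z₂ + 1 / 4) by ring] at h
    rw [he, show -(z₂ + 1 / 2) - 1 / 4 = -(z₂ - 1 / 4) - 1 by ring,
      show -(z₂ + -1 / 2) - 1 / 4 = -(z₂ - 1 / 4) by ring]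
    generalize monicBI n₂ (-(z₂ - 1 / 4) - 1) _ _ _ _ = Qm at *
    generalize monicBI n₂ (-(z₂ - 1 / 4)) _ _ _ _ = Qp at *
    generalize monicBI n₂ (z₂ - 1 / 4) _ _ _ _ = Q0 at *
    generalize monicBI n₁ x β (z₂ + ε - 1 / 4) α (z₂ - ε + 1 / 4) = M at *
    -- the three multipliers of the columns are the coefficients of the univariate operator in
    -- `z₂ - 1/4`, up to the constant `n₁ / 2`
    have hA : (z₂ + γ + 1 / 4) / (4 * (z₂ + 1 / 4)) * (n₁ + 2 * z₂ + 2 * ε - 2 * α + 1 / 2)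
        = (z₂ - 1 / 4 - -γ + 1 / 2) * (z₂ - 1 / 4 - (α - ε - n₁ / 2) + 1 / 2)
          / (2 * (z₂ + 1 / 4)) := by
      generalize hv' : z₂ + 1 / 4 = w' at *
      field_simp
      ring
    have hC : (z₂ - δ - 1 / 4) / (4 * (z₂ - 1 / 4)) * (n₁ + 2 * β - 2 * z₂ + 2 * ε + 1 / 2)
        = (δ - (z₂ - 1 / 4)) * (z₂ - 1 / 4 - (β + ε + n₁ / 2)) / (2 * (z₂ - 1 / 4)) := by
      generalize hv : z₂ - 1 / 4 = w at *
      field_simp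
      rw [← hv]
      ring
    have hB : α * (γ - δ + 1 / 2) + β * (γ - δ - 1 / 2) - 1 / 2 * (γ + δ + 1 / 2) - ε
          + (δ * (z₂ + 1 / 4) - γ * (z₂ - 1 / 4)) / (4 * (z₂ - 1 / 4) * (z₂ + 1 / 4))
            * (2 * (n₁ / 2) + 4 * z₂ * (α + β) + 2 * ε + β - α)
        = n₁ / 2 - (δ - (z₂ - 1 / 4)) * (z₂ - 1 / 4 - (β + ε + n₁ / 2)) / (2 * (z₂ - 1 / 4))
          - (z₂ - 1 / 4 - -γ + 1 / 2) * (z₂ - 1 / 4 - (α - ε - n₁ / 2) + 1 / 2)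
            / (2 * (z₂ + 1 / 4)) := by
      generalize hv : z₂ - 1 / 4 = w at *
      generalize hv' : z₂ + 1 / 4 = w' at *
      field_simp
      rw [← hv', ← hv]
      ring
    linear_combination Qm * hneg + Q0 * hzero + Qp * hpos + M * h + M * Qm * hA + M * Q0 * hB
      + M * Qp * hC
  · have hn' : ¬ Even n₁ := Nat.not_even_iff_odd.mpr hn
    simp only [eigL1, if_neg hn', hn.neg_one_pow, evenInd] at hneg hzero hpos ⊢
    simp only [sub_zero, one_mul, zero_mul, add_zero, zero_sub, neg_one_mul]
    have h := monicBI_eigen n₂ (β + ε + n₁ / 2) γ (α - ε - n₁ / 2) (-δ)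
      (show -z₂ - 1 / 4 ≠ 0 from fun h => hw' (by linear_combination -h))
      (show 2 * (-z₂ - 1 / 4) + 1 ≠ 0 from fun h => hw (by linear_combination -h / 2))
    have he : eigL2 n₁ n₂ α β γ δ ε
        = -((n₁ + 1) / 2 - α + β + γ + δ + 2 * ε)
          - eigBI n₂ (β + ε + n₁ / 2 + γ - (α - ε - n₁ / 2) - -δ) := by
      unfold eigL2 eigBI
      simp only [Nat.even_add, hn', false_iff]
      split_ifs <;> first | contradiction | ring
    rw [show 2 * (-z₂ - 1 / 4) + 1 = -(2 * (z₂ - 1 / 4)) by ring,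
      show 2 * (-z₂ - 1 / 4) = -(2 * (z₂ + 1 / 4)) by ring] at h
    rw [he, show - -(z₂ + 1 / 2) - 1 / 4 = -(-z₂ - 1 / 4) by ring,
      show - -(z₂ + -1 / 2) - 1 / 4 = -(-z₂ - 1 / 4) - 1 by ring]
    generalize monicBI n₂ (-(-z₂ - 1 / 4) - 1) _ _ _ _ = Qp at *
    generalize monicBI n₂ (-(-z₂ - 1 / 4)) _ _ _ _ = Qm at *
    generalize monicBI n₂ (-z₂ - 1 / 4) _ _ _ _ = Q0 at *
    generalize monicBI n₁ x β (z₂ + ε - 1 / 4) α (z₂ - ε + 1 / 4) = M at *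
    -- in the variable `-z₂ - 1/4` the two reflections of `z₂` are exchanged and the univariate
    -- operator occurs with the sign `-1`
    have hA : (z₂ + γ + 1 / 4) / (4 * (z₂ + 1 / 4)) * -(2 * β + 2 * z₂ + 2 * ε + 1 / 2 + n₁)
        = -((γ - (-z₂ - 1 / 4)) * (-z₂ - 1 / 4 - (β + ε + n₁ / 2)) / -(2 * (z₂ + 1 / 4))) := by
      generalize hv' : z₂ + 1 / 4 = w' at *
      field_simp
      ring
    have hC : (z₂ - δ - 1 / 4) / (4 * (z₂ - 1 / 4)) * (2 * α + 2 * z₂ - 2 * ε - n₁ - 1 / 2)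
        = -((-z₂ - 1 / 4 - -δ + 1 / 2) * (-z₂ - 1 / 4 - (α - ε - n₁ / 2) + 1 / 2)
          / -(2 * (z₂ - 1 / 4))) := by
      generalize hv : z₂ - 1 / 4 = w at *
      field_simp
      ring
    have hB : α * (γ - δ + 1 / 2) + β * (γ - δ - 1 / 2) - 1 / 2 * (γ + δ + 1 / 2) - ε
          + (δ * (z₂ + 1 / 4) - γ * (z₂ - 1 / 4)) / (4 * (z₂ - 1 / 4) * (z₂ + 1 / 4))
            * (2 * (-(n₁ / 2) + α - β - 2 * ε) + 4 * z₂ * (α + β) + 2 * ε + β - α)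
        = -((n₁ + 1) / 2 - α + β + γ + δ + 2 * ε)
          + (γ - (-z₂ - 1 / 4)) * (-z₂ - 1 / 4 - (β + ε + n₁ / 2)) / -(2 * (z₂ + 1 / 4))
          + (-z₂ - 1 / 4 - -δ + 1 / 2) * (-z₂ - 1 / 4 - (α - ε - n₁ / 2) + 1 / 2)
            / -(2 * (z₂ - 1 / 4)) := by
      generalize hv : z₂ - 1 / 4 = w at *
      generalize hv' : z₂ + 1 / 4 = w' at *
      field_simp
      rw [← hv', ← hv]
      ring
    linear_combination Qm * hneg + Q0 * hzero + Qp * hpos - M * h + M * Qm * hA + M * Q0 * hB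
      + M * Qp * hC

/-! ### Limits of the factors of the Askey-Wilson coefficients -/

theorem tendsto_div_of_hasDerivAt {f : ℂ → ℂ} {f' : ℂ} (h : HasDerivAt f f' 0) (h0 : f 0 = 0) :
    Tendsto (fun t => f t / t) (𝓝[≠] 0) (𝓝 f') := by
  have := hasDerivAt_iff_tendsto_slope_zero.mp h
  refine this.congr fun t => ?_
  rw [zero_add, h0, sub_zero, smul_eq_mul, inv_mul_eq_div]

theorem tendsto_of_hasDerivAt {f : ℂ → ℂ} {f' : ℂ} (h : HasDerivAt f f' 0) :
    Tendsto f (𝓝[≠] 0) (𝓝 (f 0)) :=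
  h.continuousAt.tendsto.mono_left nhdsWithin_le_nhds

theorem hasDerivAt_const_mul_exp (k x : ℂ) :
    HasDerivAt (fun t : ℂ => k * Complex.exp (t * x)) (k * x) 0 := by
  have h := (((hasDerivAt_id (0 : ℂ)).mul_const x).cexp).const_mul k
  simpa using h

section factors

open Complex (I)

variable {A B Z W q e : ℂ → ℂ} {a b z w ε' : ℂ}

theorem tendsto_sub_mul_sub_div (hA : HasDerivAt A (I * a) 0) (hA0 : A 0 = I)
    (hB : HasDerivAt B (-I * b) 0) (hB0 : B 0 = -I) (hZ : HasDerivAt Z (I * z) 0) (hZ0 : Z 0 = I) :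
    Tendsto (fun t => (Z t - A t) * (Z t - B t) / t) (𝓝[≠] 0) (𝓝 (2 * (a - z))) := by
  refine tendsto_div_of_hasDerivAt (((hZ.sub hA).mul (hZ.sub hB)).congr_deriv ?_)
      (by simp [hA0, hZ0])
  simp only [Pi.sub_apply, hA0, hB0, hZ0]
  linear_combination 2 * (z - a) * Complex.I_sq

theorem tendsto_mul_sub_one_div (hA : HasDerivAt A (I * a) 0) (hA0 : A 0 = I)
    (hB : HasDerivAt B (-I * b) 0) (hB0 : B 0 = -I) (hZ : HasDerivAt Z (I * z) 0) (hZ0 : Z 0 = I) :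
    Tendsto (fun t => (A t * Z t - 1) * (B t * Z t - 1) / t) (𝓝[≠] 0) (𝓝 (-2 * (b + z))) := by
  refine tendsto_div_of_hasDerivAt ((((hA.mul hZ).sub_const 1).mul
    ((hB.mul hZ).sub_const 1)).congr_deriv ?_) (by simp [hA0, hZ0, hB0])
  simp only [Pi.mul_apply, hA0, hB0, hZ0]
  linear_combination (2 * b + 2 * z - I ^ 2 * (a + 2 * z + b)) * Complex.I_sq

theorem tendsto_sq_sub_one (hZ : HasDerivAt Z (I * z) 0) (hZ0 : Z 0 = I) :
    Tendsto (fun t => Z t ^ 2 - 1) (𝓝[≠] 0) (𝓝 (-2)) := by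
  have h := tendsto_of_hasDerivAt ((hZ.pow 2).sub_const 1)
  norm_num [hZ0] at h
  exact h

theorem tendsto_sq_sub_div (hq : HasDerivAt q (-1) 0) (hq0 : q 0 = -1)
    (hZ : HasDerivAt Z (I * z) 0) (hZ0 : Z 0 = I) :
    Tendsto (fun t => (Z t ^ 2 - q t) / t) (𝓝[≠] 0) (𝓝 (1 - 2 * z)) := by
  refine tendsto_div_of_hasDerivAt (((hZ.pow 2).sub hq).congr_deriv ?_) (by simp [hq0, hZ0])
  simp only [hZ0]
  linear_combination 2 * z * Complex.I_sq

theorem tendsto_mul_sq_sub_one_div (hq : HasDerivAt q (-1) 0) (hq0 : q 0 = -1)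
    (hZ : HasDerivAt Z (I * z) 0) (hZ0 : Z 0 = I) :
    Tendsto (fun t => (q t * Z t ^ 2 - 1) / t) (𝓝[≠] 0) (𝓝 (1 + 2 * z)) := by
  refine tendsto_div_of_hasDerivAt (((hq.mul (hZ.pow 2)).sub_const 1).congr_deriv ?_)
    (by simp [hq0, hZ0])
  simp only [Pi.pow_apply, hZ0, hq0]
  linear_combination (-1 - 2 * z) * Complex.I_sq

/-- Both summands of `awFactor` are of order `t`: `1 + ab/q` is, and `(z² + 1)(a + b)` is of order
`t²` but is divided by `q + 1`, of order `t`. -/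
theorem tendsto_awFactor_div (hA : HasDerivAt A (I * a) 0) (hA0 : A 0 = I)
    (hB : HasDerivAt B (-I * b) 0) (hB0 : B 0 = -I) (hZ : HasDerivAt Z (I * z) 0) (hZ0 : Z 0 = I)
    (hq : HasDerivAt q (-1) 0) (hq0 : q 0 = -1) :
    Tendsto (fun t => awFactor (q t) (A t) (B t) (Z t) / t) (𝓝[≠] 0)
      (𝓝 (1 - a - b - 2 * z * (a - b))) := by
  have h1 : Tendsto (fun t => (1 + A t * B t / q t) / t) (𝓝[≠] 0) (𝓝 (1 - a - b)) := by
    refine tendsto_div_of_hasDerivAt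
        ((((hA.mul hB).div hq (by simp [hq0])).const_add 1).congr_deriv ?_)
      (by simp [hA0, hB0, hq0])
    simp only [Pi.mul_apply, hA0, hB0, hq0]
    linear_combination (a + b - 1) * Complex.I_sq
  have h2 : Tendsto (fun t => (Z t ^ 2 + 1) / t) (𝓝[≠] 0) (𝓝 (-2 * z)) := by
    refine tendsto_div_of_hasDerivAt (((hZ.pow 2).add_const 1).congr_deriv ?_) (by simp [hZ0])
    simp only [hZ0]
    linear_combination 2 * z * Complex.I_sq
  have h3 : Tendsto (fun t => (A t + B t) / t) (𝓝[≠] 0) (𝓝 (I * (a - b))) :=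
    tendsto_div_of_hasDerivAt ((hA.add hB).congr_deriv (by ring)) (by simp [hA0, hB0])
  have h4 : Tendsto (fun t => (q t + 1) / t) (𝓝[≠] 0) (𝓝 (-1)) :=
    tendsto_div_of_hasDerivAt (hq.add_const 1) (by simp [hq0])
  have h5 : Tendsto Z (𝓝[≠] 0) (𝓝 I) := hZ0 ▸ tendsto_of_hasDerivAt hZ
  have h := h1.sub ((h2.mul h3).div (h5.mul h4) (by simp))
  have hlim : 1 - a - b - -2 * z * (I * (a - b)) / (I * -1) = 1 - a - b - 2 * z * (a - b) := by
    have := Complex.I_ne_zero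
    field_simp
  rw [hlim] at h
  refine h.congr' ?_
  filter_upwards [self_mem_nhdsWithin] with t ht
  have ht : t ≠ 0 := ht
  simp only [awFactor, Pi.div_apply]
  field_simp

theorem tendsto_mul_sub (hZ : HasDerivAt Z (I * z) 0) (hZ0 : Z 0 = I)
    (hW : HasDerivAt W (I * w) 0) (hW0 : W 0 = I) (he : HasDerivAt e ε' 0) (he0 : e 0 = 1) :
    Tendsto (fun t => Z t * W t - e t) (𝓝[≠] 0) (𝓝 (-2)) := by
  have h := tendsto_of_hasDerivAt ((hZ.mul hW).sub he)
  norm_num [hZ0, hW0, he0] at h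
  exact h

theorem tendsto_mul_mul_sub_one (hZ : HasDerivAt Z (I * z) 0) (hZ0 : Z 0 = I)
    (hW : HasDerivAt W (I * w) 0) (hW0 : W 0 = I) (he : HasDerivAt e ε' 0) (he0 : e 0 = 1) :
    Tendsto (fun t => e t * Z t * W t - 1) (𝓝[≠] 0) (𝓝 (-2)) := by
  have h := tendsto_of_hasDerivAt (((he.mul hZ).mul hW).sub_const 1)
  norm_num [hZ0, hW0, he0] at h
  exact h

theorem tendsto_mul_sub_mul_div (hZ : HasDerivAt Z (I * z) 0) (hZ0 : Z 0 = I)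
    (hW : HasDerivAt W (I * w) 0) (hW0 : W 0 = I) (he : HasDerivAt e ε' 0) (he0 : e 0 = 1)
    (hq : HasDerivAt q (-1) 0) (hq0 : q 0 = -1) :
    Tendsto (fun t => (Z t * W t - e t * q t) / t) (𝓝[≠] 0) (𝓝 (ε' + 1 - z - w)) := by
  refine tendsto_div_of_hasDerivAt (((hZ.mul hW).sub (he.mul hq)).congr_deriv ?_)
    (by simp [hq0, hZ0, hW0, he0])
  simp only [hZ0, hW0, hq0, he0]
  linear_combination (z + w) * Complex.I_sq

theorem tendsto_mul_mul_mul_sub_one_div (hZ : HasDerivAt Z (I * z) 0) (hZ0 : Z 0 = I)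
    (hW : HasDerivAt W (I * w) 0) (hW0 : W 0 = I) (he : HasDerivAt e ε' 0) (he0 : e 0 = 1)
    (hq : HasDerivAt q (-1) 0) (hq0 : q 0 = -1) :
    Tendsto (fun t => (e t * q t * Z t * W t - 1) / t) (𝓝[≠] 0) (𝓝 (ε' + 1 + z + w)) := by
  refine tendsto_div_of_hasDerivAt (((((he.mul hq).mul hZ).mul hW).sub_const 1).congr_deriv ?_)
    (by simp [hq0, hZ0, hW0, he0])
  simp only [Pi.mul_apply, hZ0, hW0, hq0, he0]
  linear_combination -(ε' + 1 + z + w) * Complex.I_sq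

theorem tendsto_mul_sub_mul_self_div (hZ : HasDerivAt Z (I * z) 0) (hZ0 : Z 0 = I)
    (hW : HasDerivAt W (I * w) 0) (hW0 : W 0 = I) (he : HasDerivAt e ε' 0) (he0 : e 0 = 1)
    {V : ℂ → ℂ} {v : ℂ} (hV : HasDerivAt V (I * v) 0) (hV0 : V 0 = I) :
    Tendsto (fun t => V t * (Z t - e t * W t) / t) (𝓝[≠] 0) (𝓝 (ε' + w - z)) := by
  refine tendsto_div_of_hasDerivAt ((hV.mul (hZ.sub (he.mul hW))).congr_deriv ?_)
    (by simp [hZ0, hW0, he0])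
  simp only [Pi.sub_apply, Pi.mul_apply, hZ0, hW0, he0, hV0]
  linear_combination (z - ε' - w) * Complex.I_sq

theorem tendsto_sub_mul_sub_mul_div (hZ : HasDerivAt Z (I * z) 0) (hZ0 : Z 0 = I)
    (hW : HasDerivAt W (I * w) 0) (hW0 : W 0 = I) (he : HasDerivAt e ε' 0) (he0 : e 0 = 1)
    (hq : HasDerivAt q (-1) 0) (hq0 : q 0 = -1) :
    Tendsto (fun t => (Z t - e t * W t) * (Z t - e t * q t * W t) / t) (𝓝[≠] 0)
      (𝓝 (2 * (ε' + w - z))) := by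
  refine tendsto_div_of_hasDerivAt (((hZ.sub (he.mul hW)).mul
    (hZ.sub ((he.mul hq).mul hW))).congr_deriv ?_) (by simp [hZ0, hW0, he0])
  simp only [Pi.sub_apply, Pi.mul_apply, hZ0, hW0, he0, hq0]
  linear_combination 2 * (z - ε' - w) * Complex.I_sq

theorem tendsto_mul_sub_mul_mul_sub_div (hZ : HasDerivAt Z (I * z) 0) (hZ0 : Z 0 = I)
    (hW : HasDerivAt W (I * w) 0) (hW0 : W 0 = I) (he : HasDerivAt e ε' 0) (he0 : e 0 = 1)
    (hq : HasDerivAt q (-1) 0) (hq0 : q 0 = -1) :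
    Tendsto (fun t => (e t * Z t - W t) * (e t * q t * Z t - W t) / t) (𝓝[≠] 0)
      (𝓝 (2 * (ε' + z - w))) := by
  refine tendsto_div_of_hasDerivAt ((((he.mul hZ).sub hW).mul
    (((he.mul hq).mul hZ).sub hW)).congr_deriv ?_) (by simp [hZ0, hW0, he0])
  simp only [Pi.sub_apply, Pi.mul_apply, hZ0, hW0, he0, hq0]
  linear_combination -2 * (ε' + z - w) * Complex.I_sq

theorem tendsto_add_one_div (hq : HasDerivAt q (-1) 0) (hq0 : q 0 = -1) :
    Tendsto (fun t => (q t + 1) / t) (𝓝[≠] 0) (𝓝 (-1)) :=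
  tendsto_div_of_hasDerivAt (hq.add_const 1) (by simp [hq0])

end factors

theorem hasDerivAt_qT : HasDerivAt qT (-1) 0 := by
  have h := hasDerivAt_const_mul_exp (-1) 1
  simpa [qT, funext_iff] using h.congr_of_eventuallyEq (f₁ := qT) (.of_forall fun t => by simp [qT])

theorem hasDerivAt_zT (x : ℂ) : HasDerivAt (zT x) (Complex.I * (-2 * x)) 0 :=
  hasDerivAt_const_mul_exp _ _

theorem hasDerivAt_aT (α : ℂ) : HasDerivAt (aT α) (Complex.I * (-2 * α + 1 / 2)) 0 :=
  hasDerivAt_const_mul_exp _ _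

theorem hasDerivAt_bT (β : ℂ) : HasDerivAt (bT β) (-Complex.I * (2 * β + 1 / 2)) 0 :=
  hasDerivAt_const_mul_exp _ _

theorem hasDerivAt_cT (γ : ℂ) : HasDerivAt (cT γ) (Complex.I * (2 * γ + 1 / 2)) 0 :=
  hasDerivAt_const_mul_exp _ _

theorem hasDerivAt_dT (δ : ℂ) : HasDerivAt (dT δ) (-Complex.I * (2 * δ + 1 / 2)) 0 :=
  hasDerivAt_const_mul_exp _ _

theorem hasDerivAt_a₂T (ε : ℂ) : HasDerivAt (a₂T ε) (2 * ε) 0 := by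
  simpa using (hasDerivAt_const_mul_exp 1 (2 * ε)).congr_of_eventuallyEq (f₁ := a₂T ε)
    (.of_forall fun t => by simp [a₂T])

theorem qT_zero : qT 0 = -1 := by simp [qT]
theorem zT_zero (x : ℂ) : zT x 0 = Complex.I := by simp [zT]
theorem aT_zero (α : ℂ) : aT α 0 = Complex.I := by simp [aT]
theorem bT_zero (β : ℂ) : bT β 0 = -Complex.I := by simp [bT]
theorem cT_zero (γ : ℂ) : cT γ 0 = Complex.I := by simp [cT]
theorem dT_zero (δ : ℂ) : dT δ 0 = -Complex.I := by simp [dT]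
theorem a₂T_zero (ε : ℂ) : a₂T ε 0 = 1 := by simp [a₂T]

open Complex (I) in
theorem tendsto_one_add_sq_div_sub_div {Z W q e : ℂ → ℂ} {z w ε' : ℂ}
    (hZ : HasDerivAt Z (I * z) 0) (hZ0 : Z 0 = I)
    (hW : HasDerivAt W (I * w) 0) (hW0 : W 0 = I) (he : HasDerivAt e ε' 0) (he0 : e 0 = 1)
    (hq : HasDerivAt q (-1) 0) (hq0 : q 0 = -1) :
    Tendsto (fun t => (1 + e t ^ 2 / q t
        - e t * (Z t ^ 2 + 1) * (W t ^ 2 + 1) / (Z t * W t * (q t + 1))) / t) (𝓝[≠] 0)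
      (𝓝 (1 - 2 * ε' - 4 * z * w)) := by
  have h1 : Tendsto (fun t => (1 + e t ^ 2 / q t) / t) (𝓝[≠] 0) (𝓝 (1 - 2 * ε')) := by
    refine tendsto_div_of_hasDerivAt
      ((((he.pow 2).div hq (by simp [hq0])).const_add 1).congr_deriv ?_) (by simp [he0, hq0])
    simp only [Pi.pow_apply, he0, hq0]
    ring
  have h2 : ∀ {Z : ℂ → ℂ} {z : ℂ}, HasDerivAt Z (I * z) 0 → Z 0 = I →
      Tendsto (fun t => (Z t ^ 2 + 1) / t) (𝓝[≠] 0) (𝓝 (-2 * z)) := by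
    intro Z z hZ hZ0
    refine tendsto_div_of_hasDerivAt (((hZ.pow 2).add_const 1).congr_deriv ?_) (by simp [hZ0])
    simp only [hZ0]
    linear_combination 2 * z * Complex.I_sq
  have h := h1.sub ((((tendsto_of_hasDerivAt he).mul (h2 hZ hZ0)).mul (h2 hW hW0)).div
    (((tendsto_of_hasDerivAt hZ).mul (tendsto_of_hasDerivAt hW)).mul (tendsto_add_one_div hq hq0))
    (by simp [hZ0, hW0]))
  have hlim : 1 - 2 * ε' - e 0 * (-2 * z) * (-2 * w) / (Z 0 * W 0 * -1)
      = 1 - 2 * ε' - 4 * z * w := by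
    rw [he0, hZ0, hW0, Complex.I_mul_I]
    ring
  rw [hlim] at h
  refine h.congr' ?_
  filter_upwards [self_mem_nhdsWithin] with t ht
  have ht : t ≠ 0 := ht
  simp only [Pi.div_apply]
  field_simp

open Complex (I) in
theorem tendsto_neg_one_sub_div {A B C D q e : ℂ → ℂ} {a b c d ε' : ℂ}
    (hA : HasDerivAt A (I * a) 0) (hA0 : A 0 = I) (hB : HasDerivAt B (-I * b) 0) (hB0 : B 0 = -I)
    (hC : HasDerivAt C (I * c) 0) (hC0 : C 0 = I) (hD : HasDerivAt D (-I * d) 0) (hD0 : D 0 = -I)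
    (he : HasDerivAt e ε' 0) (he0 : e 0 = 1) (hq : HasDerivAt q (-1) 0) (hq0 : q 0 = -1) :
    Tendsto (fun t => (-1 - A t * e t ^ 2 * B t * C t * D t / q t) / t) (𝓝[≠] 0)
      (𝓝 (a + b + c + d + 2 * ε' - 1)) := by
  refine tendsto_div_of_hasDerivAt ((((((((hA.mul (he.pow 2)).mul hB).mul hC).mul hD).div hq
    (by simp [hq0]))).const_sub (-1)).congr_deriv ?_) (by simp [hA0, hB0, hC0, hD0, he0, hq0])
  simp only [Pi.mul_apply, Pi.pow_apply, hA0, hB0, hC0, hD0, he0, hq0]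
  linear_combination (a + b + c + d + 2 * ε' - 1) * (I ^ 2 - 1) * Complex.I_sq

theorem tendsto_nhds_of_eq {f : ℂ → ℂ} {l : Filter ℂ} {a b : ℂ} (h : Tendsto f l (𝓝 a))
    (hab : a = b) : Tendsto f l (𝓝 b) := hab ▸ h

theorem tendsto_sub_aT_mul_sub_bT (α β z : ℂ) :
    Tendsto (fun t => (zT z t - aT α t) * (zT z t - bT β t) / t) (𝓝[≠] 0)
      (𝓝 (4 * (z - α + 1 / 4))) :=
  tendsto_nhds_of_eq (tendsto_sub_mul_sub_div (hasDerivAt_aT α) (aT_zero α) (hasDerivAt_bT β)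
    (bT_zero β)
    (hasDerivAt_zT z) (zT_zero z)) (by ring)

theorem tendsto_sub_cT_mul_sub_dT (γ δ z : ℂ) :
    Tendsto (fun t => (zT z t - cT γ t) * (zT z t - dT δ t) / t) (𝓝[≠] 0)
      (𝓝 (4 * (z + γ + 1 / 4))) :=
  tendsto_nhds_of_eq (tendsto_sub_mul_sub_div (hasDerivAt_cT γ) (cT_zero γ) (hasDerivAt_dT δ)
    (dT_zero δ)
    (hasDerivAt_zT z) (zT_zero z)) (by ring)

theorem tendsto_aT_mul_sub_one_mul_bT_mul_sub_one (α β z : ℂ) :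
    Tendsto (fun t => (aT α t * zT z t - 1) * (bT β t * zT z t - 1) / t) (𝓝[≠] 0)
      (𝓝 (4 * (z - β - 1 / 4))) :=
  tendsto_nhds_of_eq (tendsto_mul_sub_one_div (hasDerivAt_aT α) (aT_zero α) (hasDerivAt_bT β)
    (bT_zero β)
    (hasDerivAt_zT z) (zT_zero z)) (by ring)

theorem tendsto_cT_mul_sub_one_mul_dT_mul_sub_one (γ δ z : ℂ) :
    Tendsto (fun t => (cT γ t * zT z t - 1) * (dT δ t * zT z t - 1) / t) (𝓝[≠] 0)
      (𝓝 (4 * (z - δ - 1 / 4))) :=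
  tendsto_nhds_of_eq (tendsto_mul_sub_one_div (hasDerivAt_cT γ) (cT_zero γ) (hasDerivAt_dT δ)
    (dT_zero δ)
    (hasDerivAt_zT z) (zT_zero z)) (by ring)

theorem tendsto_zT_sq_sub_one (z : ℂ) :
    Tendsto (fun t => zT z t ^ 2 - 1) (𝓝[≠] 0) (𝓝 (-2)) :=
  tendsto_sq_sub_one (hasDerivAt_zT z) (zT_zero z)

theorem tendsto_zT_sq_sub_qT_div (z : ℂ) :
    Tendsto (fun t => (zT z t ^ 2 - qT t) / t) (𝓝[≠] 0) (𝓝 (4 * (z + 1 / 4))) :=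
  tendsto_nhds_of_eq (tendsto_sq_sub_div hasDerivAt_qT qT_zero (hasDerivAt_zT z) (zT_zero z))
      (by ring)

theorem tendsto_qT_mul_zT_sq_sub_one_div (z : ℂ) :
    Tendsto (fun t => (qT t * zT z t ^ 2 - 1) / t) (𝓝[≠] 0) (𝓝 (-4 * (z - 1 / 4))) :=
  tendsto_nhds_of_eq (tendsto_mul_sq_sub_one_div hasDerivAt_qT qT_zero (hasDerivAt_zT z)
      (zT_zero z)) (by ring)

theorem tendsto_qT : Tendsto qT (𝓝[≠] 0) (𝓝 (-1)) :=
  tendsto_nhds_of_eq (tendsto_of_hasDerivAt hasDerivAt_qT) qT_zero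

theorem tendsto_qT_add_one_div : Tendsto (fun t => (qT t + 1) / t) (𝓝[≠] 0) (𝓝 (-1)) :=
  tendsto_add_one_div hasDerivAt_qT qT_zero

theorem tendsto_zT_mul_zT_sub_a₂T (ε z w : ℂ) :
    Tendsto (fun t => zT z t * zT w t - a₂T ε t) (𝓝[≠] 0) (𝓝 (-2)) :=
  tendsto_mul_sub (hasDerivAt_zT z) (zT_zero z) (hasDerivAt_zT w) (zT_zero w) (hasDerivAt_a₂T ε)
    (a₂T_zero ε)

theorem tendsto_zT_mul_zT_sub_a₂T_mul_qT_div (ε z w : ℂ) :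
    Tendsto (fun t => (zT z t * zT w t - a₂T ε t * qT t) / t) (𝓝[≠] 0)
      (𝓝 (2 * (ε + z + w + 1 / 2))) :=
  tendsto_nhds_of_eq (tendsto_mul_sub_mul_div (hasDerivAt_zT z) (zT_zero z) (hasDerivAt_zT w)
    (zT_zero w) (hasDerivAt_a₂T ε)
    (a₂T_zero ε) hasDerivAt_qT qT_zero) (by ring)

theorem tendsto_a₂T_mul_zT_mul_zT_sub_one (ε z w : ℂ) :
    Tendsto (fun t => a₂T ε t * zT z t * zT w t - 1) (𝓝[≠] 0) (𝓝 (-2)) :=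
  tendsto_mul_mul_sub_one (hasDerivAt_zT z) (zT_zero z) (hasDerivAt_zT w) (zT_zero w)
      (hasDerivAt_a₂T ε)
    (a₂T_zero ε)

theorem tendsto_a₂T_mul_qT_mul_zT_mul_zT_sub_one_div (ε z w : ℂ) :
    Tendsto (fun t => (a₂T ε t * qT t * zT z t * zT w t - 1) / t) (𝓝[≠] 0)
      (𝓝 (2 * (ε - z - w + 1 / 2))) :=
  tendsto_nhds_of_eq (tendsto_mul_mul_mul_sub_one_div (hasDerivAt_zT z) (zT_zero z)
      (hasDerivAt_zT w) (zT_zero w) (hasDerivAt_a₂T ε)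
    (a₂T_zero ε) hasDerivAt_qT qT_zero) (by ring)

theorem tendsto_zT_sub_mul_zT_sub_div (ε z w : ℂ) :
    Tendsto (fun t => (zT z t - a₂T ε t * zT w t) * (zT z t - a₂T ε t * qT t * zT w t) / t)
      (𝓝[≠] 0) (𝓝 (4 * (ε + z - w))) :=
  tendsto_nhds_of_eq (tendsto_sub_mul_sub_mul_div (hasDerivAt_zT z) (zT_zero z) (hasDerivAt_zT w)
    (zT_zero w) (hasDerivAt_a₂T ε)
    (a₂T_zero ε) hasDerivAt_qT qT_zero) (by ring)

theorem tendsto_a₂T_mul_zT_sub_mul_div (ε z w : ℂ) :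
    Tendsto (fun t => (a₂T ε t * zT z t - zT w t) * (a₂T ε t * qT t * zT z t - zT w t) / t)
      (𝓝[≠] 0) (𝓝 (4 * (ε - z + w))) :=
  tendsto_nhds_of_eq (tendsto_mul_sub_mul_mul_sub_div (hasDerivAt_zT z) (zT_zero z)
      (hasDerivAt_zT w) (zT_zero w) (hasDerivAt_a₂T ε)
    (a₂T_zero ε) hasDerivAt_qT qT_zero) (by ring)

theorem tendsto_zT_mul_zT_sub_div (ε z w v : ℂ) :
    Tendsto (fun t => zT v t * (zT z t - a₂T ε t * zT w t) / t) (𝓝[≠] 0)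
      (𝓝 (2 * (ε + z - w))) :=
  tendsto_nhds_of_eq (tendsto_mul_sub_mul_self_div (hasDerivAt_zT z) (zT_zero z) (hasDerivAt_zT w)
    (zT_zero w) (hasDerivAt_a₂T ε)
    (a₂T_zero ε) (hasDerivAt_zT v) (zT_zero v)) (by ring)

theorem tendsto_awFactor_aT_bT_div (α β z : ℂ) :
    Tendsto (fun t => awFactor (qT t) (aT α t) (bT β t) (zT z t) / t) (𝓝[≠] 0)
      (𝓝 (-8 * (α * (z - 1 / 4) + β * (z + 1 / 4)))) :=
  tendsto_nhds_of_eq (tendsto_awFactor_div (hasDerivAt_aT α) (aT_zero α) (hasDerivAt_bT β)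
    (bT_zero β)
    (hasDerivAt_zT z) (zT_zero z) hasDerivAt_qT qT_zero) (by ring)

theorem tendsto_awFactor_cT_dT_div (γ δ z : ℂ) :
    Tendsto (fun t => awFactor (qT t) (cT γ t) (dT δ t) (zT z t) / t) (𝓝[≠] 0)
      (𝓝 (-8 * (δ * (z + 1 / 4) - γ * (z - 1 / 4)))) :=
  tendsto_nhds_of_eq (tendsto_awFactor_div (hasDerivAt_cT γ) (cT_zero γ) (hasDerivAt_dT δ)
    (dT_zero δ)
    (hasDerivAt_zT z) (zT_zero z) hasDerivAt_qT qT_zero) (by ring)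

/-! ### Limits of the coefficients -/

section coefficients

/-- The coefficient `C_{i,j} / (4 (1 + q))` at the point `(i e^{-2tz₁}, i e^{-2tz₂})`, as a
function of `t`. -/
def scaledCoefAW (α β γ δ ε : ℂ) (i j : SignType) (z₁ z₂ t : ℂ) : ℂ :=
  coefAW (qT t) (aT α t) (bT β t) (cT γ t) (dT δ t) (a₂T ε t) i j (zT z₁ t) (zT z₂ t)
    / (4 * (1 + qT t))

/-- Cancellation of a power of a nonzero number, in a form in which the hypothesis `h` is
accessible to `ring`. -/
theorem eq_of_eq_mul_pow_mul_inv_pow {x y s : ℂ} (hs : s ≠ 0) (k : ℕ)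
    (h : x = y * (s ^ k * s⁻¹ ^ k)) : x = y := by
  rw [h, ← mul_pow, mul_inv_cancel₀ hs, one_pow, mul_one]

variable (α β γ δ ε : ℂ) {z₁ z₂ : ℂ}

theorem denominator_limits_ne_zero {z : ℂ} (hz : z ≠ 1 / 4) (hz' : z ≠ -1 / 4) :
    4 * (z + 1 / 4) ≠ 0 ∧ -4 * (z - 1 / 4) ≠ 0 :=
  ⟨fun h => hz' (by linear_combination h / 4), fun h => hz (by linear_combination -h / 4)⟩

/-- In `C_{i,j} / (4(1+q))` the factors which vanish at `t = 0` are matched: numerator and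
denominator are each divided by the same power of `t`, after which every factor has a limit. -/
theorem tendsto_coefAW_neg_neg (hz₁ : z₁ ≠ 1 / 4) (hz₁' : z₁ ≠ -1 / 4) (hz₂ : z₂ ≠ 1 / 4)
    (hz₂' : z₂ ≠ -1 / 4) :
    Tendsto (scaledCoefAW α β γ δ ε .neg .neg z₁ z₂) (𝓝[≠] 0)
      (𝓝 (coefL2 α β γ δ ε .neg .neg z₁ z₂)) := by
  obtain ⟨hm₁, hp₁⟩ := denominator_limits_ne_zero hz₁ hz₁'
  obtain ⟨hm₂, hp₂⟩ := denominator_limits_ne_zero hz₂ hz₂'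
  have h := (((((tendsto_sub_aT_mul_sub_bT α β z₁).mul
      (tendsto_sub_cT_mul_sub_dT γ δ z₂)).mul
      (tendsto_zT_mul_zT_sub_a₂T ε z₁ z₂)).mul
      (tendsto_zT_mul_zT_sub_a₂T_mul_qT_div ε z₁ z₂)).div
    (((((tendsto_zT_sq_sub_one z₁).mul
      (tendsto_zT_sq_sub_one z₂)).mul
      (tendsto_zT_sq_sub_qT_div z₁)).mul
      (tendsto_zT_sq_sub_qT_div z₂)).mul
      (tendsto_qT_add_one_div))
    (mul_ne_zero (mul_ne_zero (mul_ne_zero (mul_ne_zero (by norm_num) (by norm_num)) hm₁) hm₂)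
        (by norm_num))).mul_const (1 / 4)
  refine (h.congr' ?_).trans_eq (congrArg 𝓝 ?_)
  · clear h
    filter_upwards [self_mem_nhdsWithin] with t ht
    have ht : t ≠ 0 := ht
    simp only [scaledCoefAW, coefAW, Pi.div_apply]
    rw [← neg_sub (zT z₂ t ^ 2) (qT t),
      add_comm 1 (qT t)]
    generalize zT z₁ t - aT α t = x0
    generalize zT z₁ t - bT β t = x1
    generalize zT z₂ t - cT γ t = x2
    generalize zT z₂ t - dT δ t = x3
    generalize zT z₁ t * zT z₂ t - a₂T ε t = x4
    generalize zT z₁ t * zT z₂ t - a₂T ε t * qT t = x5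
    generalize zT z₁ t ^ 2 - 1 = x6
    generalize zT z₂ t ^ 2 - 1 = x7
    generalize zT z₁ t ^ 2 - qT t = x8
    generalize zT z₂ t ^ 2 - qT t = x9
    generalize qT t + 1 = x10
    have hs : t⁻¹ ≠ 0 := inv_ne_zero ht
    simp only [fun x : ℂ => div_eq_mul_inv x t]
    generalize t⁻¹ = s at *
    refine eq_of_eq_mul_pow_mul_inv_pow hs 3 ?_
    ring
  · simp only [coefL2]
    generalize z₁ - α + 1 / 4 = x0
    generalize z₂ + γ + 1 / 4 = x1
    generalize ε + z₁ + z₂ + 1 / 2 = x2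
    generalize z₁ - 1 / 4 = y1
    generalize z₁ + 1 / 4 = y2
    generalize z₂ - 1 / 4 = y3
    generalize z₂ + 1 / 4 = y4
    ring

theorem tendsto_coefAW_neg_zero (hz₁ : z₁ ≠ 1 / 4) (hz₁' : z₁ ≠ -1 / 4) (hz₂ : z₂ ≠ 1 / 4)
    (hz₂' : z₂ ≠ -1 / 4) :
    Tendsto (scaledCoefAW α β γ δ ε .neg .zero z₁ z₂) (𝓝[≠] 0)
      (𝓝 (coefL2 α β γ δ ε .neg .zero z₁ z₂)) := by
  obtain ⟨hm₁, hp₁⟩ := denominator_limits_ne_zero hz₁ hz₁'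
  obtain ⟨hm₂, hp₂⟩ := denominator_limits_ne_zero hz₂ hz₂'
  have h := (((((((tendsto_zT_mul_zT_sub_div ε z₁ z₂ z₂).mul
      (tendsto_qT)).mul
      (tendsto_qT_add_one_div)).mul
      (tendsto_sub_aT_mul_sub_bT α β z₁)).mul
      (tendsto_zT_mul_zT_sub_a₂T ε z₁ z₂)).mul
      (tendsto_awFactor_cT_dT_div γ δ z₂)).div
    (((((tendsto_zT_sq_sub_one z₁).mul
      (tendsto_zT_sq_sub_qT_div z₁)).mul
      (tendsto_zT_sq_sub_qT_div z₂)).mul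
      (tendsto_qT_mul_zT_sq_sub_one_div z₂)).mul
      (tendsto_qT_add_one_div))
    (mul_ne_zero (mul_ne_zero (mul_ne_zero (mul_ne_zero (by norm_num) hm₁) hm₂) hp₂)
        (by norm_num))).mul_const (-1 / 4)
  refine (h.congr' ?_).trans_eq (congrArg 𝓝 ?_)
  · clear h
    filter_upwards [self_mem_nhdsWithin] with t ht
    have ht : t ≠ 0 := ht
    simp only [scaledCoefAW, coefAW, Pi.div_apply]
    rw [← neg_sub (zT z₂ t ^ 2) (qT t),
      add_comm 1 (qT t)]
    generalize zT z₁ t - aT α t = x0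
    generalize zT z₁ t - bT β t = x1
    generalize zT z₁ t - a₂T ε t * zT z₂ t = x2
    generalize zT z₁ t * zT z₂ t - a₂T ε t = x3
    generalize awFactor (qT t) (cT γ t) (dT δ t) (zT z₂ t) = x4
    generalize zT z₁ t ^ 2 - 1 = x5
    generalize zT z₁ t ^ 2 - qT t = x6
    generalize zT z₂ t ^ 2 - qT t = x7
    generalize qT t * zT z₂ t ^ 2 - 1 = x8
    generalize qT t + 1 = x9
    have hs : t⁻¹ ≠ 0 := inv_ne_zero ht
    simp only [fun x : ℂ => div_eq_mul_inv x t]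
    generalize t⁻¹ = s at *
    refine eq_of_eq_mul_pow_mul_inv_pow hs 4 ?_
    ring
  · simp only [coefL2]
    generalize z₁ - α + 1 / 4 = x0
    generalize ε + z₁ - z₂ = x1
    generalize δ * (z₂ + 1 / 4) - γ * (z₂ - 1 / 4) = x2
    generalize z₁ - 1 / 4 = y1
    generalize z₁ + 1 / 4 = y2
    generalize z₂ - 1 / 4 = y3
    generalize z₂ + 1 / 4 = y4
    ring

theorem tendsto_coefAW_neg_pos (hz₁ : z₁ ≠ 1 / 4) (hz₁' : z₁ ≠ -1 / 4) (hz₂ : z₂ ≠ 1 / 4)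
    (hz₂' : z₂ ≠ -1 / 4) :
    Tendsto (scaledCoefAW α β γ δ ε .neg .pos z₁ z₂) (𝓝[≠] 0)
      (𝓝 (coefL2 α β γ δ ε .neg .pos z₁ z₂)) := by
  obtain ⟨hm₁, hp₁⟩ := denominator_limits_ne_zero hz₁ hz₁'
  obtain ⟨hm₂, hp₂⟩ := denominator_limits_ne_zero hz₂ hz₂'
  have h := ((((tendsto_sub_aT_mul_sub_bT α β z₁).mul
      (tendsto_cT_mul_sub_one_mul_dT_mul_sub_one γ δ z₂)).mul
      (tendsto_zT_sub_mul_zT_sub_div ε z₁ z₂)).div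
    (((((tendsto_zT_sq_sub_one z₁).mul
      (tendsto_zT_sq_sub_one z₂)).mul
      (tendsto_zT_sq_sub_qT_div z₁)).mul
      (tendsto_qT_mul_zT_sq_sub_one_div z₂)).mul
      (tendsto_qT_add_one_div))
    (mul_ne_zero (mul_ne_zero (mul_ne_zero (mul_ne_zero (by norm_num) (by norm_num)) hm₁) hp₂)
        (by norm_num))).mul_const (1 / 4)
  refine (h.congr' ?_).trans_eq (congrArg 𝓝 ?_)
  · clear h
    filter_upwards [self_mem_nhdsWithin] with t ht
    have ht : t ≠ 0 := ht
    simp only [scaledCoefAW, coefAW, Pi.div_apply]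
    rw [← neg_sub (zT z₁ t) (aT α t),
      ← neg_sub (dT δ t * zT z₂ t) 1,
      add_comm 1 (qT t)]
    generalize zT z₁ t - aT α t = x0
    generalize zT z₁ t - bT β t = x1
    generalize cT γ t * zT z₂ t - 1 = x2
    generalize dT δ t * zT z₂ t - 1 = x3
    generalize zT z₁ t - a₂T ε t * zT z₂ t = x4
    generalize zT z₁ t - a₂T ε t * qT t * zT z₂ t = x5
    generalize zT z₁ t ^ 2 - 1 = x6
    generalize zT z₂ t ^ 2 - 1 = x7
    generalize zT z₁ t ^ 2 - qT t = x8
    generalize qT t * zT z₂ t ^ 2 - 1 = x9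
    generalize qT t + 1 = x10
    have hs : t⁻¹ ≠ 0 := inv_ne_zero ht
    simp only [fun x : ℂ => div_eq_mul_inv x t]
    generalize t⁻¹ = s at *
    refine eq_of_eq_mul_pow_mul_inv_pow hs 3 ?_
    ring
  · simp only [coefL2]
    generalize z₁ - α + 1 / 4 = x0
    generalize z₂ - δ - 1 / 4 = x1
    generalize ε + z₁ - z₂ = x2
    generalize z₁ - 1 / 4 = y1
    generalize z₁ + 1 / 4 = y2
    generalize z₂ - 1 / 4 = y3
    generalize z₂ + 1 / 4 = y4
    ring

theorem tendsto_coefAW_zero_neg (hz₁ : z₁ ≠ 1 / 4) (hz₁' : z₁ ≠ -1 / 4) (hz₂ : z₂ ≠ 1 / 4)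
    (hz₂' : z₂ ≠ -1 / 4) :
    Tendsto (scaledCoefAW α β γ δ ε .zero .neg z₁ z₂) (𝓝[≠] 0)
      (𝓝 (coefL2 α β γ δ ε .zero .neg z₁ z₂)) := by
  obtain ⟨hm₁, hp₁⟩ := denominator_limits_ne_zero hz₁ hz₁'
  obtain ⟨hm₂, hp₂⟩ := denominator_limits_ne_zero hz₂ hz₂'
  have h := (((((((tendsto_zT_mul_zT_sub_div ε z₂ z₁ z₁).mul
      (tendsto_qT)).mul
      (tendsto_qT_add_one_div)).mul
      (tendsto_sub_cT_mul_sub_dT γ δ z₂)).mul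
      (tendsto_zT_mul_zT_sub_a₂T ε z₁ z₂)).mul
      (tendsto_awFactor_aT_bT_div α β z₁)).div
    (((((tendsto_zT_sq_sub_one z₂).mul
      (tendsto_zT_sq_sub_qT_div z₁)).mul
      (tendsto_qT_mul_zT_sq_sub_one_div z₁)).mul
      (tendsto_zT_sq_sub_qT_div z₂)).mul
      (tendsto_qT_add_one_div))
    (mul_ne_zero (mul_ne_zero (mul_ne_zero (mul_ne_zero (by norm_num) hm₁) hp₁) hm₂)
        (by norm_num))).mul_const (-1 / 4)
  refine (h.congr' ?_).trans_eq (congrArg 𝓝 ?_)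
  · clear h
    filter_upwards [self_mem_nhdsWithin] with t ht
    have ht : t ≠ 0 := ht
    simp only [scaledCoefAW, coefAW, Pi.div_apply]
    rw [← neg_sub (qT t * zT z₁ t ^ 2) 1,
      add_comm 1 (qT t)]
    generalize zT z₂ t - cT γ t = x0
    generalize zT z₂ t - dT δ t = x1
    generalize zT z₂ t - a₂T ε t * zT z₁ t = x2
    generalize zT z₁ t * zT z₂ t - a₂T ε t = x3
    generalize awFactor (qT t) (aT α t) (bT β t) (zT z₁ t) = x4
    generalize zT z₂ t ^ 2 - 1 = x5
    generalize zT z₁ t ^ 2 - qT t = x6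
    generalize qT t * zT z₁ t ^ 2 - 1 = x7
    generalize zT z₂ t ^ 2 - qT t = x8
    generalize qT t + 1 = x9
    have hs : t⁻¹ ≠ 0 := inv_ne_zero ht
    simp only [fun x : ℂ => div_eq_mul_inv x t]
    generalize t⁻¹ = s at *
    refine eq_of_eq_mul_pow_mul_inv_pow hs 4 ?_
    ring
  · simp only [coefL2]
    rw [show ε + z₂ - z₁ = ε - z₁ + z₂ by ring]
    generalize z₂ + γ + 1 / 4 = x0
    generalize ε - z₁ + z₂ = x1
    generalize α * (z₁ - 1 / 4) + β * (z₁ + 1 / 4) = x2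
    generalize z₁ - 1 / 4 = y1
    generalize z₁ + 1 / 4 = y2
    generalize z₂ - 1 / 4 = y3
    generalize z₂ + 1 / 4 = y4
    ring

theorem tendsto_coefAW_zero_pos (hz₁ : z₁ ≠ 1 / 4) (hz₁' : z₁ ≠ -1 / 4) (hz₂ : z₂ ≠ 1 / 4)
    (hz₂' : z₂ ≠ -1 / 4) :
    Tendsto (scaledCoefAW α β γ δ ε .zero .pos z₁ z₂) (𝓝[≠] 0)
      (𝓝 (coefL2 α β γ δ ε .zero .pos z₁ z₂)) := by
  obtain ⟨hm₁, hp₁⟩ := denominator_limits_ne_zero hz₁ hz₁'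
  obtain ⟨hm₂, hp₂⟩ := denominator_limits_ne_zero hz₂ hz₂'
  have h := (((((((tendsto_zT_mul_zT_sub_div ε z₁ z₂ z₁).mul
      (tendsto_qT)).mul
      (tendsto_qT_add_one_div)).mul
      (tendsto_cT_mul_sub_one_mul_dT_mul_sub_one γ δ z₂)).mul
      (tendsto_a₂T_mul_zT_mul_zT_sub_one ε z₁ z₂)).mul
      (tendsto_awFactor_aT_bT_div α β z₁)).div
    (((((tendsto_zT_sq_sub_one z₂).mul
      (tendsto_zT_sq_sub_qT_div z₁)).mul
      (tendsto_qT_mul_zT_sq_sub_one_div z₁)).mul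
      (tendsto_qT_mul_zT_sq_sub_one_div z₂)).mul
      (tendsto_qT_add_one_div))
    (mul_ne_zero (mul_ne_zero (mul_ne_zero (mul_ne_zero (by norm_num) hm₁) hp₁) hp₂)
        (by norm_num))).mul_const (1 / 4)
  refine (h.congr' ?_).trans_eq (congrArg 𝓝 ?_)
  · clear h
    filter_upwards [self_mem_nhdsWithin] with t ht
    have ht : t ≠ 0 := ht
    simp only [scaledCoefAW, coefAW, Pi.div_apply]
    rw [← neg_sub (cT γ t * zT z₂ t) 1,
      ← neg_sub (dT δ t * zT z₂ t) 1,
      ← neg_sub (a₂T ε t * zT z₁ t * zT z₂ t) 1,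
      ← neg_sub (zT z₂ t ^ 2) 1,
      ← neg_sub (qT t * zT z₁ t ^ 2) 1,
      ← neg_sub (qT t * zT z₂ t ^ 2) 1,
      add_comm 1 (qT t)]
    generalize cT γ t * zT z₂ t - 1 = x0
    generalize dT δ t * zT z₂ t - 1 = x1
    generalize zT z₁ t - a₂T ε t * zT z₂ t = x2
    generalize a₂T ε t * zT z₁ t * zT z₂ t - 1 = x3
    generalize awFactor (qT t) (aT α t) (bT β t) (zT z₁ t) = x4
    generalize zT z₂ t ^ 2 - 1 = x5
    generalize zT z₁ t ^ 2 - qT t = x6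
    generalize qT t * zT z₁ t ^ 2 - 1 = x7
    generalize qT t * zT z₂ t ^ 2 - 1 = x8
    generalize qT t + 1 = x9
    have hs : t⁻¹ ≠ 0 := inv_ne_zero ht
    simp only [fun x : ℂ => div_eq_mul_inv x t]
    generalize t⁻¹ = s at *
    refine eq_of_eq_mul_pow_mul_inv_pow hs 4 ?_
    ring
  · simp only [coefL2]
    generalize z₂ - δ - 1 / 4 = x0
    generalize ε + z₁ - z₂ = x1
    generalize α * (z₁ - 1 / 4) + β * (z₁ + 1 / 4) = x2
    generalize z₁ - 1 / 4 = y1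
    generalize z₁ + 1 / 4 = y2
    generalize z₂ - 1 / 4 = y3
    generalize z₂ + 1 / 4 = y4
    ring

theorem tendsto_coefAW_pos_neg (hz₁ : z₁ ≠ 1 / 4) (hz₁' : z₁ ≠ -1 / 4) (hz₂ : z₂ ≠ 1 / 4)
    (hz₂' : z₂ ≠ -1 / 4) :
    Tendsto (scaledCoefAW α β γ δ ε .pos .neg z₁ z₂) (𝓝[≠] 0)
      (𝓝 (coefL2 α β γ δ ε .pos .neg z₁ z₂)) := by
  obtain ⟨hm₁, hp₁⟩ := denominator_limits_ne_zero hz₁ hz₁'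
  obtain ⟨hm₂, hp₂⟩ := denominator_limits_ne_zero hz₂ hz₂'
  have h := ((((tendsto_aT_mul_sub_one_mul_bT_mul_sub_one α β z₁).mul
      (tendsto_sub_cT_mul_sub_dT γ δ z₂)).mul
      (tendsto_a₂T_mul_zT_sub_mul_div ε z₁ z₂)).div
    (((((tendsto_zT_sq_sub_one z₁).mul
      (tendsto_zT_sq_sub_one z₂)).mul
      (tendsto_qT_mul_zT_sq_sub_one_div z₁)).mul
      (tendsto_zT_sq_sub_qT_div z₂)).mul
      (tendsto_qT_add_one_div))
    (mul_ne_zero (mul_ne_zero (mul_ne_zero (mul_ne_zero (by norm_num) (by norm_num)) hp₁) hm₂)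
        (by norm_num))).mul_const (1 / 4)
  refine (h.congr' ?_).trans_eq (congrArg 𝓝 ?_)
  · clear h
    filter_upwards [self_mem_nhdsWithin] with t ht
    have ht : t ≠ 0 := ht
    simp only [scaledCoefAW, coefAW, Pi.div_apply]
    rw [← neg_sub (zT z₂ t) (cT γ t),
      ← neg_sub (zT z₂ t ^ 2) (qT t),
      add_comm 1 (qT t)]
    generalize aT α t * zT z₁ t - 1 = x0
    generalize bT β t * zT z₁ t - 1 = x1
    generalize zT z₂ t - cT γ t = x2
    generalize zT z₂ t - dT δ t = x3
    generalize a₂T ε t * zT z₁ t - zT z₂ t = x4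
    generalize a₂T ε t * qT t * zT z₁ t - zT z₂ t = x5
    generalize zT z₁ t ^ 2 - 1 = x6
    generalize zT z₂ t ^ 2 - 1 = x7
    generalize qT t * zT z₁ t ^ 2 - 1 = x8
    generalize zT z₂ t ^ 2 - qT t = x9
    generalize qT t + 1 = x10
    have hs : t⁻¹ ≠ 0 := inv_ne_zero ht
    simp only [fun x : ℂ => div_eq_mul_inv x t]
    generalize t⁻¹ = s at *
    refine eq_of_eq_mul_pow_mul_inv_pow hs 3 ?_
    ring
  · simp only [coefL2]
    generalize z₁ - β - 1 / 4 = x0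
    generalize z₂ + γ + 1 / 4 = x1
    generalize ε - z₁ + z₂ = x2
    generalize z₁ - 1 / 4 = y1
    generalize z₁ + 1 / 4 = y2
    generalize z₂ - 1 / 4 = y3
    generalize z₂ + 1 / 4 = y4
    ring

theorem tendsto_coefAW_pos_zero (hz₁ : z₁ ≠ 1 / 4) (hz₁' : z₁ ≠ -1 / 4) (hz₂ : z₂ ≠ 1 / 4)
    (hz₂' : z₂ ≠ -1 / 4) :
    Tendsto (scaledCoefAW α β γ δ ε .pos .zero z₁ z₂) (𝓝[≠] 0)
      (𝓝 (coefL2 α β γ δ ε .pos .zero z₁ z₂)) := by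
  obtain ⟨hm₁, hp₁⟩ := denominator_limits_ne_zero hz₁ hz₁'
  obtain ⟨hm₂, hp₂⟩ := denominator_limits_ne_zero hz₂ hz₂'
  have h := (((((((tendsto_zT_mul_zT_sub_div ε z₂ z₁ z₂).mul
      (tendsto_qT)).mul
      (tendsto_qT_add_one_div)).mul
      (tendsto_aT_mul_sub_one_mul_bT_mul_sub_one α β z₁)).mul
      (tendsto_a₂T_mul_zT_mul_zT_sub_one ε z₁ z₂)).mul
      (tendsto_awFactor_cT_dT_div γ δ z₂)).div
    (((((tendsto_zT_sq_sub_one z₁).mul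
      (tendsto_qT_mul_zT_sq_sub_one_div z₁)).mul
      (tendsto_zT_sq_sub_qT_div z₂)).mul
      (tendsto_qT_mul_zT_sq_sub_one_div z₂)).mul
      (tendsto_qT_add_one_div))
    (mul_ne_zero (mul_ne_zero (mul_ne_zero (mul_ne_zero (by norm_num) hp₁) hm₂) hp₂)
        (by norm_num))).mul_const (1 / 4)
  refine (h.congr' ?_).trans_eq (congrArg 𝓝 ?_)
  · clear h
    filter_upwards [self_mem_nhdsWithin] with t ht
    have ht : t ≠ 0 := ht
    simp only [scaledCoefAW, coefAW, Pi.div_apply]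
    rw [← neg_sub (aT α t * zT z₁ t) 1,
      ← neg_sub (bT β t * zT z₁ t) 1,
      ← neg_sub (a₂T ε t * zT z₁ t * zT z₂ t) 1,
      ← neg_sub (zT z₂ t ^ 2) (qT t),
      add_comm 1 (qT t)]
    generalize aT α t * zT z₁ t - 1 = x0
    generalize bT β t * zT z₁ t - 1 = x1
    generalize zT z₂ t - a₂T ε t * zT z₁ t = x2
    generalize a₂T ε t * zT z₁ t * zT z₂ t - 1 = x3
    generalize awFactor (qT t) (cT γ t) (dT δ t) (zT z₂ t) = x4
    generalize zT z₁ t ^ 2 - 1 = x5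
    generalize qT t * zT z₁ t ^ 2 - 1 = x6
    generalize zT z₂ t ^ 2 - qT t = x7
    generalize qT t * zT z₂ t ^ 2 - 1 = x8
    generalize qT t + 1 = x9
    have hs : t⁻¹ ≠ 0 := inv_ne_zero ht
    simp only [fun x : ℂ => div_eq_mul_inv x t]
    generalize t⁻¹ = s at *
    refine eq_of_eq_mul_pow_mul_inv_pow hs 4 ?_
    ring
  · simp only [coefL2]
    rw [show ε + z₂ - z₁ = ε - z₁ + z₂ by ring]
    generalize z₁ - β - 1 / 4 = x0
    generalize ε - z₁ + z₂ = x1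
    generalize δ * (z₂ + 1 / 4) - γ * (z₂ - 1 / 4) = x2
    generalize z₁ - 1 / 4 = y1
    generalize z₁ + 1 / 4 = y2
    generalize z₂ - 1 / 4 = y3
    generalize z₂ + 1 / 4 = y4
    ring

theorem tendsto_coefAW_pos_pos (hz₁ : z₁ ≠ 1 / 4) (hz₁' : z₁ ≠ -1 / 4) (hz₂ : z₂ ≠ 1 / 4)
    (hz₂' : z₂ ≠ -1 / 4) :
    Tendsto (scaledCoefAW α β γ δ ε .pos .pos z₁ z₂) (𝓝[≠] 0)
      (𝓝 (coefL2 α β γ δ ε .pos .pos z₁ z₂)) := by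
  obtain ⟨hm₁, hp₁⟩ := denominator_limits_ne_zero hz₁ hz₁'
  obtain ⟨hm₂, hp₂⟩ := denominator_limits_ne_zero hz₂ hz₂'
  have h := (((((tendsto_aT_mul_sub_one_mul_bT_mul_sub_one α β z₁).mul
      (tendsto_cT_mul_sub_one_mul_dT_mul_sub_one γ δ z₂)).mul
      (tendsto_a₂T_mul_zT_mul_zT_sub_one ε z₁ z₂)).mul
      (tendsto_a₂T_mul_qT_mul_zT_mul_zT_sub_one_div ε z₁ z₂)).div
    (((((tendsto_zT_sq_sub_one z₁).mul
      (tendsto_zT_sq_sub_one z₂)).mul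
      (tendsto_qT_mul_zT_sq_sub_one_div z₁)).mul
      (tendsto_qT_mul_zT_sq_sub_one_div z₂)).mul
      (tendsto_qT_add_one_div))
    (mul_ne_zero (mul_ne_zero (mul_ne_zero (mul_ne_zero (by norm_num) (by norm_num)) hp₁) hp₂)
        (by norm_num))).mul_const (1 / 4)
  refine (h.congr' ?_).trans_eq (congrArg 𝓝 ?_)
  · clear h
    filter_upwards [self_mem_nhdsWithin] with t ht
    have ht : t ≠ 0 := ht
    simp only [scaledCoefAW, coefAW, Pi.div_apply]
    rw [← neg_sub (dT δ t * zT z₂ t) 1,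
      add_comm 1 (qT t)]
    generalize aT α t * zT z₁ t - 1 = x0
    generalize bT β t * zT z₁ t - 1 = x1
    generalize cT γ t * zT z₂ t - 1 = x2
    generalize dT δ t * zT z₂ t - 1 = x3
    generalize a₂T ε t * zT z₁ t * zT z₂ t - 1 = x4
    generalize a₂T ε t * qT t * zT z₁ t * zT z₂ t - 1 = x5
    generalize zT z₁ t ^ 2 - 1 = x6
    generalize zT z₂ t ^ 2 - 1 = x7
    generalize qT t * zT z₁ t ^ 2 - 1 = x8
    generalize qT t * zT z₂ t ^ 2 - 1 = x9
    generalize qT t + 1 = x10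
    have hs : t⁻¹ ≠ 0 := inv_ne_zero ht
    simp only [fun x : ℂ => div_eq_mul_inv x t]
    generalize t⁻¹ = s at *
    refine eq_of_eq_mul_pow_mul_inv_pow hs 3 ?_
    ring
  · simp only [coefL2]
    generalize z₁ - β - 1 / 4 = x0
    generalize z₂ - δ - 1 / 4 = x1
    generalize ε - z₁ - z₂ + 1 / 2 = x2
    generalize z₁ - 1 / 4 = y1
    generalize z₁ + 1 / 4 = y2
    generalize z₂ - 1 / 4 = y3
    generalize z₂ + 1 / 4 = y4
    ring

end coefficients

/-- The coefficient is a sum of three terms, each of order `t`: `-1 - a a₂² b c d / q`, the term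
`a₂ (a + b) (c + d) / (q + 1)` of order `t² / t`, and a product of order `t⁵` divided by four
factors of order `t`. -/
theorem tendsto_coefAW_zero_zero (α β γ δ ε : ℂ) {z₁ z₂ : ℂ} (hz₁ : z₁ ≠ 1 / 4)
    (hz₁' : z₁ ≠ -1 / 4) (hz₂ : z₂ ≠ 1 / 4) (hz₂' : z₂ ≠ -1 / 4) :
    Tendsto (scaledCoefAW α β γ δ ε .zero .zero z₁ z₂) (𝓝[≠] 0)
      (𝓝 (coefL2 α β γ δ ε .zero .zero z₁ z₂)) := by
  obtain ⟨hm₁, hp₁⟩ := denominator_limits_ne_zero hz₁ hz₁'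
  obtain ⟨hm₂, hp₂⟩ := denominator_limits_ne_zero hz₂ hz₂'
  have hconst := tendsto_neg_one_sub_div (hasDerivAt_aT α) (aT_zero α) (hasDerivAt_bT β)
    (bT_zero β) (hasDerivAt_cT γ) (cT_zero γ) (hasDerivAt_dT δ) (dT_zero δ) (hasDerivAt_a₂T ε)
    (a₂T_zero ε) hasDerivAt_qT qT_zero
  have hab : Tendsto (fun t => (aT α t + bT β t) / t) (𝓝[≠] 0) (𝓝 (Complex.I * (-2 * (α + β)))) :=
    tendsto_div_of_hasDerivAt (((hasDerivAt_aT α).add (hasDerivAt_bT β)).congr_deriv (by ring))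
      (by simp [aT_zero, bT_zero])
  have hcd : Tendsto (fun t => (cT γ t + dT δ t) / t) (𝓝[≠] 0) (𝓝 (Complex.I * (2 * (γ - δ)))) :=
    tendsto_div_of_hasDerivAt (((hasDerivAt_cT γ).add (hasDerivAt_dT δ)).congr_deriv (by ring))
      (by simp [cT_zero, dT_zero])
  have ha₂ : Tendsto (a₂T ε) (𝓝[≠] 0) (𝓝 1) :=
    tendsto_nhds_of_eq (tendsto_of_hasDerivAt (hasDerivAt_a₂T ε)) (a₂T_zero ε)
  have hz : ∀ z, Tendsto (zT z) (𝓝[≠] 0) (𝓝 Complex.I) := fun z =>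
    tendsto_nhds_of_eq (tendsto_of_hasDerivAt (hasDerivAt_zT z)) (zT_zero z)
  have hmid := tendsto_one_add_sq_div_sub_div (hasDerivAt_zT z₁) (zT_zero z₁) (hasDerivAt_zT z₂)
    (zT_zero z₂) (hasDerivAt_a₂T ε) (a₂T_zero ε) hasDerivAt_qT qT_zero
  have hprod := ((ha₂.mul hab).mul hcd).div tendsto_qT_add_one_div (by norm_num)
  have hlast := (((((((hz z₁).pow 2).mul ((hz z₂).pow 2)).mul (tendsto_qT.pow 2)).mul
    (tendsto_qT_add_one_div.pow 2)).mul (tendsto_awFactor_aT_bT_div α β z₁)).mul hmid).mul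
    (tendsto_awFactor_cT_dT_div γ δ z₂)
  have hden := ((tendsto_zT_sq_sub_qT_div z₁).mul (tendsto_qT_mul_zT_sq_sub_one_div z₁)).mul
    ((tendsto_zT_sq_sub_qT_div z₂).mul (tendsto_qT_mul_zT_sq_sub_one_div z₂))
  have h := ((hconst.add hprod).add (hlast.div hden
    (mul_ne_zero (mul_ne_zero hm₁ hp₁) (mul_ne_zero hm₂ hp₂)))).div
    (tendsto_qT_add_one_div.const_mul 4) (by norm_num)
  refine (h.congr' ?_).trans_eq (congrArg 𝓝 ?_)
  · clear h hlast hden hprod hmid hz ha₂ hcd hab hconst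
    filter_upwards [self_mem_nhdsWithin] with t ht
    have ht : t ≠ 0 := ht
    simp only [scaledCoefAW, coefAW, Pi.div_apply]
    rw [add_comm 1 (qT t), ← neg_sub (qT t * zT z₁ t ^ 2) 1, ← neg_sub (qT t * zT z₂ t ^ 2) 1,
      ← mul_div_mul_right _ (4 * (qT t + 1)) (inv_ne_zero ht), ← div_eq_mul_inv (4 * (qT t + 1)),
      mul_div_assoc 4]
    congr 1
    have e : ∀ u v w : ℂ, (-1 + v - u + w) * t⁻¹ = (-1 - u) / t + v / t + w / t := by
      intros
      ring
    rw [e]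
    generalize 1 + a₂T ε t ^ 2 / qT t - a₂T ε t * (zT z₁ t ^ 2 + 1) * (zT z₂ t ^ 2 + 1)
      / (zT z₁ t * zT z₂ t * (qT t + 1)) = x0
    generalize awFactor (qT t) (aT α t) (bT β t) (zT z₁ t) = x1
    generalize awFactor (qT t) (cT γ t) (dT δ t) (zT z₂ t) = x2
    generalize zT z₁ t ^ 2 - qT t = x3
    generalize zT z₂ t ^ 2 - qT t = x4
    generalize qT t * zT z₁ t ^ 2 - 1 = x5
    generalize qT t * zT z₂ t ^ 2 - 1 = x6
    generalize qT t + 1 = x7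
    generalize aT α t + bT β t = x8
    generalize cT γ t + dT δ t = x9
    have hs : t⁻¹ ≠ 0 := inv_ne_zero ht
    simp only [fun x : ℂ => div_eq_mul_inv x t]
    generalize t⁻¹ = s at *
    congr 1
    · congr 1
      refine eq_of_eq_mul_pow_mul_inv_pow hs 1 ?_
      ring
    · refine eq_of_eq_mul_pow_mul_inv_pow hs 4 ?_
      ring
  · clear h hlast hden hprod hmid hz ha₂ hcd hab hconst
    simp only [coefL2]
    generalize δ * (z₂ + 1 / 4) - γ * (z₂ - 1 / 4) = Y
    generalize α * (z₁ - 1 / 4) + β * (z₁ + 1 / 4) = X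
    generalize z₁ - 1 / 4 = y1
    generalize z₁ + 1 / 4 = y2
    generalize z₂ - 1 / 4 = y3
    generalize z₂ + 1 / 4 = y4
    rw [mul_assoc 1 (Complex.I * _), mul_mul_mul_comm Complex.I, Complex.I_mul_I, Complex.I_sq]
    ring

theorem tendsto_coefAW (α β γ δ ε : ℂ) (i j : SignType) {z₁ z₂ : ℂ} (hz₁ : z₁ ≠ 1 / 4)
    (hz₁' : z₁ ≠ -1 / 4) (hz₂ : z₂ ≠ 1 / 4) (hz₂' : z₂ ≠ -1 / 4) :
    Tendsto (scaledCoefAW α β γ δ ε i j z₁ z₂) (𝓝[≠] 0)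
      (𝓝 (coefL2 α β γ δ ε i j z₁ z₂)) := by
  match i, j with
  | .neg, .neg => exact tendsto_coefAW_neg_neg α β γ δ ε hz₁ hz₁' hz₂ hz₂'
  | .neg, .zero => exact tendsto_coefAW_neg_zero α β γ δ ε hz₁ hz₁' hz₂ hz₂'
  | .neg, .pos => exact tendsto_coefAW_neg_pos α β γ δ ε hz₁ hz₁' hz₂ hz₂'
  | .zero, .neg => exact tendsto_coefAW_zero_neg α β γ δ ε hz₁ hz₁' hz₂ hz₂'
  | .zero, .zero => exact tendsto_coefAW_zero_zero α β γ δ ε hz₁ hz₁' hz₂ hz₂'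
  | .zero, .pos => exact tendsto_coefAW_zero_pos α β γ δ ε hz₁ hz₁' hz₂ hz₂'
  | .pos, .neg => exact tendsto_coefAW_pos_neg α β γ δ ε hz₁ hz₁' hz₂ hz₂'
  | .pos, .zero => exact tendsto_coefAW_pos_zero α β γ δ ε hz₁ hz₁' hz₂ hz₂'
  | .pos, .pos => exact tendsto_coefAW_pos_pos α β γ δ ε hz₁ hz₁' hz₂ hz₂'

/-! ### Limits of the eigenvalues and of the operator -/

theorem tendsto_eigAW (α β γ δ ε : ℂ) (n₁ n₂ : ℕ) :
    Tendsto
      (fun t : ℂ =>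
        eigAW n₁ n₂ (qT t) (aT α t) (bT β t) (cT γ t) (dT δ t) (a₂T ε t) / (4 * (1 + qT t)))
      (𝓝[≠] 0) (𝓝 (eigL2 n₁ n₂ α β γ δ ε)) := by
  have hq0 : qT 0 ≠ 0 := by simp [qT_zero]
  have hpow : ∀ m : ℤ, HasDerivAt (fun t => qT t ^ m) (m * (-1) ^ (m - 1) * -1) 0 := fun m => by
    have h := (hasDerivAt_zpow m (qT 0) (.inl hq0)).comp 0 hasDerivAt_qT
    rwa [qT_zero] at h
  have hprod := (((((hasDerivAt_aT α).mul ((hasDerivAt_a₂T ε).pow 2)).mul (hasDerivAt_bT β)).mul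
    (hasDerivAt_cT γ)).mul (hasDerivAt_dT δ)).congr_deriv
    (g' := -2 * α + 2 * β + 2 * γ + 2 * δ + 4 * ε + 2) (by
      simp only [Pi.mul_apply, Pi.pow_apply, aT_zero, bT_zero, cT_zero, dT_zero, a₂T_zero]
      linear_combination (-2 * α + 2 * β + 2 * γ + 2 * δ + 4 * ε + 2) * (Complex.I ^ 2 - 1)
        * Complex.I_sq)
  have hprod0 : aT α 0 * a₂T ε 0 ^ 2 * bT β 0 * cT γ 0 * dT δ 0 = 1 := by
    simp only [aT_zero, bT_zero, cT_zero, dT_zero, a₂T_zero]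
    linear_combination (Complex.I ^ 2 - 1) * Complex.I_sq
  have hder := ((hpow (-(n₁ : ℤ) - n₂)).sub_const 1).mul
    ((hprod.mul (hpow ((n₁ : ℤ) + n₂ - 1))).const_sub 1)
  have h := (tendsto_div_of_hasDerivAt (f := fun t =>
    eigAW n₁ n₂ (qT t) (aT α t) (bT β t) (cT γ t) (dT δ t) (a₂T ε t)) hder ?_).div
    (tendsto_qT_add_one_div.const_mul 4) (by norm_num)
  · refine (h.congr' ?_).trans_eq (congrArg 𝓝 ?_)
    · filter_upwards [self_mem_nhdsWithin] with t ht
      have ht : t ≠ 0 := ht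
      simp only [Pi.div_apply]
      rw [add_comm 1 (qT t), ← mul_div_assoc, div_div_div_cancel_right₀ ht]
    · simp only [Pi.mul_apply, Pi.pow_apply, hprod0, qT_zero]
      rcases Nat.even_or_odd (n₁ + n₂) with hn | hn
      · have hn' : Even ((n₁ : ℤ) + n₂) := by exact_mod_cast hn
        have hneg : Even (-(n₁ : ℤ) - n₂) := by
          rw [show -(n₁ : ℤ) - n₂ = -(n₁ + n₂) by ring]; exact hn'.neg
        rw [eigL2, if_pos hn, hneg.neg_one_zpow, (hneg.sub_odd odd_one).neg_one_zpow,
          (hn'.sub_odd odd_one).neg_one_zpow]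
        push_cast
        ring
      · have hn' : Odd ((n₁ : ℤ) + n₂) := by exact_mod_cast hn
        have hneg : Odd (-(n₁ : ℤ) - n₂) := by
          rw [show -(n₁ : ℤ) - n₂ = -(n₁ + n₂) by ring]; exact hn'.neg
        rw [eigL2, if_neg (Nat.not_even_iff_odd.mpr hn), hneg.neg_one_zpow,
          (hn'.sub_odd odd_one).neg_one_zpow, ((hn'.sub_odd odd_one).sub_odd odd_one).neg_one_zpow]
        push_cast
        ring
  · rcases Nat.even_or_odd (n₁ + n₂) with hn | hn
    · have hneg : Even (-(n₁ : ℤ) - n₂) := by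
        rw [show -(n₁ : ℤ) - n₂ = -(n₁ + n₂ : ℕ) by push_cast; ring]
        exact (show Even ((n₁ + n₂ : ℕ) : ℤ) by exact_mod_cast hn).neg
      simp only [eigAW, qT_zero, hneg.neg_one_zpow, sub_self, zero_mul]
    · have hn' : Odd ((n₁ : ℤ) + n₂) := by exact_mod_cast hn
      have h1 : aT α 0 * a₂T ε 0 ^ 2 * bT β 0 * cT γ 0 * dT δ 0 = 1 := hprod0
      simp only [eigAW, h1, qT_zero, (hn'.sub_odd odd_one).neg_one_zpow]
      ring

/-- In the limit variables, `z ↦ q z` becomes the reflection `z ↦ -z + 1/2`, up to the inversion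
under which the functions acted upon are invariant. -/
theorem qT_mul_zT (z t : ℂ) : qT t * zT z t = (zT (-(z + -1 / 2)) t)⁻¹ := by
  refine eq_inv_of_mul_eq_one_left ?_
  unfold qT zT
  rw [show -Complex.exp t * (Complex.I * Complex.exp (t * (-2 * z)))
      * (Complex.I * Complex.exp (t * (-2 * -(z + -1 / 2))))
      = -(Complex.I * Complex.I) * (Complex.exp t * Complex.exp (t * (-2 * z))
        * Complex.exp (t * (-2 * -(z + -1 / 2)))) by ring,
    ← Complex.exp_add, ← Complex.exp_add, Complex.I_mul_I,
    show t + t * (-2 * z) + t * (-2 * -(z + -1 / 2)) = 0 by ring, Complex.exp_zero]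
  ring

theorem qT_inv_mul_zT (z t : ℂ) : (qT t)⁻¹ * zT z t = (zT (-(z + 1 / 2)) t)⁻¹ := by
  refine eq_inv_of_mul_eq_one_left ?_
  unfold qT zT
  rw [inv_neg, ← Complex.exp_neg, show -Complex.exp (-t) * (Complex.I * Complex.exp (t * (-2 * z)))
      * (Complex.I * Complex.exp (t * (-2 * -(z + 1 / 2))))
      = -(Complex.I * Complex.I) * (Complex.exp (-t) * Complex.exp (t * (-2 * z))
        * Complex.exp (t * (-2 * -(z + 1 / 2)))) by ring,
    ← Complex.exp_add, ← Complex.exp_add, Complex.I_mul_I,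
    show -t + t * (-2 * z) + t * (-2 * -(z + 1 / 2)) = 0 by ring, Complex.exp_zero]
  ring

theorem tendsto_opAW (α β γ δ ε : ℂ) {F : ℂ → ℂ → ℂ → ℂ} {f : ℂ → ℂ → ℂ}
    (hF₁ : ∀ t u v : ℂ, F t u⁻¹ v = F t u v) (hF₂ : ∀ t u v : ℂ, F t u v⁻¹ = F t u v)
    (hF : ∀ z₁ z₂ : ℂ, Tendsto (fun t : ℂ => F t (zT z₁ t) (zT z₂ t)) (𝓝[≠] 0) (𝓝 (f z₁ z₂)))
    {z₁ z₂ : ℂ} (hz₁ : z₁ ≠ 1 / 4) (hz₁' : z₁ ≠ -1 / 4) (hz₂ : z₂ ≠ 1 / 4) (hz₂' : z₂ ≠ -1 / 4) :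
    Tendsto
      (fun t : ℂ =>
        opAW (qT t) (aT α t) (bT β t) (cT γ t) (dT δ t) (a₂T ε t) (F t) (zT z₁ t) (zT z₂ t)
          / (4 * (1 + qT t)))
      (𝓝[≠] 0) (𝓝 (opL2 α β γ δ ε f z₁ z₂)) := by
  have hshift : ∀ i j : SignType, Tendsto
      (fun t => F t (qT t ^ (i : ℤ) * zT z₁ t) (qT t ^ (j : ℤ) * zT z₂ t)) (𝓝[≠] 0)
      (𝓝 (shiftRefl₁ i (shiftRefl₂ j f) z₁ z₂)) := by
    have hneg : ((SignType.neg : SignType) : ℤ) = -1 := rfl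
    have hzero : ((SignType.zero : SignType) : ℤ) = 0 := rfl
    have hpos : ((SignType.pos : SignType) : ℤ) = 1 := rfl
    intro i j
    match i, j with
    | .neg, .neg =>
      refine (hF _ _).congr fun t => ?_
      simp only [hneg, zpow_neg_one, qT_inv_mul_zT, hF₁, hF₂]
    | .neg, .zero =>
      refine (hF _ _).congr fun t => ?_
      simp only [hneg, hzero, zpow_neg_one, zpow_zero, one_mul, qT_inv_mul_zT, hF₁]
    | .neg, .pos =>
      refine (hF _ _).congr fun t => ?_
      simp only [hneg, hpos, zpow_neg_one, zpow_one, qT_inv_mul_zT, qT_mul_zT, hF₁, hF₂]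
    | .zero, .neg =>
      refine (hF _ _).congr fun t => ?_
      simp only [hzero, hneg, zpow_neg_one, zpow_zero, one_mul, qT_inv_mul_zT, hF₂]
    | .zero, .zero =>
      refine (hF _ _).congr fun t => ?_
      simp only [hzero, zpow_zero, one_mul]
    | .zero, .pos =>
      refine (hF _ _).congr fun t => ?_
      simp only [hzero, hpos, zpow_zero, one_mul, zpow_one, qT_mul_zT, hF₂]
    | .pos, .neg =>
      refine (hF _ _).congr fun t => ?_
      simp only [hpos, hneg, zpow_neg_one, zpow_one, qT_inv_mul_zT, qT_mul_zT, hF₁, hF₂]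
    | .pos, .zero =>
      refine (hF _ _).congr fun t => ?_
      simp only [hpos, hzero, zpow_zero, one_mul, zpow_one, qT_mul_zT, hF₁]
    | .pos, .pos =>
      refine (hF _ _).congr fun t => ?_
      simp only [hpos, zpow_one, qT_mul_zT, hF₁, hF₂]
  refine (tendsto_finsetSum _ fun i _ => tendsto_finsetSum _ fun j _ =>
    (tendsto_coefAW α β γ δ ε i j hz₁ hz₁' hz₂ hz₂').mul (hshift i j)).congr fun t => ?_
  simp only [opAW, scaledCoefAW, Finset.sum_div]
  exact Finset.sum_congr rfl fun i _ => Finset.sum_congr rfl fun j _ => by ring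

end BannaiIto

end

theorem mainTheorem2 (α β γ δ ε : ℂ) :
    -- eigenfunctions of `L₁` and `L₂`
    (∀ n₁ n₂ : ℕ,
      (∀ k ∈ Finset.Ioc (n₁ / 2) n₁, β - α + 2 * ε - 1 / 2 + (k : ℂ) ≠ 0) →
      (∀ k ∈ Finset.Ioc (n₂ / 2) n₂, β - α + γ + δ + 2 * ε + (n₁ : ℂ) + (k : ℂ) ≠ 0) →
      bivariateBI n₁ n₂ α β γ δ ε ≠ 0 ∧
      (∀ z₁ z₂ : ℂ, z₁ ≠ 1 / 4 → z₁ ≠ -1 / 4 →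
        opL1 α β ε (bivariateBI n₁ n₂ α β γ δ ε) z₁ z₂
          = eigL1 n₁ α β ε * bivariateBI n₁ n₂ α β γ δ ε z₁ z₂) ∧
      (∀ z₁ z₂ : ℂ, z₁ ≠ 1 / 4 → z₁ ≠ -1 / 4 → z₂ ≠ 1 / 4 → z₂ ≠ -1 / 4 →
        opL2 α β γ δ ε (bivariateBI n₁ n₂ α β γ δ ε) z₁ z₂
          = eigL2 n₁ n₂ α β γ δ ε * bivariateBI n₁ n₂ α β γ δ ε z₁ z₂)) ∧
    -- the coefficients of `L₂` are limits of those of the Askey-Wilson operator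
    (∀ (i j : SignType) (z₁ z₂ : ℂ), z₁ ≠ 1 / 4 → z₁ ≠ -1 / 4 → z₂ ≠ 1 / 4 → z₂ ≠ -1 / 4 →
      Tendsto
        (fun t : ℂ =>
          coefAW (qT t) (aT α t) (bT β t) (cT γ t) (dT δ t) (a₂T ε t) i j (zT z₁ t) (zT z₂ t)
            / (4 * (1 + qT t)))
        (𝓝[≠] 0) (𝓝 (coefL2 α β γ δ ε i j z₁ z₂))) ∧
    -- the eigenvalues of `L₂` are limits of those of the Askey-Wilson operator
    (∀ n₁ n₂ : ℕ,
      Tendsto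
        (fun t : ℂ =>
          eigAW n₁ n₂ (qT t) (aT α t) (bT β t) (cT γ t) (dT δ t) (a₂T ε t) / (4 * (1 + qT t)))
        (𝓝[≠] 0) (𝓝 (eigL2 n₁ n₂ α β γ δ ε))) ∧
    -- `L₂` itself is the limit of the Askey-Wilson operator on functions of `z + z⁻¹`
    (∀ (F : ℂ → ℂ → ℂ → ℂ) (f : ℂ → ℂ → ℂ),
      (∀ t u v : ℂ, F t u⁻¹ v = F t u v) → (∀ t u v : ℂ, F t u v⁻¹ = F t u v) →
      (∀ z₁ z₂ : ℂ, Tendsto (fun t : ℂ => F t (zT z₁ t) (zT z₂ t)) (𝓝[≠] 0) (𝓝 (f z₁ z₂))) →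
      ∀ z₁ z₂ : ℂ, z₁ ≠ 1 / 4 → z₁ ≠ -1 / 4 → z₂ ≠ 1 / 4 → z₂ ≠ -1 / 4 →
        Tendsto
          (fun t : ℂ =>
            opAW (qT t) (aT α t) (bT β t) (cT γ t) (dT δ t) (a₂T ε t) (F t) (zT z₁ t) (zT z₂ t)
              / (4 * (1 + qT t)))
          (𝓝[≠] 0) (𝓝 (opL2 α β γ δ ε f z₁ z₂))) := by
  refine ⟨fun n₁ n₂ h₁ h₂ => ⟨bivariateBI_ne_zero h₁ h₂, fun z₁ z₂ hz₁ hz₁' =>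
    opL1_bivariateBI n₁ n₂ α β γ δ ε z₂ hz₁ hz₁', fun z₁ z₂ hz₁ hz₁' hz₂ hz₂' =>
    opL2_bivariateBI n₁ n₂ α β γ δ ε hz₁ hz₁' hz₂ hz₂'⟩,
    fun i j z₁ z₂ hz₁ hz₁' hz₂ hz₂' => tendsto_coefAW α β γ δ ε i j hz₁ hz₁' hz₂ hz₂',
    fun n₁ n₂ => tendsto_eigAW α β γ δ ε n₁ n₂,
    fun F f hF₁ hF₂ hF z₁ z₂ hz₁ hz₁' hz₂ hz₂' =>
      tendsto_opAW α β γ δ ε hF₁ hF₂ hF hz₁ hz₁' hz₂ hz₂'⟩
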